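/- **Setting.** Let $k$ be a field and let $A$ be a finite-dimensional self-injective $k$-algebra which is split (endomorphism rings of simple modules are $k$) and has no projective simple module. All modules are finitely generated. Let $A\text{-stab}$ be the stable category: its objects are the finitely generated $A$-modules, and its morphisms are the $A$-linear maps modulo those which factor through a projective module. It is triangulated with shift $[1]=\Omega^{-1}$, the distinguished triangles being those isomorphic to the ones given by short exact sequences of modules. For a set $\mathcal S$ of objects, $\operatorname{add}\mathcal S$ denotes the objects isomorphic to finite direct sums of objects of $\mathcal S$. A module $M$ is *filtrable* if it has a filtration $0=M_r\subseteq\cdots\subseteq M_1\subseteq M_0=M$ with all $M_i/M_{i+1}\in\operatorname{add}\mathcal S$. Let $\mathcal S$ be a finite set of indecomposable $A$-modules such that * $\operatorname{Hom}_{A\text{-stab}}(S,T)=k^{\delta_{S,T}}$ for $S,T\in\mathcal S$, and * for every $A$-module $M$ there is a projective $A$-module $P$ such that $M\oplus P$ is filtrable. **The category $\mathcal G$.** An $\mathcal S$-*radical filtration* of $M$ is a filtration $0=M_r\subseteq\cdots\subseteq M_0=M$ in which each $M_{i+1}$ is minimal among the filtrable submodules $L$ of $M_i$ with $M_i/L\in\operatorname{add}\mathcal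 S$. Put $\bar M_i=M_i/M_{i+1}$. The objects of $\mathcal G$ are the modules with a fixed $\mathcal S$-radical filtration. $\operatorname{Hom}_{\mathcal G}(M,N)=\bigoplus_{d\ge0}\operatorname{Hom}_{\mathcal G}(M,N)_d$, where $\operatorname{Hom}_{\mathcal G}(M,N)_d$ is the image in $\operatorname{Hom}_{A\text{-stab}}(\bar M_0,\bar N_d)$ of the set of linear maps $\tilde f:M\to N_d$ with $\tilde f(M_i)\subseteq N_{d+i}$ for all $i$. The composite of $g\in\operatorname{Hom}_{\mathcal G}(L,M)_e$ and $f\in\operatorname{Hom}_{\mathcal G}(M,N)_d$ is $\bar M_e\to\bar N_{d+e}$ composed with $g$, where $\bar M_e\to\bar N_{d+e}$ is induced by any filtered map $\tilde f$ representing $f$ (its stable class does not depend on the choice of $\tilde f$). **The category $\mathcal F$.** Let $\mathcal T$ be a triangulated category and $\mathcal S$ a set of objects of $\mathcal T$. The objects of $\mathcal F=\mathcal F(\mathcal T,\mathcal S)$ are the sequences $\cdots\to M_2\xrightarrow{f_2}M_1\xrightarrow{f_1}M_0$ with $M_i=0$ for $i\gg0$, together with distinguished triangles $M_{i+1}\xrightarrow{f_{i+1}}M_i\xrightarrow{\varepsilon_i}N_i\xrightarrow{\delta_i}M_{i+1}[1]$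 for $i\ge0$, such that $N_i\in\operatorname{add}\mathcal S$ for all $i\ge 0$, and for all $S\in\mathcal S$ the map $\operatorname{Hom}(N_i,S)\to\operatorname{Hom}(M_i,S)$ given by $\varepsilon_i$ is surjective for $i=0$ and bijective for $i\ge1$. $\operatorname{Hom}_{\mathcal F}(M,M')=\bigoplus_{d\ge0}\operatorname{Hom}_{\mathcal F}(M,M')_d$, where $\operatorname{Hom}_{\mathcal F}(M,M')_d$ consists of those $g_0:N_0\to N'_d$ for which there is $h_0:M_0\to M'_d$ with $\varepsilon'_dh_0=g_0\varepsilon_0$. Such a $g_0$ extends to morphisms $h_i:M_i\to M'_{d+i}$ and $g_i:N_i\to N'_{d+i}$ $(i\ge0)$ commuting with all $f$, $\varepsilon$, $\delta$, and the $g_i$ depend only on $g_0$. The composite of $g_0\in\operatorname{Hom}_{\mathcal F}(M,M')_d$ and $g'_0\in\operatorname{Hom}_{\mathcal F}(M',M'')_e$ is $g'_d\circ g_0$. **Theorem.** Let $\mathcal T=A\text{-stab}$. 1. For every module with an $\mathcal S$-radical filtration, the sequence of the modules $M_i$ with their inclusions, and the triangles given by $0\to M_{i+1}\to M_i\to\bar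 M_i\to0$, form an object of $\mathcal F(\mathcal T,\mathcal S)$; and the resulting canonical functor $\mathcal G\to\mathcal F(\mathcal T,\mathcal S)$, which is the inclusion $\operatorname{Hom}_{\mathcal G}(M,N)_d\subseteq\operatorname{Hom}_{\mathcal F}(M,N)_d\subseteq\operatorname{Hom}_{A\text{-stab}}(\bar M_0,\bar N_d)$ in each degree, is an equivalence of categories. 2. Consequently $\mathcal G$ depends only on the triangulated category $A\text{-stab}$ and on $\mathcal S$: if $B$ is another such $k$-algebra with such a set $\mathcal S'$ of $B$-modules, and if $E:A\text{-stab}\to B\text{-stab}$ is an equivalence of triangulated categories under which the isomorphism classes of the objects of $\mathcal S$ and those of the objects of $\mathcal S'$ correspond, then the categories $\mathcal G$ of $(A,\mathcal S)$ and of $(B,\mathcal S')$ are equivalent. -/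

import Mathlib

universe w v u

set_option linter.unusedSectionVars false

section

namespace SelfInj

section

variable {k : Type w} {A : Type u} [Field k] [Ring A] [Algebra k A]

/-- For a functional `φ` on `L`, some nonzero left ideal is killed on the right by the annihilator
of `φ`. -/
theorem exists_killed [Module.Finite k A] [Module.Injective A A] {L : Type u} [AddCommGroup L]
    [Module A L] [Module k L] [IsScalarTower k A L] (φ : L →ₗ[k] k) (hφ : φ ≠ 0) :
    ∃ S : Submodule A A, IsSimpleModule A S ∧
      ∀ x ∈ S, ∀ c : A, (∀ v : L, φ (c • v) = 0) → x * c = 0 := by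
  have : IsArtinianRing A := IsArtinianRing.of_finite k A
  let I : Submodule k A :=
    { carrier := {c | ∀ v : L, φ (c • v) = 0}
      add_mem' := fun {a b} ha hb v => by simp [add_smul, ha v, hb v]
      zero_mem' := fun v => by simp
      smul_mem' := fun t c hc v => by simp [hc v] }
  obtain ⟨n, a, ha⟩ := Submodule.fg_iff_exists_fin_generating_family.mp
    (IsNoetherian.noetherian I)
  let l : A →ₗ[A] (Fin n → A) := LinearMap.pi fun i => LinearMap.toSpanSingleton A A (a i)
  let T : Submodule A A :=
    { carrier := {x | ∀ c ∈ I, x * c = 0}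
      add_mem' := fun {x y} hx hy c hc => by simp [add_mul, hx c hc, hy c hc]
      zero_mem' := fun c _ => by simp
      smul_mem' := fun b x hx c hc => by simp [mul_assoc, hx c hc] }
  have hT : T ≠ ⊥ := by
    intro hT
    have hl : Function.Injective l := by
      rw [← LinearMap.ker_eq_bot, eq_bot_iff, ← hT]
      intro x hx c hc
      have hx' : ∀ i, x * a i = 0 := fun i => by
        have := congrFun (LinearMap.mem_ker.mp hx) i
        simpa [l] using this
      have : I ≤ LinearMap.ker (LinearMap.mulLeft k x) := by
        rw [← ha, Submodule.span_le]
        rintro _ ⟨i, rfl⟩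
        simpa using hx' i
      simpa using this hc
    obtain ⟨g, hg⟩ := Module.Injective.extension_property A A A (Fin n → A) l hl LinearMap.id
    have h1 : (1 : A) ∈ I := by
      have e : (1 : A) = ∑ i, a i * g (Pi.single i 1) := by
        have h := LinearMap.congr_fun hg 1
        simp only [LinearMap.comp_apply, LinearMap.id_apply] at h
        have hl1 : l 1 = ∑ i, a i • (Pi.single i (1 : A) : Fin n → A) := by
          ext j
          simp [l, Finset.sum_apply, Pi.single_apply]
        rw [hl1, map_sum] at h
        simpa only [map_smul, smul_eq_mul] using h.symm
      rw [e]
      refine I.sum_mem fun i _ => ?_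
      have hi : a i ∈ I := ha ▸ Submodule.subset_span ⟨i, rfl⟩
      intro v
      rw [mul_smul]
      exact hi _
    apply hφ
    ext v
    simpa using h1 v
  obtain ⟨S, hS, hST⟩ := (IsAtomic.eq_bot_or_exists_atom_le T).resolve_left hT
  exact ⟨S, isSimpleModule_iff_isAtom.mpr hS, fun x hx c hc => hST hx c hc⟩

theorem exists_smul_functional {L : Type u} [AddCommGroup L]
    [Module A L] [Module k L] [IsScalarTower k A L] [IsSimpleModule A L] [Module.Finite k L]
    (φ ψ : L →ₗ[k] k) (hψ : ψ ≠ 0) : ∃ a : A, ∀ v, φ v = ψ (a • v) := by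
  let T : A →ₗ[k] Module.Dual k L :=
    LinearMap.mk₂ k (fun a v => ψ (a • v)) (by simp [add_smul]) (by simp) (by simp)
      (fun t a v => by
        have : a • t • v = t • a • v := by
          rw [← algebraMap_smul A t v, ← algebraMap_smul A t (a • v), ← mul_smul, ← mul_smul,
            Algebra.commutes]
        simp [this])
  have hco : (LinearMap.range T).dualCoannihilator = ⊥ := by
    let N : Submodule A L :=
      { carrier := {v | ∀ a : A, ψ (a • v) = 0}
        add_mem' := fun {x y} hx hy a => by simp [hx a, hy a]
        zero_mem' := fun a => by simp
        smul_mem' := fun b x hx a => by rw [← mul_smul]; exact hx _ }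
    have hN : N = ⊥ := (eq_bot_or_eq_top N).resolve_right fun h => hψ <| by
      ext v
      have : v ∈ N := h ▸ Submodule.mem_top
      simpa using this 1
    rw [eq_bot_iff]
    intro v hv
    have : v ∈ N := fun a => by
      rw [Submodule.mem_dualCoannihilator] at hv
      exact hv _ ⟨a, rfl⟩
    simpa [hN] using this
  have : LinearMap.range T = ⊤ := by
    rw [← Subspace.dualCoannihilator_dualAnnihilator_eq (W := LinearMap.range T), hco]
    simp
  obtain ⟨a, ha⟩ := LinearMap.range_eq_top.mp this φ
  exact ⟨a, fun v => by rw [← ha]; rfl⟩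

theorem iso_of_annihilator {L K : Type u} [AddCommGroup L]
    [Module A L] [Module k L] [IsScalarTower k A L] [IsSimpleModule A L] [Module.Finite k L]
    [AddCommGroup K] [Module A K] [IsSimpleModule A K]
    (h : ∀ c : A, (∀ v : L, c • v = 0) → ∀ v : K, c • v = 0) : Nonempty (L ≃ₗ[A] K) := by
  let b := Module.finBasis k L
  let l : A →ₗ[A] (Fin (Module.finrank k L) → L) :=
    LinearMap.pi fun i => LinearMap.toSpanSingleton A L (b i)
  have hl : ∀ c, l c = 0 → ∀ v : L, c • v = 0 := by
    intro c hc v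
    let m : L →ₗ[k] L :=
      { toFun := fun v => c • v
        map_add' := by simp
        map_smul' := fun t v => by
          simp only [RingHom.id_apply]
          rw [← algebraMap_smul A t v, ← algebraMap_smul A t (c • v), ← mul_smul, ← mul_smul,
            Algebra.commutes] }
    have : m = 0 := b.ext fun i => by
      have := congrFun hc i
      simpa [l] using! this
    exact LinearMap.congr_fun this v
  have : Nontrivial K := IsSimpleModule.nontrivial A K
  obtain ⟨v, hv⟩ := exists_ne (0 : K)
  have hker : LinearMap.ker l.rangeRestrict ≤ LinearMap.ker (LinearMap.toSpanSingleton A K v) := by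
    intro c hc
    rw [LinearMap.ker_rangeRestrict] at hc
    simpa using h c (hl c hc) v
  let e := LinearMap.quotKerEquivOfSurjective l.rangeRestrict l.surjective_rangeRestrict
  let q : LinearMap.range l →ₗ[A] K := (Submodule.liftQ _ _ hker) ∘ₗ e.symm.toLinearMap
  have hq : q ≠ 0 := by
    intro h0
    apply hv
    have := LinearMap.congr_fun h0 (e (Submodule.Quotient.mk 1))
    simpa [q] using this
  have : IsSemisimpleModule A (LinearMap.range l) := inferInstance
  obtain ⟨S, ⟨eS⟩⟩ := LinearMap.linearEquiv_of_ne_zero hq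
  have : Nontrivial S := eS.symm.toEquiv.nontrivial
  obtain ⟨s, hs⟩ := exists_ne (0 : S)
  have : ∃ i, ((s : LinearMap.range l) : Fin (Module.finrank k L) → L) i ≠ 0 := by
    by_contra hcon
    push Not at hcon
    exact hs (Subtype.ext (Subtype.ext (funext hcon)))
  obtain ⟨i, hi⟩ := this
  let p : K →ₗ[A] L :=
    LinearMap.proj i ∘ₗ (LinearMap.range l).subtype ∘ₗ S.subtype ∘ₗ eS.toLinearMap
  have hp : p ≠ 0 := fun h0 => hi <| by
    have := LinearMap.congr_fun h0 (eS.symm s)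
    simpa [p] using this
  exact ⟨(LinearEquiv.ofBijective p (LinearMap.bijective_of_ne_zero hp)).symm⟩

theorem iso_of_iso [Module.Injective A A] {L K : Type u} [AddCommGroup L]
    [Module A L] [Module k L] [IsScalarTower k A L] [IsSimpleModule A L] [Module.Finite k L]
    [AddCommGroup K] [Module A K] [Module k K] [IsScalarTower k A K] [IsSimpleModule A K]
    [Module.Finite k K] (φ : L →ₗ[k] k) (ψ : K →ₗ[k] k) (hψ : ψ ≠ 0)
    (S T : Submodule A A) [IsSimpleModule A S]
    (hS : ∀ x ∈ S, ∀ c : A, (∀ v : L, φ (c • v) = 0) → x * c = 0)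
    (hT : ∀ x ∈ T, ∀ c : A, (∀ v : K, ψ (c • v) = 0) → x * c = 0)
    (e : S ≃ₗ[A] T) : Nonempty (L ≃ₗ[A] K) := by
  have key : ∀ {L : Type u} [AddCommGroup L] [Module A L] [Module k L] [IsScalarTower k A L]
      [IsSimpleModule A L] [Module.Finite k L] (φ : L →ₗ[k] k) (S : Submodule A A)
      (_ : ∀ x ∈ S, ∀ c : A, (∀ v : L, φ (c • v) = 0) → x * c = 0) (x : A) (_ : x ∈ S)
      (_ : x ≠ 0) (c : A), x * c = 0 → ∀ v : L, φ (c • v) = 0 := by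
    intro L _ _ _ _ _ _ φ S hS x hx hx0 c hc
    by_contra hcon
    let ψ : L →ₗ[k] k :=
      { toFun := fun v => φ (c • v)
        map_add' := by simp
        map_smul' := fun t v => by
          have : c • t • v = t • c • v := by
            rw [← algebraMap_smul A t v, ← algebraMap_smul A t (c • v), ← mul_smul, ← mul_smul,
              Algebra.commutes]
          simp [this] }
    have hψ : ψ ≠ 0 := fun h => hcon fun v => LinearMap.congr_fun h v
    obtain ⟨a, ha⟩ := exists_smul_functional (A := A) φ ψ hψ
    have h1 := hS x hx (1 - c * a) fun v => by
      have := ha v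
      simp only [ψ, LinearMap.coe_mk, AddHom.coe_mk] at this
      rw [sub_smul, one_smul, map_sub, mul_smul, ← this, sub_self]
    rw [mul_sub, mul_one, ← mul_assoc, hc, zero_mul, sub_zero] at h1
    exact hx0 h1
  have : Nontrivial S := IsSimpleModule.nontrivial A S
  obtain ⟨x, hx⟩ := exists_ne (0 : S)
  obtain ⟨g, hg⟩ := Module.Injective.extension_property A A S A S.subtype S.subtype_injective
    (T.subtype ∘ₗ e.toLinearMap)
  have hgx : ((e x : T) : A) = x * g 1 := by
    have := LinearMap.congr_fun hg x
    simp only [LinearMap.comp_apply, Submodule.subtype_apply, LinearEquiv.coe_coe] at this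
    rw [← this, ← smul_eq_mul, ← map_smul, smul_eq_mul, mul_one]
  have hx0 : (x : A) ≠ 0 := fun h => hx (Subtype.ext h)
  have hy0 : ((e x : T) : A) ≠ 0 := fun h => hx (e.map_eq_zero_iff.mp (Subtype.ext h))
  set a := g 1
  apply iso_of_annihilator (k := k)
  intro c hc
  let N : Submodule A K :=
    { carrier := {v | ∀ b : A, ψ (b • v) = 0}
      add_mem' := fun {x y} hx hy a => by simp [hx a, hy a]
      zero_mem' := fun a => by simp
      smul_mem' := fun b x hx a => by rw [← mul_smul]; exact hx _ }
  have hN : N = ⊥ := (eq_bot_or_eq_top N).resolve_right fun h => hψ <| by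
    ext v
    have : v ∈ N := h ▸ Submodule.mem_top
    simpa using this 1
  intro v
  have hv : c • v ∈ N := fun b => by
    rw [← mul_smul]
    refine key ψ T hT _ (e x).2 hy0 (b * c) ?_ v
    rw [hgx, mul_assoc]
    refine hS x x.2 _ fun v => ?_
    rw [← mul_assoc, mul_smul, hc, smul_zero, map_zero]
  simpa [hN] using hv

end

section

variable (A : Type u) [Ring A]

/-- Isomorphism of simple quotients of the regular module. -/
def isoSetoid : Setoid {m : Submodule A A // IsCoatom m} where
  r m n := Nonempty ((A ⧸ m.1) ≃ₗ[A] (A ⧸ n.1))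
  iseqv := ⟨fun _ => ⟨.refl _ _⟩, fun ⟨e⟩ => ⟨e.symm⟩, fun ⟨e⟩ ⟨f⟩ => ⟨e.trans f⟩⟩

theorem finite_types [IsArtinianRing A] : Finite (Quotient (isoSetoid A)) := by
  have hss : IsSemisimpleModule A (A ⧸ Module.jacobson A A) :=
    (IsArtinian.isSemisimpleModule_iff_jacobson _ _).mpr (Module.jacobson_quotient_jacobson A A)
  have h : ∀ m : {m : Submodule A A // IsCoatom m}, ∃ S : Submodule A (A ⧸ Module.jacobson A A),
      Nonempty ((A ⧸ m.1) ≃ₗ[A] S) := by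
    intro m
    have hle : Module.jacobson A A ≤ m.1 := sInf_le m.2
    have : IsSimpleModule A (A ⧸ m.1) := isSimpleModule_iff_isCoatom.mpr m.2
    have : Nontrivial (A ⧸ m.1) := IsSimpleModule.nontrivial A _
    refine LinearMap.linearEquiv_of_ne_zero (f := Submodule.factor hle) ?_
    intro h0
    obtain ⟨y, hy⟩ := exists_ne (0 : A ⧸ m.1)
    obtain ⟨y, rfl⟩ := Submodule.factor_surjective hle y
    exact hy (by rw [h0]; rfl)
  choose S eS using h
  have hS : ∀ m, IsSimpleModule A (S m) := fun m => by
    have : IsSimpleModule A (A ⧸ m.1) := isSimpleModule_iff_isCoatom.mpr m.2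
    exact IsSimpleModule.congr (eS m).some.symm
  let F : Quotient (isoSetoid A) → isotypicComponents A (A ⧸ Module.jacobson A A) := fun q =>
    ⟨isotypicComponent A _ (S q.out), ⟨S q.out, hS _, rfl⟩⟩
  refine Finite.of_injective F fun p q hpq => ?_
  have hpq' : isotypicComponent A (A ⧸ Module.jacobson A A) (S p.out) =
      isotypicComponent A _ (S q.out) := congrArg Subtype.val hpq
  have h1 := (S p.out).le_isotypicComponent
  rw [hpq'] at h1
  have := hS p.out
  have := hS q.out
  have h2 := isIsotypicOfType_submodule_iff.mp
    (IsIsotypicOfType.isotypicComponent (R := A) (M := A ⧸ Module.jacobson A A)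
      (S := S q.out)) _ h1
  rw [← Quotient.out_equiv_out]
  exact ⟨(eS _).some.trans (h2.some.trans (eS _).some.symm)⟩

theorem exists_simple_embedding (k : Type w) (A : Type u) [Field k] [Ring A] [Algebra k A]
    [Module.Finite k A] [Module.Injective A A] (m : Submodule A A) (hm : IsCoatom m) :
    ∃ f : (A ⧸ m) →ₗ[A] A, Function.Injective f := by
  have : IsArtinianRing A := IsArtinianRing.of_finite k A
  have := finite_types A
  have hs : ∀ m : {m : Submodule A A // IsCoatom m}, IsSimpleModule A (A ⧸ m.1) :=
    fun m => isSimpleModule_iff_isCoatom.mpr m.2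
  have hφ : ∀ m : {m : Submodule A A // IsCoatom m}, ∃ φ : (A ⧸ m.1) →ₗ[k] k, φ ≠ 0 := by
    intro m
    have : Nontrivial (A ⧸ m.1) := IsSimpleModule.nontrivial A _
    exact exists_ne (0 : Module.Dual k (A ⧸ m.1))
  choose φ hφ using hφ
  choose S hSs hS using fun m => exists_killed (A := A) (φ m) (hφ m)
  have hn : ∀ m, ∃ n : {m : Submodule A A // IsCoatom m}, Nonempty (S m ≃ₗ[A] (A ⧸ n.1)) := by
    intro m
    obtain ⟨n, hn, e⟩ := isSimpleModule_iff_quot_maximal.mp (hSs m)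
    exact ⟨⟨n, Ideal.isMaximal_def.mp hn⟩, e⟩
  choose n en using hn
  let F : Quotient (isoSetoid A) → Quotient (isoSetoid A) := fun q => Quotient.mk _ (n q.out)
  have hF : Function.Injective F := by
    intro p q hpq
    obtain ⟨e⟩ := Quotient.exact hpq
    have := hSs p.out
    rw [← Quotient.out_equiv_out]
    exact iso_of_iso (φ p.out) (φ q.out) (hφ _) (S p.out) (S q.out) (hS _) (hS _)
      (((en p.out).some.trans e).trans (en q.out).some.symm)
  obtain ⟨q, hq⟩ := Finite.surjective_of_injective hF (Quotient.mk _ ⟨m, hm⟩)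
  obtain ⟨e⟩ := Quotient.exact hq
  exact ⟨(S q.out).subtype ∘ₗ ((en q.out).some.trans e).symm.toLinearMap,
    (S q.out).subtype_injective.comp (LinearEquiv.injective _)⟩

/-- Over a self-injective algebra every finitely generated module embeds in a free module of finite
rank. -/
theorem exists_embedding (k : Type w) (A : Type u) [Field k] [Ring A] [Algebra k A]
    [Module.Finite k A] [Module.Injective A A] (M : Type u) [AddCommGroup M] [Module A M] [Module.Finite A M] :
    ∃ (n : ℕ) (f : M →ₗ[A] (Fin n → A)), Function.Injective f := by
  have : IsArtinianRing A := IsArtinianRing.of_finite k A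
  have sep : ∀ x : M, x ≠ 0 → ∃ f : M →ₗ[A] A, f x ≠ 0 := by
    intro x hx
    let l := LinearMap.toSpanSingleton A M x
    have hl : LinearMap.ker l ≠ ⊤ := fun h => hx <| by
      have : (1 : A) ∈ LinearMap.ker l := h ▸ Submodule.mem_top
      simpa [l] using this
    obtain ⟨m, hm, hle⟩ := (eq_top_or_exists_le_coatom (LinearMap.ker l)).resolve_left hl
    obtain ⟨j, hj⟩ := exists_simple_embedding k A m hm
    let e := LinearMap.quotKerEquivRange l
    let g : LinearMap.range l →ₗ[A] A := j ∘ₗ Submodule.factor hle ∘ₗ e.symm.toLinearMap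
    obtain ⟨f, hf⟩ := Module.Injective.extension_property A A _ M (LinearMap.range l).subtype
      (LinearMap.range l).subtype_injective g
    refine ⟨f, fun h0 => hm.1 ?_⟩
    have h1 := LinearMap.congr_fun hf (e (Submodule.Quotient.mk 1))
    have h2 : ((e (Submodule.Quotient.mk 1) : LinearMap.range l) : M) = x := by simp [e, l]
    simp only [LinearMap.comp_apply, Submodule.subtype_apply, g, LinearEquiv.coe_coe,
      LinearEquiv.symm_apply_apply, h2, h0] at h1
    have h3 : Submodule.factor hle (Submodule.Quotient.mk 1) = 0 := hj (by rw [← h1, map_zero])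
    have h4 : (1 : A) ∈ m := (Submodule.Quotient.mk_eq_zero m).mp h3
    exact (Ideal.eq_top_iff_one m).mpr h4
  have hmin : ∃ s : Finset (M →ₗ[A] A), ∀ t : Finset (M →ₗ[A] A),
      ¬ (⨅ f ∈ t, LinearMap.ker f) < ⨅ f ∈ s, LinearMap.ker f := by
    obtain ⟨_, ⟨s, rfl⟩, hs⟩ := WellFounded.has_min
      (wellFounded_lt : WellFounded ((· < ·) : Submodule A M → Submodule A M → Prop))
      (Set.range fun s : Finset (M →ₗ[A] A) => ⨅ f ∈ s, LinearMap.ker f) ⟨_, ∅, rfl⟩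
    exact ⟨s, fun t => hs _ ⟨t, rfl⟩⟩
  obtain ⟨s, hs⟩ := hmin
  refine ⟨s.card, LinearMap.pi fun i => (s.equivFin.symm i).1, ?_⟩
  rw [← LinearMap.ker_eq_bot, eq_bot_iff]
  intro x hx
  by_contra hx0
  obtain ⟨f, hf⟩ := sep x hx0
  classical
  apply hs (insert f s)
  rw [Finset.iInf_insert]
  refine lt_of_le_of_ne inf_le_right fun h => hf ?_
  have : x ∈ ⨅ f ∈ s, LinearMap.ker f := by
    simp only [Submodule.mem_iInf, LinearMap.mem_ker]
    intro g hg
    have := congrFun (LinearMap.mem_ker.mp hx) (s.equivFin ⟨g, hg⟩)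
    simpa using this
  rw [← h] at this
  exact this.1

end

end SelfInj

end

section

open CategoryTheory CategoryTheory.Limits

section Linear

variable {A : Type u} [Ring A]
variable {M N L : Type u} [AddCommGroup M] [Module A M] [AddCommGroup N] [Module A N]
  [AddCommGroup L] [Module A L]

/-- A linear map is projective if it factors through a finitely generated projective module. -/
def IsProjectiveMap (f : M →ₗ[A] N) : Prop :=
  ∃ (P : Type u) (_ : AddCommGroup P) (_ : Module A P),
    Module.Finite A P ∧ Module.Projective A P ∧
      ∃ (a : M →ₗ[A] P) (b : P →ₗ[A] N), b ∘ₗ a = f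

namespace IsProjectiveMap

theorem of_factor {P : Type u} [AddCommGroup P] [Module A P] [Module.Finite A P]
    [Module.Projective A P] (a : M →ₗ[A] P) (b : P →ₗ[A] N) : IsProjectiveMap (b ∘ₗ a) :=
  ⟨P, _, _, inferInstance, inferInstance, a, b, rfl⟩

theorem zero : IsProjectiveMap (0 : M →ₗ[A] N) := by
  simpa using of_factor (P := PUnit.{u + 1}) (0 : M →ₗ[A] PUnit.{u + 1}) (0 : PUnit.{u + 1} →ₗ[A] N)

theorem add {f g : M →ₗ[A] N} (hf : IsProjectiveMap f) (hg : IsProjectiveMap g) :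
    IsProjectiveMap (f + g) := by
  obtain ⟨P, _, _, _, _, a, b, rfl⟩ := hf
  obtain ⟨Q, _, _, _, _, c, d, rfl⟩ := hg
  have := of_factor (P := P × Q) (a.prod c) (b.coprod d)
  rwa [LinearMap.coprod_comp_prod] at this

theorem neg {f : M →ₗ[A] N} (hf : IsProjectiveMap f) : IsProjectiveMap (-f) := by
  obtain ⟨P, _, _, _, _, a, b, rfl⟩ := hf
  exact ⟨P, _, _, inferInstance, inferInstance, a, -b, by rw [LinearMap.neg_comp]⟩

theorem sub {f g : M →ₗ[A] N} (hf : IsProjectiveMap f) (hg : IsProjectiveMap g) :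
    IsProjectiveMap (f - g) := by
  rw [sub_eq_add_neg]; exact hf.add hg.neg

theorem comp_left {f : M →ₗ[A] N} (hf : IsProjectiveMap f) (g : N →ₗ[A] L) :
    IsProjectiveMap (g ∘ₗ f) := by
  obtain ⟨P, _, _, _, _, a, b, rfl⟩ := hf
  exact of_factor a (g ∘ₗ b)

theorem comp_right {f : M →ₗ[A] N} (hf : IsProjectiveMap f) (g : L →ₗ[A] M) :
    IsProjectiveMap (f ∘ₗ g) := by
  obtain ⟨P, _, _, _, _, a, b, rfl⟩ := hf
  exact of_factor (a ∘ₗ g) b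

end IsProjectiveMap

theorem exists_desc {f : M →ₗ[A] N} {g : N →ₗ[A] L} (hfg : Function.Exact f g)
    (hg : Function.Surjective g) {W : Type u} [AddCommGroup W] [Module A W] (h : N →ₗ[A] W)
    (hf : h ∘ₗ f = 0) : ∃ s : L →ₗ[A] W, s ∘ₗ g = h := by
  have hle : LinearMap.ker g ≤ LinearMap.ker h := by
    rw [hfg.linearMap_ker_eq]
    rintro _ ⟨x, rfl⟩
    exact LinearMap.congr_fun hf x
  let e := LinearMap.quotKerEquivOfSurjective g hg
  refine ⟨(Submodule.liftQ _ _ hle) ∘ₗ e.symm.toLinearMap, ?_⟩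
  ext x
  have : e.symm (g x) = Submodule.Quotient.mk x := by
    rw [LinearEquiv.symm_apply_eq]; rfl
  simp [this]

end Linear

section Stab

variable (k : Type w) (A : Type u) [Ring A]

/-- Two homomorphisms are identified if their difference is a projective map. -/
def stableRel : HomRel (FGModuleCat.{u} A) :=
  fun _ _ f g => IsProjectiveMap (f.hom.hom - g.hom.hom)

instance : Congruence (stableRel A) where
  equivalence :=
    { refl := fun f => by simpa [stableRel] using IsProjectiveMap.zero
      symm := fun {f g} h => by
        have := IsProjectiveMap.neg h
        rwa [neg_sub] at this
      trans := fun {f g h} h₁ h₂ => by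
        have := IsProjectiveMap.add h₁ h₂
        rwa [sub_add_sub_cancel] at this }
  comp_left f g g' h := by
    have := IsProjectiveMap.comp_right h f.hom.hom
    rwa [LinearMap.sub_comp] at this
  comp_right f h := by
    have := IsProjectiveMap.comp_left h f.hom.hom
    rwa [LinearMap.comp_sub] at this

/-- The stable category: finitely generated modules, with the homomorphisms modulo those which
factor through a projective module. -/
def Stab (_k : Type w) (A : Type u) [Ring A] : Type (u + 1) := Quotient (stableRel A)

noncomputable instance : Category.{u} (Stab k A) := inferInstanceAs (Category (Quotient (stableRel A)))

theorem stableRel_add ⦃X Y : FGModuleCat.{u} A⦄ (f₁ f₂ g₁ g₂ : X ⟶ Y) (h : stableRel A f₁ f₂)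
    (h' : stableRel A g₁ g₂) : stableRel A (f₁ + g₁) (f₂ + g₂) := by
  have := IsProjectiveMap.add h h'
  rwa [sub_add_sub_comm] at this

noncomputable instance : Preadditive (Stab k A) :=
  Quotient.preadditive (stableRel A) (stableRel_add A)

/-- The quotient functor. -/
noncomputable def toStab : FGModuleCat.{u} A ⥤ Stab k A := Quotient.functor (stableRel A)

instance : (toStab k A).Additive := Quotient.functor_additive (stableRel A) (stableRel_add A)

noncomputable instance [Field k] [Algebra k A] : Linear k (Stab k A) :=
  letI : Preadditive (Quotient (stableRel A)) :=
    Quotient.preadditive (stableRel A) (stableRel_add A)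
  letI : (Quotient.functor (stableRel A)).Additive :=
    Quotient.functor_additive (stableRel A) (stableRel_add A)
  Quotient.linear k (stableRel A) (fun c X Y f₁ f₂ h => by
    have := IsProjectiveMap.comp_left h (c • 𝟙 Y : Y ⟶ Y).hom.hom
    rw [LinearMap.comp_sub] at this
    have e : ∀ f : X ⟶ Y, (c • f).hom.hom = (c • 𝟙 Y : Y ⟶ Y).hom.hom ∘ₗ f.hom.hom := fun f => by
      rw [← FGModuleCat.hom_hom_comp, Linear.comp_smul, Category.comp_id]
    change IsProjectiveMap _
    rwa [e, e])

/-- A finitely generated module, as an object of the stable category. -/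
noncomputable abbrev stabObj (M : Type u) [AddCommGroup M] [Module A M] [Module.Finite A M] :
    Stab k A :=
  (toStab k A).obj (FGModuleCat.of A M)

theorem stab_exists_rep (X : Stab k A) : ∃ M : FGModuleCat.{u} A, X = stabObj k A M := ⟨X.as, rfl⟩

section

variable {A}
variable {M N L : Type u} [AddCommGroup M] [Module A M] [Module.Finite A M]
  [AddCommGroup N] [Module A N] [Module.Finite A N]
  [AddCommGroup L] [Module A L] [Module.Finite A L]

/-- The class of a homomorphism in the stable category. -/
noncomputable def stabMap (f : M →ₗ[A] N) : stabObj k A M ⟶ stabObj k A N :=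
  (toStab k A).map (FGModuleCat.ofHom f)

theorem stabMap_surjective (g : stabObj k A M ⟶ stabObj k A N) :
    ∃ f : M →ₗ[A] N, stabMap k f = g := by
  obtain ⟨f, hf⟩ := (Quotient.functor (stableRel A)).map_surjective g
  exact ⟨f.hom.hom, hf⟩

theorem stabMap_eq_iff (f g : M →ₗ[A] N) : stabMap k f = stabMap k g ↔ IsProjectiveMap (f - g) :=
  Quotient.functor_map_eq_iff (stableRel A) _ _

@[simp] theorem stabMap_id : stabMap k (LinearMap.id : M →ₗ[A] M) = 𝟙 _ := (toStab k A).map_id _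

theorem stabMap_comp (f : M →ₗ[A] N) (g : N →ₗ[A] L) :
    stabMap k (g ∘ₗ f) = stabMap k f ≫ stabMap k g := (toStab k A).map_comp (FGModuleCat.ofHom f) (FGModuleCat.ofHom g)

theorem stabMap_add (f g : M →ₗ[A] N) : stabMap k (f + g) = stabMap k f + stabMap k g :=
  (toStab k A).map_add (f := FGModuleCat.ofHom f) (g := FGModuleCat.ofHom g)

theorem stabMap_sub (f g : M →ₗ[A] N) : stabMap k (f - g) = stabMap k f - stabMap k g :=
  (toStab k A).map_sub (f := FGModuleCat.ofHom f) (g := FGModuleCat.ofHom g)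

theorem stabMap_neg (f : M →ₗ[A] N) : stabMap k (-f) = -stabMap k f :=
  (toStab k A).map_neg (f := FGModuleCat.ofHom f)

@[simp] theorem stabMap_zero : stabMap k (0 : M →ₗ[A] N) = 0 :=
  (toStab k A).map_zero _ _

theorem stabMap_eq_zero_iff (f : M →ₗ[A] N) : stabMap k f = 0 ↔ IsProjectiveMap f := by
  rw [← stabMap_zero, stabMap_eq_iff, sub_zero]

end

end Stab

end

section

open CategoryTheory CategoryTheory.Limits

theorem injective_of_projective {A : Type u} [Ring A] [Module.Injective A A] (P : Type u)
    [AddCommGroup P] [Module A P] [Module.Finite A P] [Module.Projective A P] :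
    Module.Injective A P where
  out X Y _ _ _ _ f hf g := by
    obtain ⟨n, p, hp⟩ := Module.Finite.exists_fin' A P
    obtain ⟨s, hs⟩ := Module.projective_lifting_property p LinearMap.id hp
    obtain ⟨h, hh⟩ := Module.Injective.extension_property A (Fin n → A) X Y f hf (s ∘ₗ g)
    refine ⟨p ∘ₗ h, fun x => ?_⟩
    have h1 := LinearMap.congr_fun hh x
    have h2 := LinearMap.congr_fun hs (g x)
    simp only [LinearMap.comp_apply, LinearMap.id_apply] at h1 h2 ⊢
    rw [h1, h2]

section

variable {A : Type u} [Ring A] [Module.Injective A A]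

theorem IsProjectiveMap.exists_extend {X Y Z : Type u} [AddCommGroup X] [Module A X]
    [AddCommGroup Y] [Module A Y] [AddCommGroup Z] [Module A Z] {f : X →ₗ[A] Z}
    (hf : IsProjectiveMap f) (u : X →ₗ[A] Y) (hu : Function.Injective u) :
    ∃ t : Y →ₗ[A] Z, IsProjectiveMap t ∧ t ∘ₗ u = f := by
  obtain ⟨P, _, _, _, _, a, b, rfl⟩ := hf
  have := injective_of_projective (A := A) P
  obtain ⟨h, hh⟩ := Module.Injective.extension_property A P X Y u hu a
  exact ⟨b ∘ₗ h, .of_factor h b, by rw [LinearMap.comp_assoc, hh]⟩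

/-- Comparison of maps from a short exact sequence to a sequence whose middle term is
projective. -/
theorem isProjectiveMap_of_ladder {X Y Z X' I' Z' : Type u} [AddCommGroup X] [Module A X]
    [AddCommGroup Y] [Module A Y] [AddCommGroup Z] [Module A Z] [AddCommGroup X'] [Module A X']
    [AddCommGroup I'] [Module A I'] [AddCommGroup Z'] [Module A Z']
    [Module.Finite A I'] [Module.Projective A I']
    {u : X →ₗ[A] Y} {v : Y →ₗ[A] Z} (hu : Function.Injective u) (huv : Function.Exact u v)
    (hv : Function.Surjective v) {u' : X' →ₗ[A] I'} {v' : I' →ₗ[A] Z'} (h' : v' ∘ₗ u' = 0)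
    {f : X →ₗ[A] X'} {b : Y →ₗ[A] I'} {c : Z →ₗ[A] Z'} (hb : b ∘ₗ u = u' ∘ₗ f)
    (hc : c ∘ₗ v = v' ∘ₗ b) (hf : IsProjectiveMap f) : IsProjectiveMap c := by
  obtain ⟨t, -, rfl⟩ := hf.exists_extend u hu
  obtain ⟨s, hs⟩ := exists_desc huv hv (b - u' ∘ₗ t) (by
    rw [LinearMap.sub_comp, hb, LinearMap.comp_assoc, sub_self])
  have : c = v' ∘ₗ s := by
    apply LinearMap.ext
    intro z
    obtain ⟨y, rfl⟩ := hv z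
    have h1 := LinearMap.congr_fun hc y
    have h2 := LinearMap.congr_fun hs y
    have h3 := LinearMap.congr_fun h' (t y)
    simp only [LinearMap.comp_apply, LinearMap.sub_apply, LinearMap.zero_apply] at h1 h2 h3 ⊢
    rw [h1, h2, map_sub, h3, sub_zero]
  rw [this]
  exact .of_factor _ _

end

section Cosyzygy

variable (k : Type w) (A : Type u) [Field k] [Ring A] [Algebra k A] [Module.Finite k A]
  [Module.Injective A A]
variable (M : Type u) [AddCommGroup M] [Module A M] [Module.Finite A M]

/-- The rank of a free module in which `M` embeds. -/
noncomputable def hullRank : ℕ := (SelfInj.exists_embedding k A M).choose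

/-- A finitely generated free (hence also injective) module containing `M`. -/
abbrev Hull : Type u := Fin (hullRank k A M) → A

/-- An embedding of `M` in a projective-injective module. -/
noncomputable def hullι : M →ₗ[A] Hull k A M := (SelfInj.exists_embedding k A M).choose_spec.choose

theorem hullι_injective : Function.Injective (hullι k A M) :=
  (SelfInj.exists_embedding k A M).choose_spec.choose_spec

/-- The cosyzygy of `M`: the cokernel of an embedding of `M` in a projective-injective module. -/
abbrev Cosyzygy : Type u := Hull k A M ⧸ LinearMap.range (hullι k A M)

/-- The projection onto the cosyzygy. -/
noncomputable abbrev cosyzygyπ : Hull k A M →ₗ[A] Cosyzygy k A M := (LinearMap.range (hullι k A M)).mkQ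

theorem cosyzygyπ_surjective : Function.Surjective (cosyzygyπ k A M) := Submodule.mkQ_surjective _

theorem hull_exact : Function.Exact (hullι k A M) (cosyzygyπ k A M) :=
  LinearMap.exact_map_mkQ_range _

theorem hull_comp : cosyzygyπ k A M ∘ₗ hullι k A M = 0 :=
  (hull_exact k A M).linearMap_comp_eq_zero

variable {A M}
variable {N L : Type u} [AddCommGroup N] [Module A N] [Module.Finite A N]
  [AddCommGroup L] [Module A L] [Module.Finite A L]

/-- `δ : L → Ω⁻¹ M` is a connecting map of the short exact sequence `M → N → L` if it is induced by
an extension to `N` of the embedding of `M` in its hull. -/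
def IsConnecting (u : M →ₗ[A] N) (v : N →ₗ[A] L) (δ : L →ₗ[A] Cosyzygy k A M) : Prop :=
  ∃ b : N →ₗ[A] Hull k A M, b ∘ₗ u = hullι k A M ∘ₗ LinearMap.id ∧ δ ∘ₗ v = cosyzygyπ k A M ∘ₗ b

/-- A map `c` between cosyzygies is induced by `f` if the two are part of a map of short exact
sequences. -/
def IsInduced (f : M →ₗ[A] N) (c : Cosyzygy k A M →ₗ[A] Cosyzygy k A N) : Prop :=
  ∃ b : Hull k A M →ₗ[A] Hull k A N,
    b ∘ₗ hullι k A M = hullι k A N ∘ₗ f ∧ c ∘ₗ cosyzygyπ k A M = cosyzygyπ k A N ∘ₗ b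

variable {k}

theorem exists_ladder {M N L : Type u} [AddCommGroup M] [Module A M] [AddCommGroup N]
    [Module A N] [AddCommGroup L] [Module A L] {u : M →ₗ[A] N} {v : N →ₗ[A] L} (hu : Function.Injective u)
    (huv : Function.Exact u v) (hv : Function.Surjective v)
    {X : Type u} [AddCommGroup X] [Module A X] [Module.Finite A X] (f : M →ₗ[A] X) :
    ∃ (b : N →ₗ[A] Hull k A X) (c : L →ₗ[A] Cosyzygy k A X),
      b ∘ₗ u = hullι k A X ∘ₗ f ∧ c ∘ₗ v = cosyzygyπ k A X ∘ₗ b := by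
  obtain ⟨b, hb⟩ := Module.Injective.extension_property A (Hull k A X) M N u hu (hullι k A X ∘ₗ f)
  obtain ⟨c, hc⟩ := exists_desc huv hv (cosyzygyπ k A X ∘ₗ b) (by
    rw [LinearMap.comp_assoc, hb, ← LinearMap.comp_assoc, hull_comp, LinearMap.zero_comp])
  exact ⟨b, c, hb, hc⟩

theorem exists_isConnecting {u : M →ₗ[A] N} {v : N →ₗ[A] L} (hu : Function.Injective u)
    (huv : Function.Exact u v) (hv : Function.Surjective v) : ∃ δ, IsConnecting k u v δ := by
  obtain ⟨b, c, h⟩ := exists_ladder (k := k) hu huv hv LinearMap.id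
  exact ⟨c, b, h⟩

theorem exists_isInduced (f : M →ₗ[A] N) : ∃ c, IsInduced k f c := by
  obtain ⟨b, c, h⟩ := exists_ladder (k := k) (hullι_injective k A M) (hull_exact k A M)
    (cosyzygyπ_surjective k A M) f
  exact ⟨c, b, h⟩

theorem IsInduced.sub {f g : M →ₗ[A] N} {c d} (hf : IsInduced k f c) (hg : IsInduced k g d) :
    IsInduced k (f - g) (c - d) := by
  obtain ⟨b, hb, hc⟩ := hf
  obtain ⟨b', hb', hc'⟩ := hg
  exact ⟨b - b', by simp only [LinearMap.sub_comp, LinearMap.comp_sub, hb, hb'],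
    by simp only [LinearMap.sub_comp, LinearMap.comp_sub, hc, hc']⟩

theorem IsInduced.add {f g : M →ₗ[A] N} {c d} (hf : IsInduced k f c) (hg : IsInduced k g d) :
    IsInduced k (f + g) (c + d) := by
  obtain ⟨b, hb, hc⟩ := hf
  obtain ⟨b', hb', hc'⟩ := hg
  exact ⟨b + b', by simp only [LinearMap.add_comp, LinearMap.comp_add, hb, hb'],
    by simp only [LinearMap.add_comp, LinearMap.comp_add, hc, hc']⟩

theorem IsInduced.comp {f : M →ₗ[A] N} {g : N →ₗ[A] L} {c d} (hf : IsInduced k f c)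
    (hg : IsInduced k g d) : IsInduced k (g ∘ₗ f) (d ∘ₗ c) := by
  obtain ⟨b, hb, hc⟩ := hf
  obtain ⟨b', hb', hc'⟩ := hg
  refine ⟨b' ∘ₗ b, ?_, ?_⟩
  · rw [LinearMap.comp_assoc, hb, ← LinearMap.comp_assoc, hb', LinearMap.comp_assoc]
  · rw [LinearMap.comp_assoc, hc, ← LinearMap.comp_assoc, hc', LinearMap.comp_assoc]

theorem IsInduced.id : IsInduced k (LinearMap.id : M →ₗ[A] M) LinearMap.id :=
  ⟨LinearMap.id, rfl, rfl⟩

theorem IsInduced.isProjectiveMap {f : M →ₗ[A] N} {c} (h : IsInduced k f c)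
    (hf : IsProjectiveMap f) : IsProjectiveMap c := by
  obtain ⟨b, hb, hc⟩ := h
  exact isProjectiveMap_of_ladder (hullι_injective k A M) (hull_exact k A M)
    (cosyzygyπ_surjective k A M) (hull_comp k A N) hb hc hf

theorem IsInduced.isProjectiveMap_of {f : M →ₗ[A] N} {c} (h : IsInduced k f c)
    (hc' : IsProjectiveMap c) : IsProjectiveMap f := by
  obtain ⟨b, hb, hc⟩ := h
  obtain ⟨P, _, _, _, _, p, q, rfl⟩ := hc'
  obtain ⟨r, hr⟩ := Module.projective_lifting_property (cosyzygyπ k A N) q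
    (cosyzygyπ_surjective k A N)
  -- the difference of the two lifts takes values in the submodule `N`
  have hle : ∀ x, (b - r ∘ₗ p ∘ₗ cosyzygyπ k A M) x ∈ LinearMap.range (hullι k A N) := by
    intro x
    rw [← Submodule.Quotient.mk_eq_zero]
    have h1 := LinearMap.congr_fun hc x
    have h2 := LinearMap.congr_fun hr (p (cosyzygyπ k A M x))
    simp only [LinearMap.comp_apply, Submodule.mkQ_apply] at h1 h2
    simp only [LinearMap.sub_apply, LinearMap.comp_apply, Submodule.Quotient.mk_sub,
      Submodule.mkQ_apply]
    rw [← h1, h2, sub_self]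
  let e := LinearEquiv.ofInjective _ (hullι_injective k A N)
  let t : Hull k A M →ₗ[A] N := e.symm.toLinearMap ∘ₗ LinearMap.codRestrict _ _ hle
  have ht : t ∘ₗ hullι k A M = f := by
    ext m
    apply hullι_injective k A N
    have h0 : hullι k A N (t (hullι k A M m)) = (e (t (hullι k A M m)) : _) := rfl
    have h1 := LinearMap.congr_fun hb m
    have h2 := LinearMap.congr_fun (hull_comp k A M) m
    simp only [LinearMap.comp_apply, LinearMap.zero_apply] at h1 h2
    rw [LinearMap.comp_apply, h0]
    simp [t, h1, h2]
  rw [← ht]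
  exact .of_factor _ _

theorem exists_of_cosyzygy (c : Cosyzygy k A M →ₗ[A] Cosyzygy k A N) :
    ∃ f : M →ₗ[A] N, IsInduced k f c := by
  obtain ⟨b, hb⟩ := Module.projective_lifting_property (cosyzygyπ k A N)
    (c ∘ₗ cosyzygyπ k A M) (cosyzygyπ_surjective k A N)
  have hle : ∀ x, (b ∘ₗ hullι k A M) x ∈ LinearMap.range (hullι k A N) := by
    intro x
    rw [← Submodule.Quotient.mk_eq_zero]
    have h1 := LinearMap.congr_fun hb (hullι k A M x)
    have h2 := LinearMap.congr_fun (hull_comp k A M) x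
    simp only [LinearMap.comp_apply, Submodule.mkQ_apply, LinearMap.zero_apply] at h1 h2 ⊢
    rw [h1, h2, map_zero]
  let e := LinearEquiv.ofInjective _ (hullι_injective k A N)
  refine ⟨e.symm.toLinearMap ∘ₗ LinearMap.codRestrict _ _ hle, b, ?_, hb.symm⟩
  ext m : 1
  set f : M →ₗ[A] N := e.symm.toLinearMap ∘ₗ LinearMap.codRestrict _ _ hle with hf
  have h0 : hullι k A N (f m) = (e (f m) : _) := rfl
  rw [LinearMap.comp_apply (hullι k A N), h0]
  simp [hf]

variable (k)

/-- A map induced by `f` on cosyzygies. -/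
noncomputable def cosyzygyMap (f : M →ₗ[A] N) : Cosyzygy k A M →ₗ[A] Cosyzygy k A N :=
  (exists_isInduced f).choose

theorem isInduced_cosyzygyMap (f : M →ₗ[A] N) : IsInduced k f (cosyzygyMap k f) :=
  (exists_isInduced f).choose_spec

theorem stabMap_eq_of_isInduced {f g : M →ₗ[A] N} {c d} (hf : IsInduced k f c)
    (hg : IsInduced k g d) (h : stabMap k f = stabMap k g) : stabMap k c = stabMap k d := by
  rw [stabMap_eq_iff] at h ⊢
  exact (hf.sub hg).isProjectiveMap h

theorem stabMap_cosyzygyMap {f : M →ₗ[A] N} {c} (h : IsInduced k f c) :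
    stabMap k (cosyzygyMap k f) = stabMap k c :=
  stabMap_eq_of_isInduced k (isInduced_cosyzygyMap k f) h rfl

variable (A)

/-- The functor `Ω⁻¹` on modules, with values in the stable category. -/
noncomputable def cosyzygyFunctorAux : FGModuleCat.{u} A ⥤ Stab k A where
  obj M := stabObj k A (Cosyzygy k A M)
  map {M N} f := stabMap k (cosyzygyMap k f.hom.hom)
  map_id M := (stabMap_cosyzygyMap k .id).trans (stabMap_id k)
  map_comp {M N L} f g := by
    rw [← stabMap_comp]
    exact stabMap_cosyzygyMap k
      ((isInduced_cosyzygyMap k f.hom.hom).comp (isInduced_cosyzygyMap k g.hom.hom))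

/-- The functor `Ω⁻¹` on the stable category. -/
noncomputable def cosyzygyFunctor : Stab k A ⥤ Stab k A :=
  CategoryTheory.Quotient.lift (stableRel A) (cosyzygyFunctorAux k A) fun _ _ f g h =>
    stabMap_eq_of_isInduced k (isInduced_cosyzygyMap k f.hom.hom)
      (isInduced_cosyzygyMap k g.hom.hom) ((stabMap_eq_iff k _ _).mpr h)

variable {A}

theorem cosyzygyFunctor_map {f : M →ₗ[A] N} {c} (h : IsInduced k f c) :
    (cosyzygyFunctor k A).map (stabMap k f) = stabMap k c :=
  stabMap_cosyzygyMap k h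

variable (A)

instance : (cosyzygyFunctor k A).Additive where
  map_add {X Y f g} := by
    obtain ⟨X, rfl⟩ := stab_exists_rep k A X
    obtain ⟨Y, rfl⟩ := stab_exists_rep k A Y
    obtain ⟨f, rfl⟩ := stabMap_surjective (M := X) (N := Y) k f
    obtain ⟨g, rfl⟩ := stabMap_surjective (M := X) (N := Y) k g
    rw [← stabMap_add]
    exact (cosyzygyFunctor_map k
      ((isInduced_cosyzygyMap k f).add (isInduced_cosyzygyMap k g))).trans (stabMap_add k _ _)

instance : (cosyzygyFunctor k A).Faithful where
  map_injective {X Y f g} h := by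
    obtain ⟨X, rfl⟩ := stab_exists_rep k A X
    obtain ⟨Y, rfl⟩ := stab_exists_rep k A Y
    obtain ⟨f, rfl⟩ := stabMap_surjective (M := X) (N := Y) k f
    obtain ⟨g, rfl⟩ := stabMap_surjective (M := X) (N := Y) k g
    replace h := (stabMap_eq_iff k (cosyzygyMap k f) (cosyzygyMap k g)).mp h
    rw [stabMap_eq_iff]
    exact ((isInduced_cosyzygyMap k f).sub (isInduced_cosyzygyMap k g)).isProjectiveMap_of h

instance : (cosyzygyFunctor k A).Full where
  map_surjective {X Y} c := by
    obtain ⟨X, rfl⟩ := stab_exists_rep k A X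
    obtain ⟨Y, rfl⟩ := stab_exists_rep k A Y
    obtain ⟨c', hc'⟩ := stabMap_surjective k
      (show stabObj k A (Cosyzygy k A X) ⟶ stabObj k A (Cosyzygy k A Y) from c)
    obtain ⟨f, hf⟩ := exists_of_cosyzygy c'
    exact ⟨stabMap k f, (cosyzygyFunctor_map k hf).trans hc'⟩

instance : (cosyzygyFunctor k A).EssSurj where
  mem_essImage Z := by
    obtain ⟨Z, rfl⟩ := stab_exists_rep k A Z
    have : IsNoetherianRing A := IsNoetherianRing.of_finite k A
    obtain ⟨n, p, hp⟩ := Module.Finite.exists_fin' A Z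
    let K := LinearMap.ker p
    have hex : Function.Exact K.subtype p := LinearMap.exact_subtype_ker_map p
    obtain ⟨b, c, hb, hc⟩ := exists_ladder (k := k) K.subtype_injective hex hp LinearMap.id
    obtain ⟨b', hb'⟩ := Module.Injective.extension_property A (Fin n → A) K (Hull k A K)
      (hullι k A K) (hullι_injective k A K) K.subtype
    obtain ⟨c', hc'⟩ := exists_desc (hull_exact k A K) (cosyzygyπ_surjective k A K) (p ∘ₗ b') (by
      rw [LinearMap.comp_assoc, hb']; exact hex.linearMap_comp_eq_zero)
    refine ⟨stabObj k A K, ⟨⟨stabMap k c', stabMap k c, ?_, ?_⟩⟩⟩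
    · change stabMap k c' ≫ stabMap k c = 𝟙 (stabObj k A (Cosyzygy k A K))
      rw [← stabMap_comp, ← stabMap_id, stabMap_eq_iff]
      refine isProjectiveMap_of_ladder (hullι_injective k A K) (hull_exact k A K)
        (cosyzygyπ_surjective k A K) (hull_comp k A K) (f := 0) (b := b ∘ₗ b' - LinearMap.id)
        ?_ ?_ .zero
      · rw [LinearMap.sub_comp, LinearMap.comp_assoc, hb', hb]
        simp
      · rw [LinearMap.sub_comp, LinearMap.comp_assoc, hc', ← LinearMap.comp_assoc, hc,
          LinearMap.comp_sub, LinearMap.comp_assoc]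
        rfl
    · change stabMap k c ≫ stabMap k c' = 𝟙 (stabObj k A Z)
      rw [← stabMap_comp, ← stabMap_id, stabMap_eq_iff]
      refine isProjectiveMap_of_ladder K.subtype_injective hex hp hex.linearMap_comp_eq_zero
        (f := 0) (b := b' ∘ₗ b - LinearMap.id) ?_ ?_ .zero
      · rw [LinearMap.sub_comp, LinearMap.comp_assoc, hb, LinearMap.comp_id, hb']
        simp
      · rw [LinearMap.sub_comp, LinearMap.comp_assoc, hc, ← LinearMap.comp_assoc, hc',
          LinearMap.comp_sub, LinearMap.comp_assoc]
        rfl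

instance : (cosyzygyFunctor k A).IsEquivalence where

end Cosyzygy

end

section

open CategoryTheory CategoryTheory.Limits

namespace ShiftOfEquivalence

variable {C : Type u} [Category.{v} C] (F : C ⥤ C)

/-- A sequence of objects, each of which is identified with the image under `F` of the preceding
one. -/
structure Orbit where
  X : ℤ → C
  σ : ∀ i j : ℤ, i + 1 = j → (F.obj (X i) ≅ X j)

variable {F}

/-- A morphism of sequences. -/
@[ext]
structure Orbit.Hom (P Q : Orbit F) where
  f : ∀ i, P.X i ⟶ Q.X i
  comm : ∀ i j h, F.map (f i) ≫ (Q.σ i j h).hom = (P.σ i j h).hom ≫ f j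

instance : Category (Orbit F) where
  Hom P Q := Orbit.Hom P Q
  id P := ⟨fun i => 𝟙 _, fun i j h => by simp⟩
  comp f g := ⟨fun i => f.f i ≫ g.f i, fun i j h => by
    rw [F.map_comp, Category.assoc, g.comm, ← Category.assoc, f.comm, Category.assoc]⟩

@[ext]
theorem Orbit.hom_ext {P Q : Orbit F} {f g : P ⟶ Q} (h : ∀ i, f.f i = g.f i) : f = g :=
  Orbit.Hom.ext (funext h)

theorem Orbit.comp_f {P Q R : Orbit F} (f : P ⟶ Q) (g : Q ⟶ R) (i : ℤ) :
    Orbit.Hom.f (f ≫ g) i = f.f i ≫ g.f i := rfl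

/-- The identification of terms with equal indices. -/
def Orbit.iso (P : Orbit F) {i j : ℤ} (h : i = j) : P.X i ≅ P.X j := eqToIso (congrArg P.X h)

@[simp] theorem Orbit.iso_trans (P : Orbit F) {i j l : ℤ} (h : i = j) (h' : j = l) :
    (P.iso h).hom ≫ (P.iso h').hom = (P.iso (h.trans h')).hom := by
  subst h h'; simp [Orbit.iso]

theorem Orbit.iso_naturality {P Q : Orbit F} (f : P ⟶ Q) {i j : ℤ} (h : i = j) :
    f.f i ≫ (Q.iso h).hom = (P.iso h).hom ≫ f.f j := by
  subst h; simp [Orbit.iso]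

theorem Orbit.iso_σ (P : Orbit F) {i j i' j' : ℤ} (h : i + 1 = j) (h' : i' + 1 = j') (hi : i = i')
    (hj : j = j') :
    F.map (P.iso hi).hom ≫ (P.σ i' j' h').hom = (P.σ i j h).hom ≫ (P.iso hj).hom := by
  subst hi hj; simp [Orbit.iso]

@[simp] theorem Orbit.iso_refl (P : Orbit F) (i : ℤ) (h : i = i) : P.iso h = Iso.refl _ := rfl

/-- Isomorphisms of sequences from componentwise isomorphisms. -/
def Orbit.mkIso {P Q : Orbit F} (e : ∀ i, P.X i ≅ Q.X i)
    (comm : ∀ i j h, F.map (e i).hom ≫ (Q.σ i j h).hom = (P.σ i j h).hom ≫ (e j).hom) : P ≅ Q where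
  hom := ⟨fun i => (e i).hom, comm⟩
  inv := ⟨fun i => (e i).inv, fun i j h => by
    rw [← cancel_mono (e j).hom, Category.assoc, Category.assoc, ← comm, ← F.map_comp_assoc]
    simp⟩
  hom_inv_id := by ext i; exact (e i).hom_inv_id
  inv_hom_id := by ext i; exact (e i).inv_hom_id

variable (F)

/-- Reindexing of sequences. -/
@[simps]
def Orbit.shift (a : ℤ) : Orbit F ⥤ Orbit F where
  obj P := ⟨fun i => P.X (i + a), fun i j h => P.σ (i + a) (j + a) (by omega)⟩
  map f := ⟨fun i => f.f (i + a), fun i j h => f.comm _ _ _⟩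

theorem Orbit.eqToHom_f {P Q : Orbit F} (h : P = Q) (i : ℤ) :
    Orbit.Hom.f (eqToHom h) i = eqToHom (by rw [h]) := by
  subst h; rfl

@[simp]
theorem Orbit.mkIso_hom_f {P Q : Orbit F} (e : ∀ i, P.X i ≅ Q.X i) (comm) (i : ℤ) :
    Orbit.Hom.f (Orbit.mkIso e comm).hom i = (e i).hom := rfl

@[simp]
theorem Orbit.mkIso_inv_f {P Q : Orbit F} (e : ∀ i, P.X i ≅ Q.X i) (comm) (i : ℤ) :
    Orbit.Hom.f (Orbit.mkIso e comm).inv i = (e i).inv := rfl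

theorem Orbit.congrX (P : Orbit F) {i j : ℤ} (h : i = j) : P.X i = P.X j := congrArg P.X h

/-- Reindexing by `0`. -/
def Orbit.shiftZero : Orbit.shift F 0 ≅ 𝟭 _ :=
  NatIso.ofComponents
    (fun P => Orbit.mkIso (P := (Orbit.shift F 0).obj P) (Q := P)
      (fun i => P.iso (add_zero i)) (fun i j h => P.iso_σ _ _ _ _))
    (fun f => by ext i; exact Orbit.iso_naturality (i := i + 0) f (add_zero i))

/-- Reindexing by a sum. -/
def Orbit.shiftAdd (a b : ℤ) : Orbit.shift F (a + b) ≅ Orbit.shift F a ⋙ Orbit.shift F b :=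
  NatIso.ofComponents
    (fun P => Orbit.mkIso (P := (Orbit.shift F (a + b)).obj P)
      (Q := (Orbit.shift F b).obj ((Orbit.shift F a).obj P))
      (fun i => P.iso (show i + (a + b) = i + b + a by omega)) (fun i j h => P.iso_σ _ _ _ _))
    (fun f => by
      ext i; exact Orbit.iso_naturality f (show i + (a + b) = i + b + a by omega))

/-- The reindexing functors form a shift. -/
instance : HasShift (Orbit F) ℤ :=
  hasShiftMk _ _
    { F := Orbit.shift F
      zero := Orbit.shiftZero F
      add := Orbit.shiftAdd F
      assoc_hom_app := fun a b c P => by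
        ext i
        rw [Orbit.comp_f, Orbit.comp_f, Orbit.comp_f,
          Orbit.eqToHom_f]
        exact (eqToHom_trans (Orbit.congrX F P (by omega)) (Orbit.congrX F P (by omega))).trans
          (((congrArg (eqToHom (Orbit.congrX F P (by omega)) ≫ ·)
            (eqToHom_trans (Orbit.congrX F P (by omega)) (Orbit.congrX F P (by omega)))).trans
              (eqToHom_trans _ _)).symm)
      zero_add_hom_app := fun a P => by
        ext i
        rw [Orbit.comp_f, Orbit.eqToHom_f]
        exact (eqToHom_trans (Orbit.congrX F P (by omega)) (Orbit.congrX F P (by omega))).symm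
      add_zero_hom_app := fun a P => by
        ext i
        rw [Orbit.comp_f, Orbit.eqToHom_f]
        exact (eqToHom_trans (Orbit.congrX F P (by omega)) (Orbit.congrX F P (by omega))).symm }

/-- Evaluation at `0`. -/
@[simps]
def Orbit.ev : Orbit F ⥤ C where
  obj P := P.X 0
  map f := f.f 0

instance [F.Faithful] : (Orbit.ev F).Faithful where
  map_injective {P Q f g} h := by
    ext i
    induction i using Int.induction_on with
    | zero => exact h
    | succ i ih =>
      rw [← cancel_epi (P.σ i (i + 1) rfl).hom, ← f.comm, ← g.comm, ih]
    | pred i ih =>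
      apply F.map_injective
      rw [← cancel_mono (Q.σ (-i - 1) (-i) (by omega)).hom, f.comm, g.comm, ih]

/-- Extension of a morphism in degree `0`. -/
noncomputable def Orbit.extend [F.Full] {P Q : Orbit F} (f : P.X 0 ⟶ Q.X 0) :
    ∀ i : ℤ, P.X i ⟶ Q.X i
  | Int.ofNat n => Nat.rec (motive := fun n => P.X (Int.ofNat n) ⟶ Q.X (Int.ofNat n)) f
      (fun n g => (P.σ (Int.ofNat n) (Int.ofNat (n + 1)) rfl).inv ≫ F.map g ≫
        (Q.σ (Int.ofNat n) (Int.ofNat (n + 1)) rfl).hom) n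
  | Int.negSucc n => Nat.rec (motive := fun n => P.X (Int.negSucc n) ⟶ Q.X (Int.negSucc n))
      (F.preimage ((P.σ (Int.negSucc 0) 0 rfl).hom ≫ f ≫ (Q.σ (Int.negSucc 0) 0 rfl).inv))
      (fun n g => F.preimage ((P.σ (Int.negSucc (n + 1)) (Int.negSucc n) rfl).hom ≫ g ≫
        (Q.σ (Int.negSucc (n + 1)) (Int.negSucc n) rfl).inv)) n

theorem Orbit.extend_comm [F.Full] {P Q : Orbit F} (f : P.X 0 ⟶ Q.X 0) (i j : ℤ)
    (h : i + 1 = j) :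
    F.map (Orbit.extend F f i) ≫ (Q.σ i j h).hom = (P.σ i j h).hom ≫ Orbit.extend F f j := by
  have key : ∀ {X X' Y Y' : C} (s : X ≅ X') (t : Y ≅ Y') (g : X ⟶ Y),
      g ≫ t.hom = s.hom ≫ s.inv ≫ g ≫ t.hom := by simp
  have key' : ∀ {X Y Y' X' : C} (s : F.obj X ≅ X') (t : F.obj Y ≅ Y') (g : X' ⟶ Y'),
      F.map (F.preimage (s.hom ≫ g ≫ t.inv)) ≫ t.hom = s.hom ≫ g := by simp
  match i, j, h with
  | Int.ofNat n, _, rfl => exact key _ _ _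
  | Int.negSucc 0, _, rfl => exact key' (P.σ (Int.negSucc 0) 0 rfl) (Q.σ (Int.negSucc 0) 0 rfl) f
  | Int.negSucc (n + 1), _, rfl =>
    exact key' (P.σ (Int.negSucc (n + 1)) (Int.negSucc n) rfl)
      (Q.σ (Int.negSucc (n + 1)) (Int.negSucc n) rfl) _

instance [F.Full] : (Orbit.ev F).Full where
  map_surjective f := ⟨⟨Orbit.extend F f, Orbit.extend_comm F f⟩, rfl⟩

/-- The terms of the sequence of iterates of an object. -/
noncomputable def Orbit.iterX [F.EssSurj] (X : C) : ℤ → C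
  | Int.ofNat n => Nat.rec (motive := fun _ => C) X (fun _ Y => F.obj Y) n
  | Int.negSucc n => Nat.rec (motive := fun _ => C) (F.objPreimage X) (fun _ Y => F.objPreimage Y) n

/-- The identifications of the sequence of iterates. -/
noncomputable def Orbit.iterσ [F.EssSurj] (X : C) :
    ∀ i : ℤ, F.obj (Orbit.iterX F X i) ≅ Orbit.iterX F X (i + 1)
  | Int.ofNat _ => Iso.refl _
  | Int.negSucc 0 => F.objObjPreimageIso X
  | Int.negSucc (_ + 1) => F.objObjPreimageIso _

instance [F.EssSurj] : (Orbit.ev F).EssSurj where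
  mem_essImage X :=
    ⟨⟨Orbit.iterX F X, fun i j h => Orbit.iterσ F X i ≪≫ eqToIso (by rw [h])⟩, ⟨Iso.refl _⟩⟩

instance [F.IsEquivalence] : (Orbit.ev F).IsEquivalence where

/-- The functors of the shift: the first one is `F` itself. -/
noncomputable def shiftAux [F.IsEquivalence] (a : ℤ) : C ⥤ C :=
  if a = 1 then F else (Orbit.ev F).inv ⋙ Orbit.shift F a ⋙ Orbit.ev F

/-- Compatibility with the reindexing of sequences. -/
noncomputable def shiftAuxIso [F.IsEquivalence] (a : ℤ) :
    Orbit.ev F ⋙ shiftAux F a ≅ shiftFunctor (Orbit F) a ⋙ Orbit.ev F :=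
  if h : a = 1 then
    Functor.isoWhiskerLeft (Orbit.ev F) (eqToIso (if_pos h)) ≪≫
      NatIso.ofComponents (fun P => P.σ 0 (0 + a) (by omega)) (fun f => f.comm _ _ _)
  else
    Functor.isoWhiskerLeft (Orbit.ev F) (eqToIso (if_neg h)) ≪≫
      Functor.isoWhiskerRight (Orbit.ev F).asEquivalence.unitIso.symm
        (Orbit.shift F a ⋙ Orbit.ev F)

/-- The shift on `C` whose first functor is the self-equivalence `F`. -/
@[reducible]
noncomputable def hasShift [F.IsEquivalence] : HasShift C ℤ :=
  HasShift.induced (Orbit.ev F) ℤ (shiftAux F) (shiftAuxIso F)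

theorem shiftFunctor_one [F.IsEquivalence] :
    letI := hasShift F
    shiftFunctor C (1 : ℤ) = F := rfl

end ShiftOfEquivalence

end

section

open CategoryTheory CategoryTheory.Limits

namespace TriangleAux

theorem additive_of_comp_faithful {C D E : Type u} [Category.{v} C] [Category.{v} D]
    [Category.{v} E] [Preadditive C] [Preadditive D]
    [Preadditive E] (F : C ⥤ D) (G : D ⥤ E) [G.Additive] [G.Faithful] [(F ⋙ G).Additive] :
    F.Additive where
  map_add {X Y f g} := G.map_injective (by
    rw [G.map_add]; exact (F ⋙ G).map_add)

variable {C : Type u} [Category.{v} C] [Preadditive C] [HasShift C ℤ]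

theorem shiftFunctor_additive [(shiftFunctor C (1 : ℤ)).Additive] (n : ℤ) :
    (shiftFunctor C n).Additive := by
  induction n using Int.induction_on with
  | zero => exact Functor.additive_of_iso (shiftFunctorZero C ℤ).symm
  | succ i ih => exact Functor.additive_of_iso (shiftFunctorAdd C (i : ℤ) 1).symm
  | pred i ih =>
    have : (shiftFunctor C (-(i : ℤ) - 1) ⋙ shiftFunctor C (1 : ℤ)).Additive :=
      Functor.additive_of_iso (shiftFunctorAdd' C (-(i : ℤ) - 1) 1 (-(i : ℤ)) (by omega))
    exact additive_of_comp_faithful _ (shiftFunctor C (1 : ℤ))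

open Pretriangulated

variable [HasZeroObject C] [∀ n : ℤ, (shiftFunctor C n).Additive]

/-- The axioms of pretriangulated categories, where it is only asked that the rotations of
distinguished triangles be distinguished. -/
structure IsPretriangulation (D : Set (Triangle C)) : Prop where
  iso : ∀ T₁ ∈ D, ∀ (T₂ : Triangle C) (_ : T₂ ≅ T₁), T₂ ∈ D
  contr : ∀ X : C, contractibleTriangle X ∈ D
  cone : ∀ {X Y : C} (f : X ⟶ Y), ∃ (Z : C) (g : Y ⟶ Z) (h : Z ⟶ X⟦(1 : ℤ)⟧),
    Triangle.mk f g h ∈ D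
  rot : ∀ T ∈ D, T.rotate ∈ D
  mor : ∀ (T₁ T₂ : Triangle C) (_ : T₁ ∈ D) (_ : T₂ ∈ D)
      (a : T₁.obj₁ ⟶ T₂.obj₁) (b : T₁.obj₂ ⟶ T₂.obj₂) (_ : T₁.mor₁ ≫ b = a ≫ T₂.mor₁),
      ∃ c : T₁.obj₃ ⟶ T₂.obj₃, T₁.mor₂ ≫ c = b ≫ T₂.mor₂ ∧ T₁.mor₃ ≫ a⟦1⟧' = c ≫ T₂.mor₃

theorem mor_of_iso {T T' S S' : Triangle C} (e : T ≅ S) (e' : T' ≅ S')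
    (H : ∀ (a : S.obj₁ ⟶ S'.obj₁) (b : S.obj₂ ⟶ S'.obj₂), S.mor₁ ≫ b = a ≫ S'.mor₁ →
      ∃ c : S.obj₃ ⟶ S'.obj₃, S.mor₂ ≫ c = b ≫ S'.mor₂ ∧ S.mor₃ ≫ a⟦1⟧' = c ≫ S'.mor₃)
    (a : T.obj₁ ⟶ T'.obj₁) (b : T.obj₂ ⟶ T'.obj₂) (hab : T.mor₁ ≫ b = a ≫ T'.mor₁) :
    ∃ c : T.obj₃ ⟶ T'.obj₃, T.mor₂ ≫ c = b ≫ T'.mor₂ ∧ T.mor₃ ≫ a⟦1⟧' = c ≫ T'.mor₃ := by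
  obtain ⟨c, h2, h3⟩ := H (e.inv.hom₁ ≫ a ≫ e'.hom.hom₁) (e.inv.hom₂ ≫ b ≫ e'.hom.hom₂) (by
    rw [e.inv.comm₁_assoc, Category.assoc, Category.assoc, ← e'.hom.comm₁, reassoc_of% hab])
  refine ⟨e.hom.hom₃ ≫ c ≫ e'.inv.hom₃, ?_, ?_⟩
  · rw [e.hom.comm₂_assoc, reassoc_of% h2, e'.inv.comm₂]
    simp
  · rw [Category.assoc, Category.assoc, ← e'.inv.comm₃, ← reassoc_of% h3, ← e.hom.comm₃_assoc]
    simp only [← CategoryTheory.Functor.map_comp, Category.assoc]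
    simp

namespace IsPretriangulation

variable {D : Set (Triangle C)}

theorem comp_zero (hD : IsPretriangulation D) (T : Triangle C) (hT : T ∈ D) : T.mor₁ ≫ T.mor₂ = 0 := by
  obtain ⟨c, hc, -⟩ := hD.mor _ T (hD.contr T.obj₁) hT (𝟙 T.obj₁) T.mor₁ rfl
  exact hc.symm.trans Limits.zero_comp

theorem exact (hD : IsPretriangulation D) (T : Triangle C) (hT : T ∈ D) {W : C} (f : W ⟶ T.obj₂) (hf : f ≫ T.mor₂ = 0) :
    ∃ g : W ⟶ T.obj₁, g ≫ T.mor₁ = f := by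
  obtain ⟨c, -, hc⟩ := hD.mor _ _ (hD.rot _ (hD.contr W)) (hD.rot _ hT) f
    (0 : (contractibleTriangle W).obj₃ ⟶ T.obj₃) (Limits.zero_comp.trans hf.symm)
  obtain ⟨g, rfl⟩ := (shiftFunctor C (1 : ℤ)).map_surjective
    (show (shiftFunctor C (1 : ℤ)).obj W ⟶ (shiftFunctor C (1 : ℤ)).obj T.obj₁ from c)
  refine ⟨g, (shiftFunctor C (1 : ℤ)).map_injective ?_⟩
  replace hc : (-(shiftFunctor C (1 : ℤ)).map (𝟙 W)) ≫ (shiftFunctor C (1 : ℤ)).map f =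
    (shiftFunctor C (1 : ℤ)).map g ≫ (-(shiftFunctor C (1 : ℤ)).map T.mor₁) := hc
  rw [CategoryTheory.Functor.map_id, Preadditive.neg_comp, Preadditive.comp_neg,
    Category.id_comp] at hc
  rw [CategoryTheory.Functor.map_comp]
  exact (neg_injective hc).symm

theorem isIso (hD : IsPretriangulation D) {X Y Z Z' : C} {f : X ⟶ Y} {g : Y ⟶ Z} {h : Z ⟶ X⟦(1 : ℤ)⟧} {g' : Y ⟶ Z'}
    {h' : Z' ⟶ X⟦(1 : ℤ)⟧} (hT : Triangle.mk f g h ∈ D) (hT' : Triangle.mk f g' h' ∈ D)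
    (c : Z' ⟶ Z) (hg : g' ≫ c = g) (hh : c ≫ h = h') : IsIso c := by
  have e1 : ∀ {W : C} (z : W ⟶ Z'), z ≫ h' = 0 → ∃ y : W ⟶ Y, y ≫ g' = z :=
    hD.exact _ (hD.rot _ hT')
  have e2 : ∀ {W : C} (z : W ⟶ Y), z ≫ g = 0 → ∃ y : W ⟶ X, y ≫ f = z := hD.exact _ hT
  have e3 : ∀ {W : C} (z : W ⟶ X⟦(1 : ℤ)⟧), z ≫ (-f⟦1⟧') = 0 → ∃ y : W ⟶ Z', y ≫ h' = z :=
    hD.exact _ (hD.rot _ (hD.rot _ hT'))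
  have e4 : ∀ {W : C} (z : W ⟶ Z), z ≫ h = 0 → ∃ y : W ⟶ Y, y ≫ g = z :=
    hD.exact _ (hD.rot _ hT)
  have z1 : f ≫ g' = 0 := hD.comp_zero _ hT'
  have z2 : h ≫ (-f⟦1⟧') = 0 := hD.comp_zero _ (hD.rot _ (hD.rot _ hT))
  have hmono : Mono c := by
    refine Preadditive.mono_of_cancel_zero _ fun z hz => ?_
    obtain ⟨y, rfl⟩ := e1 z (by rw [← hh, ← Category.assoc, hz, Limits.zero_comp])
    obtain ⟨x, rfl⟩ := e2 y (by rw [← hg, ← Category.assoc, hz])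
    rw [Category.assoc, z1, Limits.comp_zero]
  obtain ⟨z, hz⟩ := e3 h z2
  obtain ⟨y, hy⟩ := e4 (𝟙 Z - z ≫ c) (by
    rw [Preadditive.sub_comp, Category.id_comp, Category.assoc, hh, hz, sub_self])
  have : IsSplitEpi c := ⟨⟨⟨z + y ≫ g', by
    rw [Preadditive.add_comp, Category.assoc, hg, hy, add_sub_cancel]⟩⟩⟩
  exact isIso_of_mono_of_isSplitEpi c

theorem of_rot (hD : IsPretriangulation D) (T : Triangle C) (hT : T.rotate ∈ D) : T ∈ D := by
  obtain ⟨Z, g, h, hT'⟩ := hD.cone T.mor₁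
  have h3 := hD.rot _ (hD.rot _ hT)
  have h3' := hD.rot _ (hD.rot _ (hD.rot _ hT'))
  obtain ⟨c, hc1, hc2⟩ := hD.mor _ _ h3' h3 (𝟙 _) (𝟙 _)
    ((Category.comp_id _).trans (Category.id_comp _).symm)
  have hc1' : (-(shiftFunctor C (1 : ℤ)).map g) ≫ c = -(shiftFunctor C (1 : ℤ)).map T.mor₂ :=
    hc1.trans (Category.id_comp _)
  have hc2' : -(shiftFunctor C (1 : ℤ)).map h = c ≫ (-(shiftFunctor C (1 : ℤ)).map T.mor₃) := by
    refine Eq.trans ?_ hc2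
    exact (Category.comp_id _).symm.trans
      (congrArg (_ ≫ ·) (CategoryTheory.Functor.map_id (shiftFunctor C (1 : ℤ)) _).symm)
  change (shiftFunctor C (1 : ℤ)).obj Z ⟶ (shiftFunctor C (1 : ℤ)).obj T.obj₃ at c
  have hiso : IsIso c := hD.isIso h3 h3' c hc1' hc2'.symm
  clear hc1 hc2
  obtain ⟨c, rfl⟩ := (shiftFunctor C (1 : ℤ)).map_surjective c
  have hic : IsIso c := isIso_of_fully_faithful (shiftFunctor C (1 : ℤ)) c
  have key : ∀ {P Q R : C} (a : P ⟶ Q) (b : Q ⟶ R) (d : P ⟶ R),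
      (-(shiftFunctor C (1 : ℤ)).map a) ≫ (shiftFunctor C (1 : ℤ)).map b =
        -(shiftFunctor C (1 : ℤ)).map d → a ≫ b = d := fun a b d h => by
    rw [Preadditive.neg_comp, ← CategoryTheory.Functor.map_comp] at h
    exact (shiftFunctor C (1 : ℤ)).map_injective (neg_injective h)
  have hg : g ≫ c = T.mor₂ := key _ _ _ hc1'
  have hh : c ≫ T.mor₃ = h := key _ _ _
    (((Preadditive.neg_comp _ _).trans (Preadditive.comp_neg _ _).symm).trans hc2'.symm)
  refine hD.iso _ hT' _ (Iso.symm (Triangle.isoMk _ _ (Iso.refl _) (Iso.refl _) (@asIso C _ Z T.obj₃ c hic) ?_ ?_ ?_))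
  · exact (Category.comp_id _).trans (Category.id_comp _).symm
  · exact hg.trans (Category.id_comp _).symm
  · refine Eq.trans ?_ hh.symm
    exact (congrArg (h ≫ ·) (CategoryTheory.Functor.map_id _ _)).trans (Category.comp_id _)

/-- The pretriangulated structure. -/
abbrev pretriangulated (hD : IsPretriangulation D) : Pretriangulated C where
  distinguishedTriangles := D
  isomorphic_distinguished := hD.iso
  contractible_distinguished := hD.contr
  distinguished_cocone_triangle := hD.cone
  rotate_distinguished_triangle T := ⟨hD.rot T, hD.of_rot T⟩
  complete_distinguished_triangle_morphism := hD.mor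

end IsPretriangulation

end TriangleAux

theorem isZero_stabObj_of_subsingleton (k : Type w) (A : Type u) [Ring A] (M : Type u)
    [AddCommGroup M] [Module A M] [Module.Finite A M] [Subsingleton M] :
    IsZero (stabObj k A M) := by
  rw [IsZero.iff_id_eq_zero, ← stabMap_id, ← stabMap_zero]
  exact congrArg _ (Subsingleton.elim _ _)

section StabTriangles

variable (k : Type w) (A : Type u) [Field k] [Ring A] [Algebra k A] [Module.Finite k A]
  [Module.Injective A A]

/-- The shift of the stable category: the first shift functor is `Ω⁻¹`. -/
noncomputable instance : HasShift (Stab k A) ℤ :=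
  ShiftOfEquivalence.hasShift (cosyzygyFunctor k A)

instance : (shiftFunctor (Stab k A) (1 : ℤ)).Additive :=
  inferInstanceAs (cosyzygyFunctor k A).Additive

instance (n : ℤ) : (shiftFunctor (Stab k A) n).Additive := TriangleAux.shiftFunctor_additive n

instance : HasZeroObject (Stab k A) := ⟨_, isZero_stabObj_of_subsingleton k A PUnit⟩

variable {A}

open Pretriangulated

section

variable {M N L : Type u} [AddCommGroup M] [Module A M] [Module.Finite A M]
  [AddCommGroup N] [Module A N] [Module.Finite A N] [AddCommGroup L] [Module A L]
  [Module.Finite A L]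

/-- A homomorphism `L → Ω⁻¹ M`, as a morphism to the shift of `M`. -/
noncomputable def stabConn (δ : L →ₗ[A] Cosyzygy k A M) :
    stabObj k A L ⟶ (stabObj k A M)⟦(1 : ℤ)⟧ := stabMap k δ

/-- The triangle with three given homomorphisms. -/
noncomputable abbrev stabTriangle (u : M →ₗ[A] N) (v : N →ₗ[A] L) (δ : L →ₗ[A] Cosyzygy k A M) :
    Triangle (Stab k A) :=
  Triangle.mk (stabMap k u) (stabMap k v) (stabConn k δ)

end

variable (A)

/-- The distinguished triangles of the stable category: those isomorphic to the triangle of a short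
exact sequence. -/
def stabDistinguished : Set (Triangle (Stab k A)) :=
  {T | ∃ (X Y Z : FGModuleCat.{u} A) (u : X →ₗ[A] Y) (v : Y →ₗ[A] Z) (δ : Z →ₗ[A] Cosyzygy k A X),
    Function.Injective u ∧ Function.Exact u v ∧ Function.Surjective v ∧ IsConnecting k u v δ ∧
      Nonempty (T ≅ stabTriangle k u v δ)}

variable {A}

section

variable {M N L : Type u} [AddCommGroup M] [Module A M] [Module.Finite A M]
  [AddCommGroup N] [Module A N] [Module.Finite A N] [AddCommGroup L] [Module A L]
  [Module.Finite A L]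

theorem shift_stabMap {f : M →ₗ[A] N} {c} (h : IsInduced k f c) :
    (shiftFunctor (Stab k A) (1 : ℤ)).map (stabMap k f) = stabMap k c :=
  cosyzygyFunctor_map k h

/-- Adding a projective direct summand does not change the class of a module. -/
noncomputable def stabProdIso (P : Type u) [AddCommGroup P] [Module A P] [Module.Finite A P]
    [Module.Projective A P] : stabObj k A M ≅ stabObj k A (P × M) where
  hom := stabMap k (LinearMap.inr A P M)
  inv := stabMap k (LinearMap.snd A P M)
  hom_inv_id := by rw [← stabMap_comp, LinearMap.snd_comp_inr, stabMap_id]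
  inv_hom_id := by
    rw [← stabMap_comp, ← stabMap_id, stabMap_eq_iff]
    have : LinearMap.inr A P M ∘ₗ LinearMap.snd A P M - LinearMap.id =
        -(LinearMap.inl A P M ∘ₗ LinearMap.fst A P M) := by
      ext x <;> simp
    rw [this]
    exact (IsProjectiveMap.of_factor _ _).neg

theorem stabMap_inr (P : Type u) [AddCommGroup P] [Module A P] [Module.Finite A P]
    [Module.Projective A P] (a : N →ₗ[A] P) (f : N →ₗ[A] M) :
    stabMap k (LinearMap.inr A P M ∘ₗ f) = stabMap k (a.prod f) := by
  rw [stabMap_eq_iff]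
  have : LinearMap.inr A P M ∘ₗ f - a.prod f = -(LinearMap.inl A P M ∘ₗ a) := by
    ext x <;> simp
  rw [this]
  exact (IsProjectiveMap.of_factor _ _).neg

theorem mem_stabDistinguished {u : M →ₗ[A] N} {v : N →ₗ[A] L} {δ : L →ₗ[A] Cosyzygy k A M}
    (hu : Function.Injective u) (huv : Function.Exact u v) (hv : Function.Surjective v)
    (h : IsConnecting k u v δ) : stabTriangle k u v δ ∈ stabDistinguished k A :=
  ⟨.of A M, .of A N, .of A L, u, v, δ, hu, huv, hv, h, ⟨Iso.refl _⟩⟩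

/-- Rotation of the triangle of a short exact sequence. -/
theorem stabTriangle_rotate {u : M →ₗ[A] N} {v : N →ₗ[A] L} {δ : L →ₗ[A] Cosyzygy k A M}
    (huv : Function.Exact u v) (hv : Function.Surjective v)
    (h : IsConnecting k u v δ) : (stabTriangle k u v δ).rotate ∈ stabDistinguished k A := by
  obtain ⟨β, hβ, hδ⟩ := h
  obtain ⟨c, I, hI, hc⟩ := exists_isInduced (k := k) u
  have eβ : ∀ x, β (u x) = hullι k A M x := fun x => LinearMap.congr_fun hβ x
  have eδ : ∀ y, δ (v y) = cosyzygyπ k A M (β y) := fun y => LinearMap.congr_fun hδ y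
  have eI : ∀ x, I (hullι k A M x) = hullι k A N (u x) := fun x => LinearMap.congr_fun hI x
  have ec : ∀ i, c (cosyzygyπ k A M i) = cosyzygyπ k A N (I i) := fun i => LinearMap.congr_fun hc i
  have eπ : ∀ x, cosyzygyπ k A M (hullι k A M x) = 0 :=
    fun x => LinearMap.congr_fun (hull_comp k A M) x
  have eπ' : ∀ x, cosyzygyπ k A N (hullι k A N x) = 0 :=
    fun x => LinearMap.congr_fun (hull_comp k A N) x
  obtain ⟨s, hs⟩ := exists_desc huv hv (hullι k A N - I ∘ₗ β) (by
    ext x : 1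
    simp [eβ, eI])
  have es : ∀ y, s (v y) = hullι k A N y - I (β y) := fun y => LinearMap.congr_fun hs y
  refine ⟨.of A N, .of A (Hull k A M × L), .of A (Cosyzygy k A M), (-β).prod v,
    (cosyzygyπ k A M).coprod δ, -c, ?_, ?_, ?_, ⟨(-I).coprod s, ?_, ?_⟩, ⟨?_⟩⟩
  · rw [← LinearMap.ker_eq_bot, LinearMap.ker_eq_bot']
    intro y hy
    obtain ⟨h1, h2⟩ := Prod.ext_iff.mp hy
    obtain ⟨x, rfl⟩ := (huv y).mp h2
    replace h1 : -β (u x) = 0 := h1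
    rw [neg_eq_zero, eβ] at h1
    rw [hullι_injective k A M (h1.trans (map_zero _).symm), map_zero]
  · rintro ⟨i, z⟩
    constructor
    · intro h0
      replace h0 : cosyzygyπ k A M i + δ z = 0 := h0
      obtain ⟨y, rfl⟩ := hv z
      rw [eδ, ← map_add] at h0
      obtain ⟨x, hx⟩ := (hull_exact k A M _).mp h0
      refine ⟨y - u x, Prod.ext ?_ ?_⟩
      · change -β (y - u x) = i
        rw [map_sub, eβ, hx]; abel
      · change v (y - u x) = v y
        rw [map_sub, huv.apply_apply_eq_zero, sub_zero]
    · rintro ⟨y, hy⟩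
      obtain ⟨h1, h2⟩ := Prod.ext_iff.mp hy
      replace h1 : -β y = i := h1
      replace h2 : v y = z := h2
      change cosyzygyπ k A M i + δ z = 0
      rw [← h1, ← h2, eδ, map_neg, neg_add_cancel]
  · intro z
    obtain ⟨i, rfl⟩ := cosyzygyπ_surjective k A M z
    exact ⟨(i, 0), by simp⟩
  · ext y : 1
    change -I (-β y) + s (v y) = hullι k A N y
    rw [es, map_neg]; abel
  · refine LinearMap.ext fun ⟨i, z⟩ => ?_
    obtain ⟨y, rfl⟩ := hv z
    change -c (cosyzygyπ k A M i + δ (v y)) = cosyzygyπ k A N (-I i + s (v y))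
    rw [eδ, es, map_add, ec, ec, map_add, map_neg, map_sub, eπ']; abel
  · refine Triangle.isoMk _ _ (Iso.refl _) (stabProdIso k (Hull k A M)) (Iso.refl _) ?_ ?_ ?_
    · change stabMap k v ≫ stabMap k (LinearMap.inr A (Hull k A M) L) = 𝟙 _ ≫ stabMap k _
      rw [← stabMap_comp, Category.id_comp]
      exact stabMap_inr k _ _ _
    · change stabMap k δ ≫ 𝟙 _ = stabMap k (LinearMap.inr A (Hull k A M) L) ≫ stabMap k _
      rw [← stabMap_comp, Category.comp_id, LinearMap.coprod_inr]
    · change (-(shiftFunctor (Stab k A) (1 : ℤ)).map (stabMap k u)) ≫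
        (shiftFunctor (Stab k A) (1 : ℤ)).map (𝟙 _) = 𝟙 _ ≫ stabMap k (-c)
      rw [CategoryTheory.Functor.map_id, Category.comp_id, Category.id_comp, stabMap_neg]
      exact congrArg Neg.neg (shift_stabMap k ⟨I, hI, hc⟩)

/-- Naturality of the connecting morphisms. -/
theorem stabConn_naturality {M' N' L' : Type u} [AddCommGroup M'] [Module A M'] [Module.Finite A M']
    [AddCommGroup N'] [Module A N'] [Module.Finite A N'] [AddCommGroup L'] [Module A L']
    [Module.Finite A L'] {u : M →ₗ[A] N} {v : N →ₗ[A] L} {δ : L →ₗ[A] Cosyzygy k A M}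
    {u' : M' →ₗ[A] N'} {v' : N' →ₗ[A] L'} {δ' : L' →ₗ[A] Cosyzygy k A M'}
    (h1 : Function.Injective u) (h2 : Function.Exact u v) (h3 : Function.Surjective v)
    (h : IsConnecting k u v δ) (h' : IsConnecting k u' v' δ')
    {a : M →ₗ[A] M'} {b : N →ₗ[A] N'} {c : L →ₗ[A] L'} (hb : b ∘ₗ u = u' ∘ₗ a)
    (hc : c ∘ₗ v = v' ∘ₗ b) :
    stabConn k δ ≫ (shiftFunctor (Stab k A) (1 : ℤ)).map (stabMap k a) =
      stabMap k c ≫ stabConn k δ' := by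
  obtain ⟨β, hβ, hδ⟩ := h
  obtain ⟨β', hβ', hδ'⟩ := h'
  obtain ⟨d, I, hI, hd⟩ := exists_isInduced (k := k) a
  have hcd : stabMap k (d ∘ₗ δ) = stabMap k (δ' ∘ₗ c) := by
    rw [stabMap_eq_iff]
    refine isProjectiveMap_of_ladder h1 h2 h3 (hull_comp k A M') (f := 0)
      (b := I ∘ₗ β - β' ∘ₗ b) ?_ ?_ .zero
    · rw [LinearMap.sub_comp, LinearMap.comp_assoc, LinearMap.comp_assoc, hβ, hb,
        ← LinearMap.comp_assoc, ← LinearMap.comp_assoc, hI, hβ']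
      simp
    · rw [LinearMap.sub_comp, LinearMap.comp_assoc, LinearMap.comp_assoc, hδ, hc,
        ← LinearMap.comp_assoc, hd, ← LinearMap.comp_assoc, hδ', LinearMap.comp_sub,
        LinearMap.comp_assoc, LinearMap.comp_assoc]
  exact (congrArg (stabMap k δ ≫ ·) (shift_stabMap k ⟨I, hI, hd⟩)).trans
    ((stabMap_comp k _ _).symm.trans (hcd.trans (stabMap_comp k _ _)))

/-- Morphisms between the triangles of short exact sequences. -/
theorem stabTriangle_mor {M' N' L' : Type u} [AddCommGroup M'] [Module A M'] [Module.Finite A M']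
    [AddCommGroup N'] [Module A N'] [Module.Finite A N'] [AddCommGroup L'] [Module A L']
    [Module.Finite A L'] {u : M →ₗ[A] N} {v : N →ₗ[A] L} {δ : L →ₗ[A] Cosyzygy k A M}
    {u' : M' →ₗ[A] N'} {v' : N' →ₗ[A] L'} {δ' : L' →ₗ[A] Cosyzygy k A M'}
    (h1 : Function.Injective u) (h2 : Function.Exact u v) (h3 : Function.Surjective v)
    (h2' : Function.Exact u' v') (h : IsConnecting k u v δ) (h' : IsConnecting k u' v' δ')
    (a : stabObj k A M ⟶ stabObj k A M') (b : stabObj k A N ⟶ stabObj k A N')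
    (hab : stabMap k u ≫ b = a ≫ stabMap k u') :
    ∃ c : stabObj k A L ⟶ stabObj k A L', stabMap k v ≫ c = b ≫ stabMap k v' ∧
      stabConn k δ ≫ (shiftFunctor (Stab k A) (1 : ℤ)).map a = c ≫ stabConn k δ' := by
  obtain ⟨a₀, rfl⟩ := stabMap_surjective k a
  obtain ⟨b₀, rfl⟩ := stabMap_surjective k b
  rw [← stabMap_comp, ← stabMap_comp, stabMap_eq_iff] at hab
  obtain ⟨t, ht, htu⟩ := hab.exists_extend u h1
  have hb' : (b₀ - t) ∘ₗ u = u' ∘ₗ a₀ := by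
    rw [LinearMap.sub_comp, htu]; abel
  obtain ⟨c₀, hc₀⟩ := exists_desc h2 h3 (v' ∘ₗ (b₀ - t)) (by
    rw [LinearMap.comp_assoc, hb', ← LinearMap.comp_assoc, h2'.linearMap_comp_eq_zero,
      LinearMap.zero_comp])
  refine ⟨stabMap k c₀, ?_, ?_⟩
  · rw [← stabMap_comp, ← stabMap_comp, stabMap_eq_iff, hc₀, LinearMap.comp_sub,
      sub_sub_cancel_left]
    exact (ht.comp_left v').neg
  · exact stabConn_naturality k h1 h2 h3 h h' hb' hc₀

end

variable (A)

theorem isPretriangulation_stabDistinguished :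
    TriangleAux.IsPretriangulation (stabDistinguished k A) where
  iso := by
    rintro T ⟨X, Y, Z, u, v, δ, h1, h2, h3, h4, ⟨e⟩⟩ T' e'
    exact ⟨X, Y, Z, u, v, δ, h1, h2, h3, h4, ⟨e' ≪≫ e⟩⟩
  contr X := by
    obtain ⟨X, rfl⟩ := stab_exists_rep k A X
    refine ⟨X, X, .of A PUnit, LinearMap.id, 0, 0, Function.injective_id,
      fun x => ⟨fun _ => ⟨x, rfl⟩, fun _ => rfl⟩, fun z => ⟨0, rfl⟩,
      ⟨hullι k A X, rfl, by rw [hull_comp]; rfl⟩, ⟨?_⟩⟩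
    refine Triangle.isoMk _ _ (Iso.refl _) (Iso.refl _)
      ((isZero_zero _).iso (isZero_stabObj_of_subsingleton k A PUnit)) ?_ ?_ ?_
    · change 𝟙 _ ≫ 𝟙 _ = 𝟙 _ ≫ stabMap k _
      rw [stabMap_id]
    · exact (isZero_stabObj_of_subsingleton k A PUnit).eq_of_tgt _ _
    · exact (isZero_zero _).eq_of_src _ _
  cone {X Y} f := by
    obtain ⟨X, rfl⟩ := stab_exists_rep k A X
    obtain ⟨Y, rfl⟩ := stab_exists_rep k A Y
    obtain ⟨f, rfl⟩ := stabMap_surjective (M := X) (N := Y) k f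
    let u : X →ₗ[A] Hull k A X × Y := (hullι k A X).prod f
    have hu : Function.Injective u := fun x y h => hullι_injective k A X (congrArg Prod.fst h)
    have huv : Function.Exact u (LinearMap.range u).mkQ := LinearMap.exact_map_mkQ_range u
    have hv := (LinearMap.range u).mkQ_surjective
    obtain ⟨δ, hδ⟩ := exists_isConnecting (k := k) hu huv hv
    refine ⟨stabObj k A ((Hull k A X × Y) ⧸ LinearMap.range u),
      stabMap k (LinearMap.inr A (Hull k A X) Y) ≫ stabMap k (LinearMap.range u).mkQ,
      stabConn k δ, X, .of A (Hull k A X × Y), .of A ((Hull k A X × Y) ⧸ LinearMap.range u), u,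
      (LinearMap.range u).mkQ, δ, hu, huv, hv, hδ, ⟨?_⟩⟩
    refine Triangle.isoMk _ _ (Iso.refl _) (stabProdIso k (Hull k A X)) (Iso.refl _) ?_ ?_ ?_
    · change stabMap k f ≫ stabMap k (LinearMap.inr A (Hull k A X) Y) = 𝟙 _ ≫ stabMap k _
      rw [← stabMap_comp, Category.id_comp]
      exact stabMap_inr k _ _ _
    · exact Category.comp_id _
    · change stabConn k δ ≫ (shiftFunctor (Stab k A) (1 : ℤ)).map (𝟙 _) = 𝟙 _ ≫ stabConn k δ
      rw [CategoryTheory.Functor.map_id, Category.comp_id, Category.id_comp]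
  rot := by
    rintro T ⟨X, Y, Z, u, v, δ, -, h2, h3, h4, ⟨e⟩⟩
    obtain ⟨X', Y', Z', u', v', δ', h1', h2', h3', h4', ⟨e'⟩⟩ :=
      stabTriangle_rotate k h2 h3 h4
    exact ⟨X', Y', Z', u', v', δ', h1', h2', h3', h4', ⟨(rotate _).mapIso e ≪≫ e'⟩⟩
  mor := by
    rintro T T' ⟨X, Y, Z, u, v, δ, h1, h2, h3, h, ⟨e⟩⟩ ⟨X', Y', Z', u', v', δ', -, h2', -, h', ⟨e'⟩⟩
    exact TriangleAux.mor_of_iso e e' (stabTriangle_mor k h1 h2 h3 h2' h h')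

noncomputable instance : Pretriangulated (Stab k A) :=
  (isPretriangulation_stabDistinguished k A).pretriangulated

end StabTriangles

end

section

open CategoryTheory CategoryTheory.Limits

open scoped DirectSum

/-- For objects `X` with layers `layer X 0, layer X 1, …` in a category: subgroups `hom X Y d` of
`Hom (layer X 0) (layer Y d)`, whose elements `φ` induce maps `layer X i ⟶ layer Y (d + i)` for all
`i`, in a way compatible with composition. -/
structure LayeredHoms {T : Type u} [Category.{v} T] [Preadditive T] {Obj : Type w}
    (layer : Obj → ℕ → T) where
  hom : ∀ (X Y : Obj) (d : ℕ), AddSubgroup (layer X 0 ⟶ layer Y d)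
  lift : ∀ {X Y : Obj} {d : ℕ}, hom X Y d → ∀ i m : ℕ, d + i = m → (layer X i ⟶ layer Y m)
  lift_zero : ∀ {X Y : Obj} {d : ℕ} (φ : hom X Y d), lift φ 0 d rfl = φ
  lift_add : ∀ {X Y : Obj} {d : ℕ} (φ ψ : hom X Y d) (i m : ℕ) (h : d + i = m),
    lift (φ + ψ) i m h = lift φ i m h + lift ψ i m h
  id_mem : ∀ X : Obj, 𝟙 (layer X 0) ∈ hom X X 0
  lift_id : ∀ (X : Obj) (i : ℕ), lift ⟨𝟙 (layer X 0), id_mem X⟩ i i (zero_add i) = 𝟙 (layer X i)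
  comp_mem : ∀ {X Y Z : Obj} {d e : ℕ} (φ : hom X Y d) (ψ : hom Y Z e) (n : ℕ) (h : e + d = n),
    φ.1 ≫ lift ψ d n h ∈ hom X Z n
  lift_comp : ∀ {X Y Z : Obj} {d e : ℕ} (φ : hom X Y d) (ψ : hom Y Z e) (n : ℕ) (h : e + d = n)
    (i m l : ℕ) (him : d + i = m) (hml : e + m = l) (hil : n + i = l),
    lift ⟨φ.1 ≫ lift ψ d n h, comp_mem φ ψ n h⟩ i l hil = lift φ i m him ≫ lift ψ m l hml

namespace LayeredHoms

variable {T : Type u} [Category.{v} T] [Preadditive T] {Obj : Type w}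
  {layer : Obj → ℕ → T} (L : LayeredHoms layer)

/-- The morphisms: the direct sum of the groups of homogeneous morphisms. -/
abbrev Hom (X Y : Obj) : Type v := ⨁ d, L.hom X Y d

variable {L} {X Y Z W : Obj}

/-- The composition of homogeneous morphisms `φ` and `ψ` is `φ ≫ ψ_d`, where `d` is the degree
of `φ` and `ψ_d` the map induced by `ψ` on the layer of index `d`. -/
def hcomp {d e : ℕ} (φ : L.hom X Y d) (ψ : L.hom Y Z e) (n : ℕ) (h : e + d = n) : L.hom X Z n :=
  ⟨φ.1 ≫ L.lift ψ d n h, L.comp_mem φ ψ n h⟩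

/-- A homogeneous morphism of degree `d`. -/
def homogeneous {d : ℕ} (φ : L.hom X Y d) : L.Hom X Y := DirectSum.of (fun d => L.hom X Y d) d φ

theorem homogeneous_add {d : ℕ} (φ ψ : L.hom X Y d) :
    homogeneous (φ + ψ) = homogeneous φ + homogeneous ψ := map_add _ φ ψ

/-- Composition, as a biadditive map. -/
noncomputable def compHom (X Y Z : Obj) : L.Hom X Y →+ L.Hom Y Z →+ L.Hom X Z :=
  DirectSum.toAddMonoid fun d => AddMonoidHom.flip (DirectSum.toAddMonoid fun e =>
    AddMonoidHom.flip (AddMonoidHom.mk' (fun φ => AddMonoidHom.mk'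
      (fun ψ => homogeneous (L := L) (hcomp (d := d) (e := e) φ ψ (e + d) rfl))
      (fun ψ ψ' => by
        rw [← homogeneous_add]
        refine congrArg (homogeneous (L := L)) (Subtype.ext ?_)
        exact (congrArg (φ.1 ≫ ·) (L.lift_add ψ ψ' _ _ _)).trans
          (Preadditive.comp_add _ _ _ _ _ _)))
      (fun φ φ' => by
        refine AddMonoidHom.ext fun ψ => ?_
        exact (congrArg (homogeneous (L := L) (d := e + d))
          (a₁ := hcomp (φ + φ') ψ (e + d) rfl)
          (a₂ := hcomp φ ψ (e + d) rfl + hcomp φ' ψ (e + d) rfl)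
          (Subtype.ext (Preadditive.add_comp _ _ _ _ _ _))).trans (homogeneous_add _ _))))

theorem compHom_homogeneous {d e n : ℕ} (φ : L.hom X Y d) (ψ : L.hom Y Z e) (h : e + d = n) :
    compHom X Y Z (homogeneous φ) (homogeneous ψ) = homogeneous (hcomp φ ψ n h) := by
  subst h
  simp [compHom, homogeneous]

theorem hom_induction {p : L.Hom X Y → Prop} (f : L.Hom X Y) (h0 : p 0)
    (h1 : ∀ (d : ℕ) (φ : L.hom X Y d), p (homogeneous φ))
    (h2 : ∀ f g, p f → p g → p (f + g)) : p f :=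
  DirectSum.induction_on f h0 h1 h2

variable (L) in
/-- The identity. -/
def idHom (X : Obj) : L.Hom X X := homogeneous (d := 0) ⟨𝟙 _, L.id_mem X⟩

theorem compHom_id (f : L.Hom X Y) : compHom X Y Y f (L.idHom Y) = f := by
  induction f using hom_induction with
  | h0 => simp
  | h1 d φ =>
    rw [idHom, compHom_homogeneous φ _ (zero_add d)]
    refine congrArg homogeneous (Subtype.ext ?_)
    exact (congrArg (φ.1 ≫ ·) (L.lift_id Y d)).trans (Category.comp_id _)
  | h2 f g hf hg => rw [map_add, AddMonoidHom.add_apply, hf, hg]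

theorem id_compHom (f : L.Hom X Y) : compHom X X Y (L.idHom X) f = f := by
  induction f using hom_induction with
  | h0 => simp
  | h1 d φ =>
    rw [idHom, compHom_homogeneous _ φ (add_zero d)]
    refine congrArg homogeneous (Subtype.ext ?_)
    rw [hcomp]
    exact (Category.id_comp _).trans (L.lift_zero φ)
  | h2 f g hf hg => rw [map_add, hf, hg]

theorem compHom_assoc (f : L.Hom X Y) (g : L.Hom Y Z) (h : L.Hom Z W) :
    compHom X Z W (compHom X Y Z f g) h = compHom X Y W f (compHom Y Z W g h) := by
  induction f using hom_induction with
  | h0 => simp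
  | h2 f f' hf hf' => simp only [map_add, AddMonoidHom.add_apply, hf, hf']
  | h1 d φ =>
    induction g using hom_induction with
    | h0 => simp
    | h2 f f' hf hf' => simp only [map_add, AddMonoidHom.add_apply, hf, hf']
    | h1 e ψ =>
      induction h using hom_induction with
      | h0 => simp
      | h2 f f' hf hf' => simp only [map_add, hf, hf']
      | h1 a χ =>
        rw [compHom_homogeneous φ ψ rfl, compHom_homogeneous ψ χ rfl,
          compHom_homogeneous _ χ rfl, compHom_homogeneous φ _ (add_assoc a e d)]
        refine congrArg homogeneous (Subtype.ext ?_)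
        change (φ.1 ≫ L.lift ψ d (e + d) rfl) ≫ L.lift χ (e + d) (a + (e + d)) rfl =
          φ.1 ≫ L.lift ⟨ψ.1 ≫ L.lift χ e (a + e) rfl, _⟩ d (a + (e + d)) _
        rw [L.lift_comp ψ χ (a + e) rfl d (e + d) (a + (e + d)) rfl rfl (add_assoc a e d),
          Category.assoc]

variable (L)

/-- The category with the given objects and with the graded groups of morphisms `⨁ d, hom X Y d`. -/
structure Cat (_L : LayeredHoms layer) where
  of : Obj

noncomputable instance : Category L.Cat where
  Hom X Y := L.Hom X.of Y.of
  id X := L.idHom X.of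
  comp f g := compHom _ _ _ f g
  id_comp f := id_compHom f
  comp_id f := compHom_id f
  assoc f g h := compHom_assoc f g h

/-- The functor given by a map on objects which preserves the layers, enlarges the groups of
morphisms and is compatible with the induced maps. It is the inclusion on morphisms. -/
noncomputable def functor {Obj' : Type w} {layer' : Obj' → ℕ → T} (F : Obj → Obj')
    (L : LayeredHoms fun X => layer' (F X)) (L' : LayeredHoms layer')
    (hle : ∀ (X Y : Obj) (d : ℕ), L.hom X Y d ≤ L'.hom (F X) (F Y) d)
    (hlift : ∀ {X Y : Obj} {d : ℕ} (φ : L.hom X Y d) (i m : ℕ) (h : d + i = m),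
      L'.lift ⟨φ.1, hle X Y d φ.2⟩ i m h = L.lift φ i m h) : L.Cat ⥤ L'.Cat where
  obj X := ⟨F X.of⟩
  map {X Y} f := DirectSum.map (fun d => AddSubgroup.inclusion (hle X.of Y.of d)) f
  map_id X := DirectSum.map_of _ _ _
  map_comp {X Y Z} f g := by
    change DirectSum.map _ (compHom _ _ _ f g) =
      compHom _ _ _ (DirectSum.map _ f) (DirectSum.map _ g)
    induction f using hom_induction with
    | h0 => simp
    | h2 f f' hf hf' => simp only [map_add, AddMonoidHom.add_apply, hf, hf']
    | h1 d φ =>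
      induction g using hom_induction with
      | h0 => simp
      | h2 f f' hf hf' => simp only [map_add, hf, hf']
      | h1 e ψ =>
        rw [compHom_homogeneous (L := L) φ ψ rfl]
        simp only [homogeneous, DirectSum.map_of]
        refine Eq.trans ?_ (compHom_homogeneous _ _ rfl).symm
        refine congrArg homogeneous (Subtype.ext ?_)
        exact congrArg (φ.1 ≫ ·) (hlift ψ d (e + d) rfl).symm

end LayeredHoms

end

section

open CategoryTheory CategoryTheory.Limits CategoryTheory.Pretriangulated

/-- `X` is isomorphic to a finite direct sum of objects of `𝒮`. -/
def InAdd {T : Type u} [Category.{v} T] [HasZeroMorphisms T] (𝒮 : Set T) (X : T) : Prop :=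
  ∃ (ι : Type) (_ : Finite ι) (s : ι → T) (b : Bicone s), (∀ j, s j ∈ 𝒮) ∧ Nonempty b.IsBilimit ∧
    Nonempty (X ≅ b.pt)

theorem InAdd.hom_ext {T : Type u} [Category.{v} T] [HasZeroMorphisms T] {𝒮 : Set T} {X W : T}
    (hX : InAdd 𝒮 X) {f g : W ⟶ X} (h : ∀ S ∈ 𝒮, ∀ p : X ⟶ S, f ≫ p = g ≫ p) : f = g := by
  obtain ⟨ι, _, s, b, hs, ⟨hb⟩, ⟨e⟩⟩ := hX
  rw [← cancel_mono e.hom]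
  refine hb.isLimit.hom_ext fun ⟨j⟩ => ?_
  simpa using h (s j) (hs j) (e.hom ≫ b.π j)

theorem InAdd.exists_desc {T : Type u} [Category.{v} T] [HasZeroMorphisms T] {𝒮 : Set T}
    {X V W : T} (hX : InAdd 𝒮 X) (a : V ⟶ W)
    (h : ∀ S ∈ 𝒮, ∀ p : V ⟶ S, ∃ q : W ⟶ S, a ≫ q = p) (f : V ⟶ X) : ∃ g : W ⟶ X, a ≫ g = f := by
  obtain ⟨ι, _, s, b, hs, ⟨hb⟩, ⟨e⟩⟩ := hX
  choose q hq using fun j => h (s j) (hs j) (f ≫ e.hom ≫ b.π j)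
  obtain ⟨l, hl⟩ : ∃ l : W ⟶ b.pt, ∀ j, l ≫ b.π j = q j :=
    ⟨hb.isLimit.lift (Fan.mk W q), fun j => hb.isLimit.fac (Fan.mk W q) ⟨j⟩⟩
  refine ⟨l ≫ e.inv, ?_⟩
  rw [← cancel_mono e.hom, Category.assoc, Category.assoc, Iso.inv_hom_id, Category.comp_id]
  refine hb.isLimit.hom_ext fun ⟨j⟩ => ?_
  change (a ≫ l) ≫ b.π j = (f ≫ e.hom) ≫ b.π j
  rw [Category.assoc, Category.assoc, hl, hq]

/-- A sequence `⋯ ⟶ M 2 ⟶ M 1 ⟶ M 0` with sequences `M (i + 1) ⟶ M i ⟶ N i ⟶ (M (i + 1))⟦1⟧`. -/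
structure FDiagram (T : Type u) [Category.{v} T] [HasShift T ℤ] where
  M : ℕ → T
  N : ℕ → T
  f : ∀ i, M (i + 1) ⟶ M i
  ε : ∀ i, M i ⟶ N i
  δ : ∀ i, N i ⟶ (M (i + 1))⟦(1 : ℤ)⟧

namespace FDiagram

section

variable {T : Type u} [Category.{v} T] [HasShift T ℤ] (D D' D'' : FDiagram T)

/-- A family of morphisms `M i ⟶ M' (d + i)` and `N i ⟶ N' (d + i)` which commute with the
morphisms of the diagrams. -/
structure Ladder (d : ℕ) where
  h : ∀ i m, d + i = m → (D.M i ⟶ D'.M m)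
  g : ∀ i m, d + i = m → (D.N i ⟶ D'.N m)
  comm_f : ∀ i m (hi : d + i = m),
    D.f i ≫ h i m hi = h (i + 1) (m + 1) (by omega) ≫ D'.f m
  comm_ε : ∀ i m (hi : d + i = m), D.ε i ≫ g i m hi = h i m hi ≫ D'.ε m
  comm_δ : ∀ i m (hi : d + i = m),
    D.δ i ≫ (h (i + 1) (m + 1) (by omega))⟦1⟧' = g i m hi ≫ D'.δ m

/-- The identity ladder. -/
def Ladder.id : Ladder D D 0 where
  h i m hi := eqToHom (by rw [← hi, zero_add])
  g i m hi := eqToHom (by rw [← hi, zero_add])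
  comm_f i m hi := by obtain rfl : i = m := by omega
                      simp
  comm_ε i m hi := by obtain rfl : i = m := by omega
                      simp
  comm_δ i m hi := by obtain rfl : i = m := by omega
                      simp

variable {D D' D''}

/-- Composition of ladders. -/
def Ladder.comp {d e : ℕ} (a : Ladder D D' d) (b : Ladder D' D'' e) (n : ℕ) (h : e + d = n) :
    Ladder D D'' n where
  h i m hi := a.h i (d + i) rfl ≫ b.h (d + i) m (by omega)
  g i m hi := a.g i (d + i) rfl ≫ b.g (d + i) m (by omega)
  comm_f i m hi := by
    rw [← Category.assoc, a.comm_f, Category.assoc, b.comm_f, ← Category.assoc]; rfl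
  comm_ε i m hi := by
    rw [← Category.assoc, a.comm_ε, Category.assoc, b.comm_ε, ← Category.assoc]
  comm_δ i m hi := by
    rw [Functor.map_comp, ← Category.assoc]
    refine (congrArg (· ≫ _) (a.comm_δ i (d + i) rfl)).trans ?_
    rw [Category.assoc, Category.assoc]
    exact congrArg (_ ≫ ·) (b.comm_δ (d + i) m (by omega))

end

variable {T : Type u} [Category.{v} T] [Preadditive T] [HasZeroObject T] [HasShift T ℤ]
  [∀ n : ℤ, (shiftFunctor T n).Additive] [Pretriangulated T]

/-- The conditions on the objects of the category of filtered objects. -/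
structure IsFiltered (𝒮 : Set T) (D : FDiagram T) : Prop where
  bounded : ∃ r, ∀ i, r ≤ i → IsZero (D.M i)
  distinguished : ∀ i, Triangle.mk (D.f i) (D.ε i) (D.δ i) ∈ distTriang T
  inAdd : ∀ i, InAdd 𝒮 (D.N i)
  surjective : ∀ S ∈ 𝒮, Function.Surjective fun q : D.N 0 ⟶ S => D.ε 0 ≫ q
  bijective : ∀ i, 1 ≤ i → ∀ S ∈ 𝒮, Function.Bijective fun q : D.N i ⟶ S => D.ε i ≫ q

/-- The sum of ladders. -/
def Ladder.add {D D' : FDiagram T} {d : ℕ} (a b : Ladder D D' d) : Ladder D D' d where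
  h i m hi := a.h i m hi + b.h i m hi
  g i m hi := a.g i m hi + b.g i m hi
  comm_f i m hi := by rw [Preadditive.comp_add, Preadditive.add_comp, a.comm_f, b.comm_f]
  comm_ε i m hi := by rw [Preadditive.comp_add, Preadditive.add_comp, a.comm_ε, b.comm_ε]
  comm_δ i m hi := by
    rw [Functor.map_add, Preadditive.comp_add, Preadditive.add_comp, a.comm_δ, b.comm_δ]

namespace IsFiltered

variable {𝒮 : Set T} {D D' : FDiagram T}

theorem exists_desc (hD : IsFiltered 𝒮 D) {X : T} (hX : InAdd 𝒮 X) (i : ℕ) (p : D.M i ⟶ X) :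
    ∃ q : D.N i ⟶ X, D.ε i ≫ q = p := by
  refine hX.exists_desc _ (fun S hS => ?_) p
  rcases Nat.eq_zero_or_pos i with rfl | hi
  · exact hD.surjective S hS
  · exact (hD.bijective i hi S hS).2

theorem hom_ext (hD : IsFiltered 𝒮 D) {X : T} (hX : InAdd 𝒮 X) (i : ℕ) {p q : D.N (i + 1) ⟶ X}
    (h : D.ε (i + 1) ≫ p = D.ε (i + 1) ≫ q) : p = q := by
  refine hX.hom_ext fun S hS r => (hD.bijective (i + 1) (by omega) S hS).1 ?_
  change D.ε (i + 1) ≫ p ≫ r = D.ε (i + 1) ≫ q ≫ r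
  rw [← Category.assoc, h, Category.assoc]

/-- The induction step for the construction of ladders. -/
theorem exists_step (hD : IsFiltered 𝒮 D) (hD' : IsFiltered 𝒮 D') (i m : ℕ) (h : D.M i ⟶ D'.M m)
    (g : D.N i ⟶ D'.N m) (hg : D.ε i ≫ g = h ≫ D'.ε m) :
    ∃ (h' : D.M (i + 1) ⟶ D'.M (m + 1)) (g' : D.N (i + 1) ⟶ D'.N (m + 1)),
      D.ε (i + 1) ≫ g' = h' ≫ D'.ε (m + 1) ∧ D.f i ≫ h = h' ≫ D'.f m ∧
        D.δ i ≫ h'⟦1⟧' = g ≫ D'.δ m := by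
  obtain ⟨h', h1, h2⟩ := complete_distinguished_triangle_morphism₁ _ _ (hD.distinguished i)
    (hD'.distinguished m) h g hg
  obtain ⟨g', hg'⟩ := hD.exists_desc (hD'.inAdd (m + 1)) (i + 1) (h' ≫ D'.ε (m + 1))
  exact ⟨h', g', hg', h1, h2⟩

theorem exists_ladder (hD : IsFiltered 𝒮 D) (hD' : IsFiltered 𝒮 D') (d : ℕ) (h : D.M 0 ⟶ D'.M d)
    (g : D.N 0 ⟶ D'.N d) (hg : D.ε 0 ≫ g = h ≫ D'.ε d) :
    ∃ l : Ladder D D' d, l.h 0 d rfl = h ∧ l.g 0 d rfl = g := by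
  choose! h' g' H using hD.exists_step hD'
  let s : ∀ i, {p : (D.M i ⟶ D'.M (d + i)) × (D.N i ⟶ D'.N (d + i)) //
      D.ε i ≫ p.2 = p.1 ≫ D'.ε (d + i)} := fun i =>
    Nat.rec ⟨(h, g), hg⟩ (fun i p =>
      ⟨(h' i (d + i) p.1.1 p.1.2, g' i (d + i) p.1.1 p.1.2), (H i (d + i) _ _ p.2).1⟩) i
  refine ⟨⟨fun i m hi => (s i).1.1 ≫ eqToHom (by rw [hi]), fun i m hi => (s i).1.2 ≫
    eqToHom (by rw [hi]), ?_, ?_, ?_⟩, ?_, ?_⟩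
  · rintro i _ rfl
    rw [eqToHom_refl, eqToHom_refl, Category.comp_id, Category.comp_id]
    exact (H i (d + i) _ _ (s i).2).2.1
  · rintro i _ rfl
    rw [eqToHom_refl, eqToHom_refl, Category.comp_id, Category.comp_id]
    exact (s i).2
  · rintro i _ rfl
    rw [eqToHom_refl, eqToHom_refl, Category.comp_id, Category.comp_id]
    exact (H i (d + i) _ _ (s i).2).2.2
  · exact Category.comp_id _
  · exact Category.comp_id _

theorem eq_zero_of_comp_eq_zero (hD : IsFiltered 𝒮 D) (hD' : IsFiltered 𝒮 D') (i m : ℕ)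
    (h' : D.M (i + 1) ⟶ D'.M (m + 1)) (g' : D.N (i + 1) ⟶ D'.N (m + 1))
    (hδ : D.δ i ≫ h'⟦1⟧' = 0)
    (hg' : D.ε (i + 1) ≫ g' = h' ≫ D'.ε (m + 1)) : g' = 0 := by
  obtain ⟨z, hz⟩ : ∃ z : D.M i ⟶ D'.M (m + 1), h' = D.f i ≫ z := by
    have h1 := rot_of_distTriang _ (rot_of_distTriang _ (hD.distinguished i))
    obtain ⟨z, hz⟩ := Triangle.yoneda_exact₂ _ h1 (h'⟦1⟧') hδ
    obtain ⟨z, rfl⟩ := (shiftFunctor T (1 : ℤ)).map_surjective z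
    change D.M i ⟶ D'.M (m + 1) at z
    refine ⟨-z, (shiftFunctor T (1 : ℤ)).map_injective (hz.trans ?_)⟩
    refine Eq.symm ?_
    rw [Preadditive.comp_neg, Functor.map_neg, Functor.map_comp]
    exact (Preadditive.neg_comp _ _).symm
  obtain ⟨r, hr⟩ := hD.exists_desc (hD'.inAdd (m + 1)) i (z ≫ D'.ε (m + 1))
  refine hD.hom_ext (hD'.inAdd (m + 1)) i ?_
  have h0 : D.f i ≫ D.ε i = 0 := comp_distTriang_mor_zero₁₂ _ (hD.distinguished i)
  rw [hg', hz, Category.assoc, ← hr, ← Category.assoc, h0, zero_comp, comp_zero]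

theorem ladder_unique (hD : IsFiltered 𝒮 D) (hD' : IsFiltered 𝒮 D') {d : ℕ}
    (l l' : Ladder D D' d) (h0 : l.g 0 d rfl = l'.g 0 d rfl) (i m : ℕ) (hi : d + i = m) :
    l.g i m hi = l'.g i m hi := by
  subst hi
  induction i with
  | zero => exact h0
  | succ i ih =>
    refine sub_eq_zero.mp (hD.eq_zero_of_comp_eq_zero hD' i (d + i)
      (l.h (i + 1) (d + i + 1) rfl - l'.h (i + 1) (d + i + 1) rfl) _ ?_ ?_)
    · rw [Functor.map_sub, Preadditive.comp_sub]
      refine sub_eq_zero.mpr ?_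
      rw [l.comm_δ i (d + i) rfl, l'.comm_δ i (d + i) rfl, ih]
    · rw [Preadditive.comp_sub, Preadditive.sub_comp]
      exact congrArg₂ (· - ·) (l.comm_ε (i + 1) _ rfl) (l'.comm_ε (i + 1) _ rfl)

end IsFiltered

/-- The subgroup of those morphisms `g : N 0 ⟶ N' d` for which there is a morphism
`h : M 0 ⟶ M' d` such that `h ≫ ε' = ε ≫ g`. -/
def homDeg (D D' : FDiagram T) (d : ℕ) : AddSubgroup (D.N 0 ⟶ D'.N d) where
  carrier := {g | ∃ h : D.M 0 ⟶ D'.M d, h ≫ D'.ε d = D.ε 0 ≫ g}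
  zero_mem' := ⟨0, by rw [zero_comp, comp_zero]⟩
  add_mem' := by
    rintro g g' ⟨h, hh⟩ ⟨h', hh'⟩
    exact ⟨h + h', by rw [Preadditive.add_comp, Preadditive.comp_add, hh, hh']⟩
  neg_mem' := by
    rintro g ⟨h, hh⟩
    exact ⟨-h, by rw [Preadditive.neg_comp, Preadditive.comp_neg, hh]⟩

theorem Ladder.mem_homDeg {D D' : FDiagram T} {d : ℕ} (l : Ladder D D' d) :
    l.g 0 d rfl ∈ homDeg D D' d := ⟨l.h 0 d rfl, (l.comm_ε 0 d rfl).symm⟩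

end FDiagram

/-- The objects of the category of filtered objects. -/
structure FObj {T : Type u} [Category.{v} T] [Preadditive T] [HasZeroObject T] [HasShift T ℤ]
    [∀ n : ℤ, (shiftFunctor T n).Additive] [Pretriangulated T] (𝒮 : Set T) where
  D : FDiagram T
  isFiltered : D.IsFiltered 𝒮

namespace FObj

variable {T : Type u} [Category.{v} T] [Preadditive T] [HasZeroObject T] [HasShift T ℤ]
  [∀ n : ℤ, (shiftFunctor T n).Additive] [Pretriangulated T] {𝒮 : Set T}

theorem exists_ladder {X Y : FObj 𝒮} {d : ℕ} (g : FDiagram.homDeg X.D Y.D d) :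
    ∃ l : FDiagram.Ladder X.D Y.D d, l.g 0 d rfl = g := by
  obtain ⟨g, h, hh⟩ := g
  obtain ⟨l, -, hl⟩ := X.isFiltered.exists_ladder Y.isFiltered d h g hh.symm
  exact ⟨l, hl⟩

theorem ladder_g {X Y : FObj 𝒮} {d : ℕ} (l l' : FDiagram.Ladder X.D Y.D d)
    (h : l.g 0 d rfl = l'.g 0 d rfl) (i m : ℕ) (hi : d + i = m) : l.g i m hi = l'.g i m hi :=
  X.isFiltered.ladder_unique Y.isFiltered l l' h i m hi

/-- The map `N i ⟶ N' (d + i)` induced by a homogeneous morphism of degree `d`: the component of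
any ladder which extends it. -/
noncomputable def lift {X Y : FObj 𝒮} {d : ℕ} (g : FDiagram.homDeg X.D Y.D d) (i m : ℕ)
    (h : d + i = m) : X.D.N i ⟶ Y.D.N m := (exists_ladder g).choose.g i m h

theorem lift_eq {X Y : FObj 𝒮} {d : ℕ} (g : FDiagram.homDeg X.D Y.D d)
    (l : FDiagram.Ladder X.D Y.D d) (hl : l.g 0 d rfl = g) (i m : ℕ) (h : d + i = m) :
    lift g i m h = l.g i m h :=
  ladder_g _ _ ((exists_ladder g).choose_spec.trans hl.symm) i m h

variable (𝒮)

/-- The morphisms of the category of filtered objects. -/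
noncomputable def homs : LayeredHoms fun X : FObj 𝒮 => X.D.N where
  hom X Y d := FDiagram.homDeg X.D Y.D d
  lift g i m h := lift g i m h
  lift_zero g := (exists_ladder g).choose_spec
  lift_add {X Y d} g g' i m h := by
    obtain ⟨l, hl⟩ := exists_ladder g
    obtain ⟨l', hl'⟩ := exists_ladder g'
    rw [lift_eq g l hl, lift_eq g' l' hl', lift_eq (g + g') (l.add l') (congrArg₂ (· + ·) hl hl')]
    rfl
  id_mem X := (FDiagram.Ladder.id X.D).mem_homDeg
  lift_id X i := lift_eq _ (FDiagram.Ladder.id X.D) rfl i i _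
  comp_mem {X Y Z d e} g g' n h := by
    obtain ⟨l, hl⟩ := exists_ladder g
    obtain ⟨l', hl'⟩ := exists_ladder g'
    rw [lift_eq g' l' hl', ← hl]
    exact (l.comp l' n h).mem_homDeg
  lift_comp {X Y Z d e} g g' n h i m p him hml hil := by
    obtain ⟨l, hl⟩ := exists_ladder g
    obtain ⟨l', hl'⟩ := exists_ladder g'
    subst him
    refine (lift_eq _ (l.comp l' n h) ?_ _ _ _).trans
      (congrArg₂ (· ≫ ·) (lift_eq g l hl i _ rfl) (lift_eq g' l' hl' _ p hml)).symm
    change l.g 0 d rfl ≫ l'.g d n h = g.1 ≫ lift g' d n h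
    rw [hl, lift_eq g' l' hl']

end FObj

/-- The category of filtered objects. -/
abbrev FCat {T : Type u} [Category.{v} T] [Preadditive T] [HasZeroObject T] [HasShift T ℤ]
    [∀ n : ℤ, (shiftFunctor T n).Additive] [Pretriangulated T] (𝒮 : Set T) :=
  (FObj.homs 𝒮).Cat

end

section

open CategoryTheory

section Filtrable

variable {A : Type u} [Ring A] (𝒮 : Set (FGModuleCat.{u} A))

/-- `M` is isomorphic to a finite direct sum of modules in `𝒮`. -/
def ModInAdd (M : Type u) [AddCommGroup M] [Module A M] : Prop :=
  ∃ (ι : Type) (_ : Finite ι) (s : ι → FGModuleCat.{u} A), (∀ j, s j ∈ 𝒮) ∧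
    Nonempty (M ≃ₗ[A] ∀ j, s j)

/-- `M` has a finite filtration with successive quotients in `add 𝒮`. -/
def IsFiltrable (M : Type u) [AddCommGroup M] [Module A M] : Prop :=
  ∃ F : ℕ → Submodule A M, F 0 = ⊤ ∧ (∃ r, F r = ⊥) ∧ (∀ i, F (i + 1) ≤ F i) ∧
    ∀ i, ModInAdd 𝒮 (F i ⧸ (F (i + 1)).submoduleOf (F i))

/-- `U` is a minimal filtrable submodule of `M` such that `M ⧸ U` is in `add 𝒮`. -/
def IsRadicalSubmodule {M : Type u} [AddCommGroup M] [Module A M] (U : Submodule A M) : Prop :=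
  Minimal (fun L : Submodule A M => IsFiltrable 𝒮 L ∧ ModInAdd 𝒮 (M ⧸ L)) U

variable {𝒮} {M N : Type u} [AddCommGroup M] [Module A M] [AddCommGroup N] [Module A N]

theorem ModInAdd.of_equiv (h : ModInAdd 𝒮 M) (e : M ≃ₗ[A] N) : ModInAdd 𝒮 N := by
  obtain ⟨ι, hι, s, hs, ⟨f⟩⟩ := h
  exact ⟨ι, hι, s, hs, ⟨e.symm ≪≫ₗ f⟩⟩

theorem ModInAdd.prod_mem (h : ModInAdd 𝒮 M) {S : FGModuleCat.{u} A} (hS : S ∈ 𝒮) :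
    ModInAdd 𝒮 (M × S) := by
  obtain ⟨ι, hι, s, hs, ⟨e⟩⟩ := h
  let t : Option ι → FGModuleCat.{u} A := fun o => o.elim S s
  refine ⟨Option ι, inferInstance, t, fun o => ?_, ⟨LinearEquiv.ofBijective
    (LinearMap.pi fun o => Option.rec (motive := fun o => M × S →ₗ[A] t o)
      (LinearMap.snd A M S) (fun j => LinearMap.proj j ∘ₗ e.toLinearMap ∘ₗ LinearMap.fst A M S) o)
    ⟨?_, ?_⟩⟩⟩
  · cases o with
    | none => exact hS
    | some j => exact hs j
  · rintro ⟨m, x⟩ ⟨m', x'⟩ h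
    refine Prod.ext (e.injective (funext fun j => ?_)) (congrFun h none)
    exact congrFun h (some j)
  · intro y
    refine ⟨(e.symm fun j => y (some j), y none), funext fun o => ?_⟩
    cases o with
    | none => rfl
    | some j => exact congrFun (e.apply_symm_apply fun j => y (some j)) j

/-- The kernel of a map from a direct sum which is bijective on one summand. -/
theorem ModInAdd.ker {ι : Type} [Finite ι] {s : ι → FGModuleCat.{u} A} (hs : ∀ j, s j ∈ 𝒮)
    (e : M ≃ₗ[A] ∀ j, s j) (q : M →ₗ[A] N) (l : ι) (g : s l →ₗ[A] M)
    (hg : ∀ x j, j ≠ l → e (g x) j = 0) (hgl : ∀ x, e (g x) l = x)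
    (hq : Function.Bijective (q ∘ₗ g)) : ModInAdd 𝒮 (LinearMap.ker q) := by
  refine ⟨{j // j ≠ l}, inferInstance, fun j => s j, fun j => hs j, ⟨LinearEquiv.ofBijective
    (LinearMap.pi fun j => LinearMap.proj j.1 ∘ₗ e.toLinearMap ∘ₗ (LinearMap.ker q).subtype)
    ⟨?_, ?_⟩⟩⟩
  · rw [← LinearMap.ker_eq_bot, LinearMap.ker_eq_bot']
    rintro ⟨x, hx⟩ h
    have hx' : x = g (e x l) := by
      apply e.injective
      funext j
      by_cases hj : j = l
      · subst hj; exact (hgl _).symm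
      · rw [hg _ j hj]; exact congrFun h ⟨j, hj⟩
    have h0 : (q ∘ₗ g) (e x l) = (q ∘ₗ g) 0 := by
      rw [map_zero, LinearMap.comp_apply, ← hx']; exact hx
    have h1 := hq.1 h0
    rw [h1, map_zero] at hx'
    exact Subtype.ext hx'
  · intro y
    classical
    let z : ∀ j, s j := fun j => if h : j ≠ l then y ⟨j, h⟩ else 0
    obtain ⟨a, ha⟩ := hq.2 (q (e.symm z))
    refine ⟨⟨e.symm z - g a, ?_⟩, funext fun j => ?_⟩
    · rw [LinearMap.mem_ker, map_sub, ← ha]; exact sub_self _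
    · change e (e.symm z - g a) j.1 = y j
      rw [map_sub, e.apply_symm_apply, Pi.sub_apply, hg a j.1 j.2, sub_zero]
      simp [z, j.2]

/-- The image of a subquotient under an injective map. -/
noncomputable def subquotientEquiv (f : M →ₗ[A] N) (hf : Function.Injective f)
    (P Q : Submodule A M) :
    (Q ⧸ P.submoduleOf Q) ≃ₗ[A] (Q.map f ⧸ (P.map f).submoduleOf (Q.map f)) :=
  Submodule.Quotient.equiv _ _ (Submodule.equivMapOfInjective f hf Q) (by
    ext ⟨y, hy⟩
    constructor
    · rintro ⟨x, hx, h⟩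
      rw [← h]
      exact ⟨x, hx, rfl⟩
    · intro h
      obtain ⟨x, hx, hxy⟩ := h
      obtain ⟨x', hx', hxy'⟩ := hy
      have h0 : x' = x := hf (hxy'.trans hxy.symm)
      subst h0
      exact ⟨⟨x', hx'⟩, hx, Subtype.ext hxy⟩)

theorem IsFiltrable.of_step (W : Submodule A M) (hW : IsFiltrable 𝒮 W) (h : ModInAdd 𝒮 (M ⧸ W)) :
    IsFiltrable 𝒮 M := by
  obtain ⟨F, h0, ⟨r, hr⟩, hle, hF⟩ := hW
  let F' : ℕ → Submodule A M := fun i => Nat.rec ⊤ (fun i _ => (F i).map W.subtype) i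
  have hF'0 : F' 1 = W := by
    change (F 0).map W.subtype = W
    rw [h0, Submodule.map_top, Submodule.range_subtype]
  refine ⟨F', rfl, ⟨r + 1, ?_⟩, fun i => ?_, fun i => ?_⟩
  · change (F r).map W.subtype = ⊥
    rw [hr, Submodule.map_bot]
  · cases i with
    | zero => exact le_top
    | succ i => exact Submodule.map_mono (hle i)
  · cases i with
    | zero =>
      change ModInAdd 𝒮 ((⊤ : Submodule A M) ⧸ (F' 1).submoduleOf ⊤)
      rw [hF'0]
      refine h.of_equiv (Submodule.Quotient.equiv _ _ Submodule.topEquiv.symm ?_)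
      ext x
      constructor
      · rintro ⟨y, hy, rfl⟩
        exact hy
      · intro hx
        exact ⟨x.1, hx, rfl⟩
    | succ i => exact (hF i).of_equiv (subquotientEquiv W.subtype W.subtype_injective _ _)

theorem IsFiltrable.of_equiv (h : IsFiltrable 𝒮 M) (e : M ≃ₗ[A] N) : IsFiltrable 𝒮 N := by
  obtain ⟨F, h0, ⟨r, hr⟩, hle, hF⟩ := h
  refine ⟨fun i => (F i).map e.toLinearMap, ?_, ⟨r, ?_⟩, fun i => Submodule.map_mono (hle i),
    fun i => (hF i).of_equiv (subquotientEquiv e.toLinearMap e.injective _ _)⟩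
  · change (F 0).map e.toLinearMap = ⊤
    rw [h0, Submodule.map_top, LinearEquiv.range]
  · change (F r).map e.toLinearMap = ⊥
    rw [hr, Submodule.map_bot]

/-- A radical submodule cannot be made smaller by means of a map to an element of `𝒮`. -/
theorem IsRadicalSubmodule.eq_zero {U : Submodule A M} (hU : IsRadicalSubmodule 𝒮 U)
    {S : FGModuleCat.{u} A} (hS : S ∈ 𝒮) (r : M →ₗ[A] S)
    (hr : Function.Surjective (r ∘ₗ U.subtype))
    (hker : IsFiltrable 𝒮 (LinearMap.ker (r ∘ₗ U.subtype))) : r ∘ₗ U.subtype = 0 := by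
  let L : Submodule A M := U ⊓ LinearMap.ker r
  let c : M →ₗ[A] (M ⧸ U) × S := U.mkQ.prod r
  have hc : Function.Surjective c := by
    rintro ⟨x, y⟩
    obtain ⟨m, rfl⟩ := U.mkQ_surjective x
    obtain ⟨t, ht⟩ := hr (y - r m)
    refine ⟨m + t.1, Prod.ext ?_ ?_⟩
    · change U.mkQ (m + t.1) = U.mkQ m
      rw [map_add, add_eq_left]
      exact (Submodule.Quotient.mk_eq_zero _).mpr t.2
    · change r (m + t.1) = y
      rw [map_add]
      exact (congrArg (r m + ·) ht).trans (add_sub_cancel _ _)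
  have hcker : LinearMap.ker c = L := by
    rw [LinearMap.ker_prod, Submodule.ker_mkQ]
  have hL : IsFiltrable 𝒮 L := hker.of_equiv
    (LinearEquiv.ofBijective (LinearMap.codRestrict L
      (U.subtype ∘ₗ (LinearMap.ker (r ∘ₗ U.subtype)).subtype) fun x => ⟨x.1.2, x.2⟩)
      ⟨fun x y h => Subtype.ext (Subtype.ext (congrArg (fun z : L => z.1) h)),
        fun y => ⟨⟨⟨y.1, y.2.1⟩, y.2.2⟩, rfl⟩⟩)
  have hL' : ModInAdd 𝒮 (M ⧸ L) := (hU.prop.2.prod_mem hS).of_equiv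
    ((LinearMap.quotKerEquivOfSurjective c hc).symm ≪≫ₗ Submodule.quotEquivOfEq _ _ hcker)
  have hle : U ≤ L := hU.le_of_le ⟨hL, hL'⟩ inf_le_left
  ext x : 1
  exact (hle x.2).2

/-- A module is indecomposable if it is not zero and not the direct sum of two nonzero
submodules. -/
def IsIndecomposable (A : Type u) [Ring A] (M : Type u) [AddCommGroup M] [Module A M] : Prop :=
  Nontrivial M ∧ ∀ P Q : Submodule A M, IsCompl P Q → P = ⊥ ∨ Q = ⊥

theorem IsProjectiveMap.sum {ι : Type} (s : Finset ι) (f : ι → M →ₗ[A] N)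
    (h : ∀ i ∈ s, IsProjectiveMap (f i)) : IsProjectiveMap (∑ i ∈ s, f i) := by
  classical
  induction s using Finset.induction_on with
  | empty => exact .zero
  | insert i s hi ih =>
    rw [Finset.sum_insert hi]
    exact (h i (by simp)).add (ih fun j hj => h j (by simp [hj]))

theorem isProjectiveMap_of_components {ι κ : Type} [Finite ι] [Finite κ]
    {s : ι → FGModuleCat.{u} A} {t : κ → FGModuleCat.{u} A} (e : M ≃ₗ[A] ∀ i, s i)
    (e' : N ≃ₗ[A] ∀ j, t j) (f : M →ₗ[A] N)
    (h : ∀ i j, ∀ g : s i →ₗ[A] M, (∀ x i', i' ≠ i → e (g x) i' = 0) → (∀ x, e (g x) i = x) →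
      IsProjectiveMap (LinearMap.proj j ∘ₗ e'.toLinearMap ∘ₗ f ∘ₗ g)) : IsProjectiveMap f := by
  classical
  have := Fintype.ofFinite ι
  have := Fintype.ofFinite κ
  have hf : f = ∑ i, ∑ j, (e'.symm.toLinearMap ∘ₗ LinearMap.single A (fun j => t j) j) ∘ₗ
      (LinearMap.proj j ∘ₗ e'.toLinearMap ∘ₗ f ∘ₗ
        (e.symm.toLinearMap ∘ₗ LinearMap.single A (fun i => s i) i)) ∘ₗ
        (LinearMap.proj i ∘ₗ e.toLinearMap) := by
    ext m
    simp only [LinearMap.coe_sum, Finset.sum_apply, LinearMap.comp_apply, LinearMap.coe_proj,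
      LinearEquiv.coe_coe, Function.eval, LinearMap.coe_single, ← map_sum]
    rw [LinearEquiv.eq_symm_apply]
    have h1 : ∀ i, ∑ j, Pi.single (M := fun j => (t j : Type u)) j
        (e' (f (e.symm (Pi.single i (e m i)))) j) = e' (f (e.symm (Pi.single i (e m i)))) :=
      fun i => Finset.univ_sum_single _
    simp only [h1, ← map_sum]
    rw [Finset.univ_sum_single, LinearEquiv.symm_apply_apply]
  rw [hf]
  refine .sum _ _ fun i _ => .sum _ _ fun j _ => ((h i j _ ?_ ?_).comp_right _).comp_left _
  · intro x i' hi'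
    simp [Pi.single_eq_of_ne hi']
  · intro x
    simp

end Filtrable

section System

variable (k : Type w) (A : Type u) [Field k] [Ring A] [Algebra k A]

/-- A finite set of indecomposable modules such that the space of homomorphisms in the stable
category between two of them is `k` if they are equal, and zero otherwise. -/
structure IsStableSystem (𝒮 : Set (FGModuleCat.{u} A)) : Prop where
  finite : 𝒮.Finite
  indecomposable : ∀ S ∈ 𝒮, IsIndecomposable A S
  hom_eq_zero : ∀ S ∈ 𝒮, ∀ T ∈ 𝒮, S ≠ T → ∀ f : stabObj k A S ⟶ stabObj k A T, f = 0
  finrank_end : ∀ S ∈ 𝒮, Module.finrank k (stabObj k A S ⟶ stabObj k A S) = 1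

variable {k A} [Module.Finite k A] {𝒮 : Set (FGModuleCat.{u} A)}

theorem isNilpotent_of_isProjectiveMap (k : Type w) [Field k] [Algebra k A] [Module.Finite k A]
    {S : Type u} [AddCommGroup S] [Module A S] [Module.Finite A S]
    (hS : IsIndecomposable A S) (hS' : ¬ IsProjectiveMap (LinearMap.id : S →ₗ[A] S))
    (f : S →ₗ[A] S) (hf : IsProjectiveMap f) : IsNilpotent (f : Module.End A S) := by
  have : IsArtinianRing A := IsArtinianRing.of_finite k A
  have hc := LinearMap.isCompl_iSup_ker_pow_iInf_range_pow f
  rcases hS.2 _ _ hc with h | h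
  · exfalso
    have hinj : Function.Injective f := by
      rw [← LinearMap.ker_eq_bot, eq_bot_iff, ← h]
      exact le_iSup_of_le 1 (by rw [pow_one])
    have hbij := IsArtinian.bijective_of_injective_endomorphism f hinj
    let e := LinearEquiv.ofBijective f hbij
    apply hS'
    have h1 : (LinearMap.id : S →ₗ[A] S) = e.symm.toLinearMap ∘ₗ f := by
      ext x
      exact (e.symm_apply_apply x).symm
    rw [h1]
    exact hf.comp_left _
  · obtain ⟨n, hn⟩ := Filter.eventually_atTop.mp (LinearMap.eventually_iInf_range_pow_eq f)
    refine ⟨n, ?_⟩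
    have := hn n le_rfl
    rw [h] at this
    exact LinearMap.range_eq_bot.mp this.symm

theorem IsStableSystem.bijective (h : IsStableSystem k A 𝒮) {S T : FGModuleCat.{u} A} (hS : S ∈ 𝒮)
    (hT : T ∈ 𝒮) (g : S →ₗ[A] T) (hg : ¬ IsProjectiveMap g) : Function.Bijective g := by
  rw [← stabMap_eq_zero_iff k] at hg
  by_cases hST : S = T
  swap
  · exact absurd (h.hom_eq_zero S hS T hT hST _) hg
  subst hST
  have hid : (𝟙 (stabObj k A S)) ≠ 0 := fun h0 => hg (by
    rw [← Category.comp_id (stabMap k g), h0, Limits.comp_zero])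
  obtain ⟨c, hc⟩ := (finrank_eq_one_iff_of_nonzero' _ hid).mp (h.finrank_end S hS) (stabMap k g)
  have hc0 : c ≠ 0 := by
    rintro rfl
    exact hg (by rw [← hc, zero_smul])
  let a : S →ₗ[A] S := (c • 𝟙 S : S ⟶ S).hom.hom
  let b : S →ₗ[A] S := (c⁻¹ • 𝟙 S : S ⟶ S).hom.hom
  have hba : b ∘ₗ a = LinearMap.id := by
    ext x
    change algebraMap k A c⁻¹ • algebraMap k A c • x = x
    rw [smul_smul, ← map_mul, inv_mul_cancel₀ hc0, map_one, one_smul]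
  have hab : a ∘ₗ b = LinearMap.id := by
    ext x
    change algebraMap k A c • algebraMap k A c⁻¹ • x = x
    rw [smul_smul, ← map_mul, mul_inv_cancel₀ hc0, map_one, one_smul]
  have hga : IsProjectiveMap (g - a) := by
    rw [← stabMap_eq_iff k, ← hc]
    rfl
  have hn := isNilpotent_of_isProjectiveMap k (h.indecomposable S hS)
    (fun h0 => hid (by rw [← stabMap_id, stabMap_eq_zero_iff]; exact h0)) (b ∘ₗ (g - a))
    (hga.comp_left b)
  have hu := hn.isUnit_one_add
  have hbg : b ∘ₗ g = (1 + b ∘ₗ (g - a) : Module.End A S) := by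
    rw [LinearMap.comp_sub, hba]
    exact (add_sub_cancel _ _).symm
  rw [← hbg, Module.End.isUnit_iff] at hu
  have hbb : Function.Bijective b := by
    refine Function.bijective_iff_has_inverse.mpr ⟨a, fun x => ?_, fun x => ?_⟩
    · exact LinearMap.congr_fun hab x
    · exact LinearMap.congr_fun hba x
  exact (Function.Bijective.of_comp_iff' hbb g).mp hu

theorem IsRadicalSubmodule.isProjectiveMap (h : IsStableSystem k A 𝒮) {V : Type u}
    [AddCommGroup V] [Module A V] {U : Submodule A V} (hU : IsRadicalSubmodule 𝒮 U)
    (W : Submodule A U) (hW : IsFiltrable 𝒮 W) (hUW : ModInAdd 𝒮 (U ⧸ W)) {B : Type u}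
    [AddCommGroup B] [Module A B] (hB : ModInAdd 𝒮 B) (φ : V →ₗ[A] B) (ψ : (U ⧸ W) →ₗ[A] B)
    (hψ : ψ ∘ₗ W.mkQ = φ ∘ₗ U.subtype) : IsProjectiveMap ψ := by
  obtain ⟨ι, _, s, hs, ⟨e⟩⟩ := hUW
  obtain ⟨κ, _, t, ht, ⟨e'⟩⟩ := hB
  refine isProjectiveMap_of_components e e' ψ fun i j g hg hgl => ?_
  by_contra hnot
  let p : B →ₗ[A] t j := LinearMap.proj j ∘ₗ e'.toLinearMap
  have hbij : Function.Bijective ((p ∘ₗ ψ) ∘ₗ g) := h.bijective (hs i) (ht j) _ hnot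
  have hker : ModInAdd 𝒮 (LinearMap.ker (p ∘ₗ ψ)) := ModInAdd.ker hs e (p ∘ₗ ψ) i g hg hgl hbij
  have hr : (p ∘ₗ φ) ∘ₗ U.subtype = (p ∘ₗ ψ) ∘ₗ W.mkQ := by
    rw [LinearMap.comp_assoc, ← hψ, ← LinearMap.comp_assoc]
  have hsurj : Function.Surjective ((p ∘ₗ φ) ∘ₗ U.subtype) := by
    rw [hr]
    intro y
    obtain ⟨x, hx⟩ := hbij.2 y
    obtain ⟨z, hz⟩ := W.mkQ_surjective (g x)
    exact ⟨z, by rw [← hx]; exact congrArg (p ∘ₗ ψ) hz⟩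
  have hzero := hU.eq_zero (ht j) (p ∘ₗ φ) hsurj (by
    rw [hr]
    let K := LinearMap.ker ((p ∘ₗ ψ) ∘ₗ W.mkQ)
    have hWK : W ≤ K := by
      intro x hx
      change (p ∘ₗ ψ) (W.mkQ x) = 0
      rw [show W.mkQ x = 0 from (Submodule.Quotient.mk_eq_zero W).mpr hx, map_zero]
    refine IsFiltrable.of_step (W.submoduleOf K)
      (hW.of_equiv (Submodule.submoduleOfEquivOfLe hWK).symm) ?_
    let c : K →ₗ[A] LinearMap.ker (p ∘ₗ ψ) :=
      LinearMap.codRestrict _ (W.mkQ ∘ₗ K.subtype) fun x => x.2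
    have hc : Function.Surjective c := by
      rintro ⟨x, hx⟩
      obtain ⟨z, rfl⟩ := W.mkQ_surjective x
      exact ⟨⟨z, hx⟩, rfl⟩
    have hck : LinearMap.ker c = W.submoduleOf K := by
      refine (LinearMap.ker_codRestrict _ _ _).trans ?_
      rw [LinearMap.ker_comp, Submodule.ker_mkQ]
      rfl
    exact hker.of_equiv ((LinearMap.quotKerEquivOfSurjective c hc).symm ≪≫ₗ
      Submodule.quotEquivOfEq _ _ hck))
  apply hnot
  have : LinearMap.proj j ∘ₗ e'.toLinearMap ∘ₗ ψ ∘ₗ g = 0 := by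
    ext x
    obtain ⟨z, hz⟩ := W.mkQ_surjective (g x)
    have := LinearMap.congr_fun hzero z
    rw [hr] at this
    change p (ψ (W.mkQ z)) = 0 at this
    rw [hz] at this
    exact this
  rw [this]
  exact .zero

theorem IsRadicalSubmodule.isProjectiveMap' (h : IsStableSystem k A 𝒮) {V : Type u}
    [AddCommGroup V] [Module A V] {U : Submodule A V} (hU : IsRadicalSubmodule 𝒮 U) {U' : Type u}
    [AddCommGroup U'] [Module A U'] (j : U' ≃ₗ[A] U)
    (W : Submodule A U') (hW : IsFiltrable 𝒮 W) (hUW : ModInAdd 𝒮 (U' ⧸ W)) {B : Type u}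
    [AddCommGroup B] [Module A B] (hB : ModInAdd 𝒮 B) (φ : V →ₗ[A] B) (ψ : (U' ⧸ W) →ₗ[A] B)
    (hψ : ψ ∘ₗ W.mkQ = φ ∘ₗ U.subtype ∘ₗ j.toLinearMap) : IsProjectiveMap ψ := by
  let Q : (U' ⧸ W) ≃ₗ[A] U ⧸ W.map j.toLinearMap := Submodule.Quotient.equiv _ _ j rfl
  have := (hU.isProjectiveMap h (W.map j.toLinearMap) (hW.of_equiv (j.submoduleMap W))
    (hUW.of_equiv Q) hB φ (ψ ∘ₗ Q.symm.toLinearMap) (by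
      ext u : 1
      obtain ⟨u, rfl⟩ := j.surjective u
      have h1 : Q.symm ((W.map j.toLinearMap).mkQ (j u)) = W.mkQ u := by
        rw [LinearEquiv.symm_apply_eq]; rfl
      change ψ (Q.symm ((W.map j.toLinearMap).mkQ (j u))) = _
      rw [h1]
      exact LinearMap.congr_fun hψ u)).comp_right Q.toLinearMap
  rwa [LinearMap.comp_assoc, LinearEquiv.symm_comp, LinearMap.comp_id] at this

end System

/-- A finitely generated module with a finite filtration `⋯ ⊆ fil 2 ⊆ fil 1 ⊆ fil 0`, where
`fil (i + 1)` is a minimal filtrable submodule of `fil i` such that the quotient is in `add 𝒮`. -/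
structure GObj (_k : Type w) {A : Type u} [Ring A] (𝒮 : Set (FGModuleCat.{u} A)) where
  M : FGModuleCat.{u} A
  fil : ℕ → Submodule A M
  fil_zero : fil 0 = ⊤
  fil_le : ∀ i, fil (i + 1) ≤ fil i
  exists_eq_bot : ∃ r, fil r = ⊥
  radical : ∀ i, IsRadicalSubmodule 𝒮 ((fil (i + 1)).submoduleOf (fil i))

namespace GObj

variable {k : Type w} {A : Type u} [Field k] [Ring A] [Algebra k A] [Module.Finite k A]
  {𝒮 : Set (FGModuleCat.{u} A)} (X Y Z : GObj k 𝒮)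

instance (i : ℕ) : Module.Finite A (X.fil i) := by
  have : IsNoetherianRing A := IsNoetherianRing.of_finite k A
  infer_instance

/-- The successive quotients of the filtration. -/
abbrev layer (i : ℕ) : Type u := X.fil i ⧸ (X.fil (i + 1)).submoduleOf (X.fil i)

/-- The successive quotients of the filtration, as objects of the stable category. -/
noncomputable def stabLayer (i : ℕ) : Stab k A := stabObj k A (X.layer i)

variable {X Y Z}

/-- `f` is a filtered map from `X` to `fil d` of `Y`, with the induced filtration. -/
def IsFilteredMap (X Y : GObj k 𝒮) (d : ℕ) (f : X.M →ₗ[A] Y.M) : Prop :=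
  ∀ i m, d + i = m → ∀ x ∈ X.fil i, f x ∈ Y.fil m

namespace IsFilteredMap

variable {d e : ℕ} {f f' : X.M →ₗ[A] Y.M} {g : Y.M →ₗ[A] Z.M}

theorem add (hf : IsFilteredMap X Y d f) (hf' : IsFilteredMap X Y d f') :
    IsFilteredMap X Y d (f + f') :=
  fun i m h x hx => add_mem (hf i m h x hx) (hf' i m h x hx)

theorem sub (hf : IsFilteredMap X Y d f) (hf' : IsFilteredMap X Y d f') :
    IsFilteredMap X Y d (f - f') :=
  fun i m h x hx => sub_mem (hf i m h x hx) (hf' i m h x hx)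

theorem comp (hf : IsFilteredMap X Y d f) (hg : IsFilteredMap Y Z e g) (n : ℕ) (h : e + d = n) :
    IsFilteredMap X Z n (g ∘ₗ f) :=
  fun i m hi x hx => hg (d + i) m (by omega) _ (hf i (d + i) rfl x hx)

theorem id : IsFilteredMap X X 0 LinearMap.id := fun i m hi x hx => by
  obtain rfl : i = m := by omega
  exact hx

/-- The restriction of a filtered map. -/
def res (hf : IsFilteredMap X Y d f) (i m : ℕ) (h : d + i = m) : X.fil i →ₗ[A] Y.fil m :=
  f.restrict (hf i m h)

/-- The map between the layers induced by a filtered map. -/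
def layerMap (hf : IsFilteredMap X Y d f) (i m : ℕ) (h : d + i = m) :
    X.layer i →ₗ[A] Y.layer m :=
  Submodule.mapQ _ _ (hf.res i m h) fun x hx => hf (i + 1) (m + 1) (by omega) x.1 hx

theorem isProjectiveMap_succ (h : IsStableSystem k A 𝒮) (hf : IsFilteredMap X Y d f) (i m : ℕ)
    (hi : d + i = m) (h0 : IsProjectiveMap (hf.layerMap i m hi)) :
    IsProjectiveMap (hf.layerMap (i + 1) (m + 1) (by omega)) := by
  obtain ⟨P, _, _, _, _, a, b, hab⟩ := h0
  obtain ⟨b', hb'⟩ := Module.projective_lifting_property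
    ((Y.fil (m + 1)).submoduleOf (Y.fil m)).mkQ b (Submodule.mkQ_surjective _)
  let p : X.fil i →ₗ[A] Y.fil m := b' ∘ₗ a ∘ₗ ((X.fil (i + 1)).submoduleOf (X.fil i)).mkQ
  have hp : ∀ x, (hf.res i m hi - p) x ∈ (Y.fil (m + 1)).submoduleOf (Y.fil m) := by
    intro x
    rw [← Submodule.Quotient.mk_eq_zero]
    change Submodule.mkQ _ (hf.res i m hi x - b' (a (Submodule.mkQ _ x))) = 0
    rw [map_sub]
    have h1 := LinearMap.congr_fun hb' (a (((X.fil (i + 1)).submoduleOf (X.fil i)).mkQ x))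
    have h2 := LinearMap.congr_fun hab (((X.fil (i + 1)).submoduleOf (X.fil i)).mkQ x)
    exact sub_eq_zero.mpr (h2.symm.trans h1.symm)
  let φ : X.fil i →ₗ[A] Y.layer (m + 1) := Submodule.mkQ _ ∘ₗ
    (Submodule.submoduleOfEquivOfLe (Y.fil_le m)).toLinearMap ∘ₗ LinearMap.codRestrict _ _ hp
  refine (X.radical i).isProjectiveMap' h (Submodule.submoduleOfEquivOfLe (X.fil_le i)).symm
    _ (X.radical (i + 1)).prop.1 (X.radical (i + 1)).prop.2 (Y.radical (m + 1)).prop.2 φ _ ?_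
  ext u : 1
  refine congrArg (Submodule.mkQ _) (Subtype.ext ?_)
  let u' : X.fil i := ⟨u.1, X.fil_le i u.2⟩
  change f u.1 = f u.1 - (b' (a (((X.fil (i + 1)).submoduleOf (X.fil i)).mkQ u'))).1
  have h3 : ((X.fil (i + 1)).submoduleOf (X.fil i)).mkQ u' = 0 :=
    (Submodule.Quotient.mk_eq_zero _).mpr u.2
  rw [h3, map_zero, map_zero]
  exact (sub_zero _).symm

/-- A filtered map which induces zero on the first layer in the stable category induces zero on
all layers. -/
theorem isProjectiveMap (h : IsStableSystem k A 𝒮) (hf : IsFilteredMap X Y d f)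
    (h0 : IsProjectiveMap (hf.layerMap 0 d rfl)) (i m : ℕ) (hi : d + i = m) :
    IsProjectiveMap (hf.layerMap i m hi) := by
  subst hi
  induction i with
  | zero => exact h0
  | succ i ih => exact hf.isProjectiveMap_succ h i (d + i) rfl ih

end IsFilteredMap

/-- The morphism in the stable category induced by a filtered map on a layer. -/
noncomputable def stabLayerMap {d : ℕ} {f : X.M →ₗ[A] Y.M} (hf : IsFilteredMap X Y d f) (i m : ℕ)
    (h : d + i = m) : X.stabLayer i ⟶ Y.stabLayer m := stabMap k (hf.layerMap i m h)

theorem stabLayerMap_eq (h : IsStableSystem k A 𝒮) {d : ℕ} {f f' : X.M →ₗ[A] Y.M}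
    (hf : IsFilteredMap X Y d f) (hf' : IsFilteredMap X Y d f')
    (h0 : stabLayerMap hf 0 d rfl = stabLayerMap hf' 0 d rfl) (i m : ℕ) (hi : d + i = m) :
    stabLayerMap hf i m hi = stabLayerMap hf' i m hi := by
  have key : ∀ i m hi, hf.layerMap i m hi - hf'.layerMap i m hi = (hf.sub hf').layerMap i m hi := by
    intro i m hi
    refine LinearMap.ext fun x => ?_
    obtain ⟨x, rfl⟩ := Submodule.mkQ_surjective _ x
    rfl
  refine (stabMap_eq_iff k _ _).mpr ?_
  rw [key]
  refine (hf.sub hf').isProjectiveMap h ?_ i m hi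
  rw [← key]
  exact (stabMap_eq_iff k _ _).mp h0

theorem stabLayerMap_id (i : ℕ) :
    stabLayerMap (IsFilteredMap.id (X := X)) i i (zero_add i) = 𝟙 (X.stabLayer i) := by
  refine Eq.trans ?_ (stabMap_id k)
  refine congrArg (stabMap k) (LinearMap.ext fun x => ?_)
  obtain ⟨x, rfl⟩ := Submodule.mkQ_surjective _ x
  rfl

theorem stabLayerMap_add {d : ℕ} {f f' : X.M →ₗ[A] Y.M} (hf : IsFilteredMap X Y d f)
    (hf' : IsFilteredMap X Y d f') (i m : ℕ) (hi : d + i = m) :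
    stabLayerMap (hf.add hf') i m hi = stabLayerMap hf i m hi + stabLayerMap hf' i m hi := by
  refine Eq.trans ?_ (stabMap_add k _ _)
  refine congrArg (stabMap k) (LinearMap.ext fun x => ?_)
  obtain ⟨x, rfl⟩ := Submodule.mkQ_surjective _ x
  rfl

theorem stabLayerMap_comp {d e n : ℕ} {f : X.M →ₗ[A] Y.M} {g : Y.M →ₗ[A] Z.M}
    (hf : IsFilteredMap X Y d f) (hg : IsFilteredMap Y Z e g) (h : e + d = n) (i m l : ℕ)
    (him : d + i = m) (hml : e + m = l) (hil : n + i = l) :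
    stabLayerMap (hf.comp hg n h) i l hil = stabLayerMap hf i m him ≫ stabLayerMap hg m l hml := by
  refine Eq.trans ?_ (stabMap_comp k _ _)
  refine congrArg (stabMap k) (LinearMap.ext fun x => ?_)
  obtain ⟨x, rfl⟩ := Submodule.mkQ_surjective _ x
  rfl

/-- The image of the filtered maps from `X` to `fil d` of `Y` in the morphisms of the stable
category between the first layers. -/
def homDeg (X Y : GObj k 𝒮) (d : ℕ) : AddSubgroup (X.stabLayer 0 ⟶ Y.stabLayer d) where
  carrier := {φ | ∃ (f : X.M →ₗ[A] Y.M) (hf : IsFilteredMap X Y d f), stabLayerMap hf 0 d rfl = φ}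
  zero_mem' := by
    refine ⟨0, fun i m _ x _ => zero_mem _, Eq.trans ?_ (stabMap_zero k)⟩
    refine congrArg (stabMap k) (LinearMap.ext fun x => ?_)
    obtain ⟨x, rfl⟩ := Submodule.mkQ_surjective _ x
    rfl
  add_mem' := by
    rintro _ _ ⟨f, hf, rfl⟩ ⟨f', hf', rfl⟩
    exact ⟨f + f', hf.add hf', stabLayerMap_add hf hf' _ _ _⟩
  neg_mem' := by
    rintro _ ⟨f, hf, rfl⟩
    refine ⟨-f, fun i m h x hx => neg_mem (hf i m h x hx), Eq.trans ?_ (stabMap_neg k _)⟩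
    refine congrArg (stabMap k) (LinearMap.ext fun x => ?_)
    obtain ⟨x, rfl⟩ := Submodule.mkQ_surjective _ x
    rfl

/-- The morphism `layer i ⟶ layer (d + i)` induced by a homogeneous morphism of degree `d`: the one
induced by any filtered map which represents it. -/
noncomputable def lift {d : ℕ} (φ : homDeg X Y d) (i m : ℕ) (h : d + i = m) :
    X.stabLayer i ⟶ Y.stabLayer m := stabLayerMap φ.2.choose_spec.choose i m h

theorem lift_eq (h : IsStableSystem k A 𝒮) {d : ℕ} (φ : homDeg X Y d) {f : X.M →ₗ[A] Y.M}
    (hf : IsFilteredMap X Y d f) (hφ : stabLayerMap hf 0 d rfl = φ) (i m : ℕ) (hi : d + i = m) :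
    lift φ i m hi = stabLayerMap hf i m hi :=
  stabLayerMap_eq h _ hf (φ.2.choose_spec.choose_spec.trans hφ.symm) i m hi

/-- The morphisms of the category of modules with a radical filtration. -/
noncomputable def homs (h : IsStableSystem k A 𝒮) :
    LayeredHoms fun X : GObj k 𝒮 => X.stabLayer where
  hom X Y d := homDeg X Y d
  lift φ i m hi := lift φ i m hi
  lift_zero φ := φ.2.choose_spec.choose_spec
  lift_add {X Y d} φ φ' i m hi := by
    obtain ⟨f, hf, hφ⟩ := φ.2
    obtain ⟨f', hf', hφ'⟩ := φ'.2
    rw [lift_eq h φ hf hφ, lift_eq h φ' hf' hφ', lift_eq h (φ + φ') (hf.add hf')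
      ((stabLayerMap_add hf hf' _ _ _).trans (congrArg₂ (· + ·) hφ hφ')), stabLayerMap_add]
  id_mem X := ⟨_, IsFilteredMap.id, stabLayerMap_id 0⟩
  lift_id X i := (lift_eq h _ IsFilteredMap.id (stabLayerMap_id 0) i i _).trans (stabLayerMap_id i)
  comp_mem {X Y Z d e} φ φ' n hn := by
    obtain ⟨f, hf, hφ⟩ := φ.2
    obtain ⟨f', hf', hφ'⟩ := φ'.2
    rw [lift_eq h φ' hf' hφ', ← hφ]
    exact ⟨_, hf.comp hf' n hn, stabLayerMap_comp hf hf' hn 0 d n rfl hn rfl⟩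
  lift_comp {X Y Z d e} φ φ' n hn i m l him hml hil := by
    obtain ⟨f, hf, hφ⟩ := φ.2
    obtain ⟨f', hf', hφ'⟩ := φ'.2
    refine (lift_eq h _ (hf.comp hf' n hn) ?_ i l hil).trans
      ((stabLayerMap_comp hf hf' hn i m l him hml hil).trans
        (congrArg₂ (· ≫ ·) (lift_eq h φ hf hφ i m him) (lift_eq h φ' hf' hφ' m l hml)).symm)
    exact (stabLayerMap_comp hf hf' hn 0 d n rfl hn rfl).trans
      (congrArg₂ (· ≫ ·) hφ (lift_eq h φ' hf' hφ' d n hn).symm)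

end GObj

/-- The category of modules with a radical filtration. -/
abbrev GCat {k : Type w} {A : Type u} [Field k] [Ring A] [Algebra k A] [Module.Finite k A]
    {𝒮 : Set (FGModuleCat.{u} A)} (h : IsStableSystem k A 𝒮) := (GObj.homs h).Cat

end

section

open CategoryTheory CategoryTheory.Limits

variable {k : Type w} {A : Type u} [Field k] [Ring A] [Algebra k A] [Module.Finite k A]
  [Module.Injective A A] {𝒮 : Set (FGModuleCat.{u} A)}

namespace GObj

variable (X Y : GObj k 𝒮)

/-- The inclusion of `fil (i + 1)` in `fil i`. -/
def incl (i : ℕ) : X.fil (i + 1) →ₗ[A] X.fil i := Submodule.inclusion (X.fil_le i)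

/-- The projection of `fil i` on its layer. -/
def proj (i : ℕ) : X.fil i →ₗ[A] X.layer i := Submodule.mkQ _

theorem incl_injective (i : ℕ) : Function.Injective (X.incl i) :=
  Submodule.inclusion_injective _

theorem proj_surjective (i : ℕ) : Function.Surjective (X.proj i) := Submodule.mkQ_surjective _

theorem incl_proj_exact (i : ℕ) : Function.Exact (X.incl i) (X.proj i) := fun x => by
  refine (Submodule.Quotient.mk_eq_zero _).trans ⟨fun hx => ⟨⟨x.1, hx⟩, rfl⟩, ?_⟩
  rintro ⟨y, rfl⟩
  exact y.2

/-- A connecting map of the short exact sequence `fil (i + 1) → fil i → layer i`. -/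
noncomputable def conn (i : ℕ) : X.layer i →ₗ[A] Cosyzygy k A (X.fil (i + 1)) :=
  (exists_isConnecting (k := k) (X.incl_injective i) (X.incl_proj_exact i)
    (X.proj_surjective i)).choose

theorem isConnecting_conn (i : ℕ) : IsConnecting k (X.incl i) (X.proj i) (X.conn i) :=
  (exists_isConnecting (k := k) (X.incl_injective i) (X.incl_proj_exact i)
    (X.proj_surjective i)).choose_spec

/-- The diagram in the stable category given by a filtered module: the terms of the filtration with
their inclusions and projections to the layers. -/
noncomputable def diagram : FDiagram (Stab k A) where
  M i := stabObj k A (X.fil i)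
  N i := X.stabLayer i
  f i := stabMap k (X.incl i)
  ε i := stabMap k (X.proj i)
  δ i := stabConn k (X.conn i)

variable {X Y}

/-- The morphism of diagrams given by a filtered map. -/
noncomputable def ladder {d : ℕ} {f : X.M →ₗ[A] Y.M} (hf : IsFilteredMap X Y d f) :
    FDiagram.Ladder X.diagram Y.diagram d where
  h i m hi := stabMap k (hf.res i m hi)
  g i m hi := stabLayerMap hf i m hi
  comm_f i m hi := (stabMap_comp k _ _).symm.trans
    ((congrArg (stabMap k) (by ext x; rfl)).trans (stabMap_comp k (hf.res (i + 1) (m + 1) _) _))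
  comm_ε i m hi := (stabMap_comp k _ _).symm.trans
    ((congrArg (stabMap k) (by ext x; rfl)).trans (stabMap_comp k (hf.res i m hi) _))
  comm_δ i m hi := stabConn_naturality k (X.incl_injective i) (X.incl_proj_exact i)
    (X.proj_surjective i) (X.isConnecting_conn i) (Y.isConnecting_conn m)
    (b := hf.res i m hi) (by ext x; rfl) (by ext x; rfl)

end GObj

variable (k) in
/-- The image of a set of modules in the stable category. -/
def stabSet (𝒮 : Set (FGModuleCat.{u} A)) : Set (Stab k A) :=
  (fun S : FGModuleCat.{u} A => stabObj k A S) '' 𝒮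

/-- The functor which sends a module with a radical filtration to its diagram in the stable
category, and which is the inclusion on morphisms. -/
noncomputable def canonicalFunctor (h : IsStableSystem k A 𝒮)
    (hD : ∀ X : GObj k 𝒮, X.diagram.IsFiltered (stabSet k 𝒮)) : GCat h ⥤ FCat (stabSet k 𝒮) :=
  LayeredHoms.functor (fun X : GObj k 𝒮 => (⟨X.diagram, hD X⟩ : FObj (stabSet k 𝒮)))
    (GObj.homs h) (FObj.homs (stabSet k 𝒮))
    (fun X Y d φ hφ => by
      obtain ⟨f, hf, rfl⟩ := hφ
      exact (GObj.ladder hf).mem_homDeg)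
    (fun {X Y d} φ i m hi => by
      obtain ⟨f, hf, hφ⟩ := φ.2
      have hmem : φ.1 ∈ FDiagram.homDeg X.diagram Y.diagram d := hφ ▸ (GObj.ladder hf).mem_homDeg
      exact (FObj.lift_eq (X := ⟨X.diagram, hD X⟩) (Y := ⟨Y.diagram, hD Y⟩) ⟨φ.1, hmem⟩
        (GObj.ladder hf) hφ i m hi).trans (GObj.lift_eq h φ hf hφ i m hi).symm)

variable (k A) in
/-- A system as above which generates: every finitely generated module becomes filtrable after
adding a projective module. -/
structure IsGeneratingSystem (𝒮 : Set (FGModuleCat.{u} A)) : Prop extends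
    IsStableSystem k A 𝒮 where
  exists_filtrable : ∀ M : FGModuleCat.{u} A, ∃ P : FGModuleCat.{u} A,
    Module.Projective A P ∧ IsFiltrable 𝒮 (M × P)

end

section

open CategoryTheory

section AddModules

variable {A : Type u} [Ring A] {𝒮 : Set (FGModuleCat.{u} A)}

theorem ModInAdd.of_subsingleton (M : Type u) [AddCommGroup M] [Module A M] [Subsingleton M] :
    ModInAdd 𝒮 M :=
  ⟨Empty, inferInstance, fun j => j.elim, fun j => j.elim, ⟨default⟩⟩

theorem ModInAdd.induction {P : ∀ (M : Type u) [AddCommGroup M] [Module A M], Prop}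
    (equiv : ∀ (M N : Type u) [AddCommGroup M] [Module A M] [AddCommGroup N] [Module A N],
      (M ≃ₗ[A] N) → P M → P N)
    (zero : ∀ (M : Type u) [AddCommGroup M] [Module A M] [Subsingleton M], P M)
    (prod : ∀ (M : Type u) [AddCommGroup M] [Module A M] (S : FGModuleCat.{u} A), S ∈ 𝒮 →
      ModInAdd 𝒮 M → P M → P (M × S))
    {M : Type u} [AddCommGroup M] [Module A M] (h : ModInAdd 𝒮 M) : P M := by
  obtain ⟨ι, hι, s, hs, ⟨e⟩⟩ := h
  refine equiv _ _ e.symm (Finite.induction_empty_option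
    (P := fun ι => ∀ s : ι → FGModuleCat.{u} A, (∀ j, s j ∈ 𝒮) → P (∀ j, s j)) ?_ ?_ ?_ ι s hs)
  · exact fun {α β} e ih s hs => equiv _ _ (LinearEquiv.piCongrLeft A (fun b => s b) e)
      (ih (fun a => s (e a)) fun a => hs _)
  · exact fun s hs => zero _
  · exact fun {α} _ ih s hs => equiv _ _ ((LinearEquiv.prodComm A _ _) ≪≫ₗ
      (LinearEquiv.piOptionEquivProd A (M := fun j => s j)).symm)
      (prod _ (s none) (hs _) ⟨_, inferInstance, _, fun j => hs (some j), ⟨LinearEquiv.refl A _⟩⟩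
        (ih (fun a => s (some a)) fun a => hs _))

theorem ModInAdd.finite {M : Type u} [AddCommGroup M] [Module A M] (h : ModInAdd 𝒮 M) :
    Module.Finite A M := by
  obtain ⟨ι, _, s, hs, ⟨e⟩⟩ := h
  exact Module.Finite.equiv e.symm

/-- A map to a direct sum of elements of `𝒮` is projective if its components are. -/
theorem ModInAdd.isProjectiveMap_to {M N : Type u} [AddCommGroup M] [Module A M] [AddCommGroup N]
    [Module A N] (hN : ModInAdd 𝒮 N) (f : M →ₗ[A] N)
    (h : ∀ S ∈ 𝒮, ∀ q : N →ₗ[A] S, IsProjectiveMap (q ∘ₗ f)) : IsProjectiveMap f := by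
  classical
  obtain ⟨ι, _, s, hs, ⟨e⟩⟩ := hN
  have := Fintype.ofFinite ι
  have hf : f = ∑ j, (e.symm.toLinearMap ∘ₗ LinearMap.single A (fun j => s j) j) ∘ₗ
      ((LinearMap.proj j ∘ₗ e.toLinearMap) ∘ₗ f) := by
    ext m
    simp only [LinearMap.coe_sum, Finset.sum_apply, LinearMap.comp_apply, LinearMap.coe_proj,
      LinearEquiv.coe_coe, Function.eval, LinearMap.coe_single, ← map_sum]
    rw [LinearEquiv.eq_symm_apply]
    exact (Finset.univ_sum_single (M := fun j => (s j : Type u)) _).symm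
  rw [hf]
  exact .sum _ _ fun j _ => (h _ (hs j) _).comp_left _

/-- A map from a direct sum of elements of `𝒮` which is not projective has a component which is
not projective. -/
theorem ModInAdd.exists_component {M N : Type u} [AddCommGroup M] [Module A M] [AddCommGroup N]
    [Module A N] {ι : Type} [Finite ι] {s : ι → FGModuleCat.{u} A} (e : M ≃ₗ[A] ∀ j, s j)
    (f : M →ₗ[A] N) (hf : ¬ IsProjectiveMap f) : ∃ (j : ι) (g : s j →ₗ[A] M),
      (∀ x i, i ≠ j → e (g x) i = 0) ∧ (∀ x, e (g x) j = x) ∧ ¬ IsProjectiveMap (f ∘ₗ g) := by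
  classical
  have := Fintype.ofFinite ι
  by_contra! hcon
  apply hf
  have hf : f = ∑ j, (f ∘ₗ (e.symm.toLinearMap ∘ₗ LinearMap.single A (fun j => s j) j)) ∘ₗ
      (LinearMap.proj j ∘ₗ e.toLinearMap) := by
    ext m
    simp only [LinearMap.coe_sum, Finset.sum_apply, LinearMap.comp_apply, LinearMap.coe_proj,
      LinearEquiv.coe_coe, Function.eval, LinearMap.coe_single, ← map_sum]
    congr 1
    rw [LinearEquiv.eq_symm_apply]
    exact (Finset.univ_sum_single (M := fun j => (s j : Type u)) _).symm
  rw [hf]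
  refine .sum _ _ fun j _ => (hcon j _ ?_ ?_).comp_right _
  · intro x i hi
    simp [Pi.single_eq_of_ne hi]
  · intro x
    simp

theorem IsFiltrable.of_subsingleton (M : Type u) [AddCommGroup M] [Module A M] [Subsingleton M] :
    IsFiltrable 𝒮 M :=
  ⟨fun _ => ⊤, rfl, ⟨0, Subsingleton.elim _ _⟩, fun _ => le_rfl, fun _ => .of_subsingleton _⟩

variable {M N W : Type u} [AddCommGroup M] [Module A M] [AddCommGroup N] [Module A N]
  [AddCommGroup W] [Module A W]

theorem IsFiltrable.of_exact {i : W →ₗ[A] M} {p : M →ₗ[A] N} (hi : Function.Injective i)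
    (hip : Function.Exact i p) (hp : Function.Surjective p) (hW : IsFiltrable 𝒮 W)
    (hN : ModInAdd 𝒮 N) : IsFiltrable 𝒮 M := by
  refine IsFiltrable.of_step (LinearMap.range i) (hW.of_equiv (LinearEquiv.ofInjective i hi))
    (hN.of_equiv ?_)
  exact (LinearMap.quotKerEquivOfSurjective p hp).symm ≪≫ₗ
    Submodule.quotEquivOfEq _ _ hip.linearMap_ker_eq

theorem IsFiltrable.induction {P : ∀ (M : Type u) [AddCommGroup M] [Module A M], Prop}
    (zero : ∀ (M : Type u) [AddCommGroup M] [Module A M] [Subsingleton M], P M)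
    (step : ∀ (W M N : Type u) [AddCommGroup W] [Module A W] [AddCommGroup M] [Module A M]
      [AddCommGroup N] [Module A N] (i : W →ₗ[A] M) (p : M →ₗ[A] N), Function.Injective i →
      Function.Exact i p → Function.Surjective p → IsFiltrable 𝒮 W → ModInAdd 𝒮 N → P W → P M)
    {M : Type u} [AddCommGroup M] [Module A M] (h : IsFiltrable 𝒮 M) : P M := by
  obtain ⟨F, h0, ⟨r, hr⟩, hle, hF⟩ := h
  have hstep : ∀ n, Function.Exact (Submodule.inclusion (hle n))
      ((F (n + 1)).submoduleOf (F n)).mkQ := fun n x => by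
    refine (Submodule.Quotient.mk_eq_zero _).trans ⟨fun hx => ⟨⟨x.1, hx⟩, rfl⟩, ?_⟩
    rintro ⟨y, rfl⟩
    exact y.2
  have key : ∀ n m, n + m = r → IsFiltrable 𝒮 (F n) ∧ P (F n) := by
    intro n m
    induction m generalizing n with
    | zero =>
      rintro rfl
      have : Subsingleton (F (n + 0)) := by rw [hr]; infer_instance
      exact ⟨.of_subsingleton _, zero _⟩
    | succ m ih =>
      intro hn
      obtain ⟨h1, h2⟩ := ih (n + 1) (by omega)
      exact ⟨.of_exact (Submodule.inclusion_injective _) (hstep n) (Submodule.mkQ_surjective _) h1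
        (hF n), step _ _ _ _ _ (Submodule.inclusion_injective _) (hstep n)
        (Submodule.mkQ_surjective _) h1 (hF n) h2⟩
  obtain ⟨h1, h2⟩ := key 0 r (zero_add r)
  refine step _ _ PUnit.{u + 1} (F 0).subtype 0 (Submodule.subtype_injective _) (fun x => ?_)
    (fun x => ⟨0, Subsingleton.elim _ _⟩) h1 (.of_subsingleton _) h2
  exact ⟨fun _ => ⟨⟨x, h0 ▸ Submodule.mem_top⟩, rfl⟩, fun _ => rfl⟩

end AddModules

section System

variable {k : Type w} {A : Type u} [Field k] [Ring A] [Algebra k A] [Module.Finite k A]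
  {𝒮 : Set (FGModuleCat.{u} A)}
variable {M N : Type u} [AddCommGroup M] [Module A M] [AddCommGroup N] [Module A N]

theorem IsStableSystem.not_isProjectiveMap_id (h : IsStableSystem k A 𝒮) {S : FGModuleCat.{u} A}
    (hS : S ∈ 𝒮) : ¬ IsProjectiveMap (LinearMap.id : S →ₗ[A] S) := by
  intro h0
  rw [← stabMap_eq_zero_iff k, stabMap_id] at h0
  have h1 := h.finrank_end S hS
  have : Subsingleton (stabObj k A S ⟶ stabObj k A S) :=
    ⟨fun f g => by rw [← Category.comp_id f, ← Category.comp_id g, h0, Limits.comp_zero,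
      Limits.comp_zero]⟩
  rw [Module.finrank_zero_of_subsingleton] at h1
  exact zero_ne_one h1

theorem ModInAdd.eq_zero_of_fixed (h : IsStableSystem k A 𝒮) (hN : ModInAdd 𝒮 N) :
    ∀ (e : N →ₗ[A] N), IsProjectiveMap e → ∀ x, e x = x → x = 0 := by
  refine ModInAdd.induction (𝒮 := 𝒮) (P := fun N _ _ => ∀ (e : N →ₗ[A] N), IsProjectiveMap e →
    ∀ x, e x = x → x = 0) ?_ ?_ ?_ hN
  · intro M N _ _ _ _ E ih e he x hx
    have := ih (E.symm.toLinearMap ∘ₗ e ∘ₗ E.toLinearMap) ((he.comp_right _).comp_left _)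
      (E.symm x) (by simp [hx])
    simpa using this
  · intro M _ _ _ e he x hx
    exact Subsingleton.elim _ _
  · rintro M _ _ S hS - ih e he ⟨m, s⟩ hx
    let e22 : S →ₗ[A] S := LinearMap.snd A M S ∘ₗ e ∘ₗ LinearMap.inr A M S
    have hn : IsNilpotent (e22 : Module.End A S) :=
      isNilpotent_of_isProjectiveMap k (h.indecomposable S hS) (h.not_isProjectiveMap_id hS) _
        ((he.comp_right _).comp_left _)
    obtain ⟨⟨a, b, hab, hba⟩, rfl : a = 1 - e22⟩ := hn.isUnit_one_sub
    have hx' : e (LinearMap.inl A M S m) + e (LinearMap.inr A M S s) = (m, s) := by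
      rw [← map_add]
      simpa using hx
    have hm : (e (LinearMap.inl A M S m)).1 + (e (LinearMap.inr A M S s)).1 = m :=
      congrArg Prod.fst hx'
    have hs : (e (LinearMap.inl A M S m)).2 + e22 s = s := congrArg Prod.snd hx'
    have hs' : s = b (e (LinearMap.inl A M S m)).2 := by
      have h1 := LinearMap.congr_fun hba s
      change b (s - e22 s) = s at h1
      rw [← h1]
      congr 1
      exact sub_eq_of_eq_add hs.symm
    have hm0 : m = 0 := ih (LinearMap.fst A M S ∘ₗ e ∘ₗ LinearMap.inl A M S +
      LinearMap.fst A M S ∘ₗ e ∘ₗ LinearMap.inr A M S ∘ₗ b ∘ₗ LinearMap.snd A M S ∘ₗ e ∘ₗ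
        LinearMap.inl A M S)
      (.add ((he.comp_right _).comp_left _) ((he.comp_right _).comp_left _)) m (by
        change (e (LinearMap.inl A M S m)).1 +
          (e (LinearMap.inr A M S (b (e (LinearMap.inl A M S m)).2))).1 = m
        rw [← hs', hm])
    subst hm0
    rw [map_zero, map_zero, Prod.snd_zero, map_zero] at hs'
    rw [hs']
    rfl

theorem ModInAdd.not_isProjectiveMap (h : IsStableSystem k A 𝒮) (hN : ModInAdd 𝒮 N)
    {S : FGModuleCat.{u} A} (hS : S ∈ 𝒮) (f : N →ₗ[A] S) (hf : Function.Surjective f) :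
    ¬ IsProjectiveMap f := by
  rintro ⟨P, _, _, _, _, a, b, hab⟩
  have : IsArtinianRing A := IsArtinianRing.of_finite k A
  have := hN.finite
  have : IsArtinian A N := inferInstance
  obtain ⟨b', hb'⟩ := Module.projective_lifting_property f b hf
  have hinj : Function.Injective ((LinearMap.id : N →ₗ[A] N) - b' ∘ₗ a) := by
    rw [← LinearMap.ker_eq_bot, LinearMap.ker_eq_bot']
    intro x hx
    exact hN.eq_zero_of_fixed h (b' ∘ₗ a) (.of_factor _ _) x (sub_eq_zero.mp hx).symm
  have hsurj := (IsArtinian.bijective_of_injective_endomorphism _ hinj).2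
  have := (h.indecomposable S hS).1
  obtain ⟨y, hy⟩ := exists_ne (0 : S)
  obtain ⟨x, rfl⟩ := hf y
  obtain ⟨x, rfl⟩ := hsurj x
  apply hy
  have h1 : f (b' (a x)) = f x :=
    (LinearMap.congr_fun hb' (a x)).trans (LinearMap.congr_fun hab x)
  change f (x - b' (a x)) = 0
  rw [map_sub, h1, sub_self]

/-- Surjections between direct sums of elements of `𝒮` split. -/
theorem ModInAdd.exists_section (h : IsStableSystem k A 𝒮) (hM : ModInAdd 𝒮 M)
    (hN : ModInAdd 𝒮 N) (f : M →ₗ[A] N) (hf : Function.Surjective f) :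
    ∃ s : N →ₗ[A] M, f ∘ₗ s = LinearMap.id := by
  refine ModInAdd.induction (𝒮 := 𝒮) (P := fun N _ _ => ∀ (M : Type u) [AddCommGroup M]
    [Module A M], ModInAdd 𝒮 M → ∀ f : M →ₗ[A] N, Function.Surjective f →
    ∃ s : N →ₗ[A] M, f ∘ₗ s = LinearMap.id) ?_ ?_ ?_ hN M hM f hf
  · intro N N' _ _ _ _ E ih M _ _ hM f hf
    obtain ⟨s, hs⟩ := ih M hM (E.symm.toLinearMap ∘ₗ f) (E.symm.surjective.comp hf)
    refine ⟨s ∘ₗ E.symm.toLinearMap, LinearMap.ext fun x => ?_⟩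
    have := LinearMap.congr_fun hs (E.symm x)
    exact E.symm.injective this
  · intro N _ _ _ M _ _ _ f _
    exact ⟨0, LinearMap.ext fun x => Subsingleton.elim _ _⟩
  · intro N _ _ S hS _ ih M _ _ hM f hf
    have hS' := hM.not_isProjectiveMap h hS (LinearMap.snd A N S ∘ₗ f)
      (Prod.snd_surjective.comp hf)
    obtain ⟨ι, _, s, hs, ⟨e⟩⟩ := hM
    obtain ⟨j, g, hg, hgj, hfg⟩ := ModInAdd.exists_component e _ hS'
    have hbij := h.bijective (hs j) hS _ hfg
    have hK := ModInAdd.ker hs e _ j g hg hgj hbij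
    let E := LinearEquiv.ofBijective _ hbij
    let σ : S →ₗ[A] M := g ∘ₗ E.symm.toLinearMap
    have hσ : ∀ x, (f (σ x)).2 = x := fun x => E.apply_symm_apply x
    obtain ⟨τ, hτ⟩ := ih _ hK (LinearMap.fst A N S ∘ₗ f ∘ₗ Submodule.subtype _) (by
      intro n
      obtain ⟨m, hm⟩ := hf (n, 0)
      exact ⟨⟨m, congrArg Prod.snd hm⟩, congrArg Prod.fst hm⟩)
    refine ⟨Submodule.subtype _ ∘ₗ τ ∘ₗ (LinearMap.fst A N S -
      LinearMap.fst A N S ∘ₗ f ∘ₗ σ ∘ₗ LinearMap.snd A N S) + σ ∘ₗ LinearMap.snd A N S,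
      LinearMap.ext fun ⟨n, x⟩ => ?_⟩
    have h1 : (f (τ (n - (f (σ x)).1))).1 = n - (f (σ x)).1 :=
      LinearMap.congr_fun hτ (n - (f (σ x)).1)
    have h2 : (f (τ (n - (f (σ x)).1))).2 = 0 := (τ (n - (f (σ x)).1)).2
    change f (τ (n - (f (σ x)).1) + σ x) = (n, x)
    rw [map_add]
    refine Prod.ext ?_ ?_
    · rw [Prod.fst_add, h1]; exact sub_add_cancel _ _
    · rw [Prod.snd_add, h2, hσ]; exact zero_add _

variable [Module.Injective A A]

/-- A map from a filtrable module to an element of `𝒮` which is not zero in the stable category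
is in the stable category equal to a surjective map with filtrable kernel. -/
theorem IsFiltrable.exists_surjective (h : IsStableSystem k A 𝒮) (hM : IsFiltrable 𝒮 M)
    {S : FGModuleCat.{u} A} (hS : S ∈ 𝒮) (f : M →ₗ[A] S) (hf : ¬ IsProjectiveMap f) :
    ∃ f' : M →ₗ[A] S, IsProjectiveMap (f - f') ∧ Function.Surjective f' ∧
      IsFiltrable 𝒮 (LinearMap.ker f') := by
  refine IsFiltrable.induction (𝒮 := 𝒮) (P := fun M _ _ => ∀ (f : M →ₗ[A] S),
    ¬ IsProjectiveMap f → ∃ f' : M →ₗ[A] S, IsProjectiveMap (f - f') ∧ Function.Surjective f' ∧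
      IsFiltrable 𝒮 (LinearMap.ker f')) ?_ ?_ hM f hf
  · intro M _ _ _ f hf
    refine absurd ?_ hf
    rw [show f = 0 from LinearMap.ext fun x => by
      rw [Subsingleton.elim x 0, map_zero, map_zero]]
    exact .zero
  · intro W M N _ _ _ _ _ _ i p hi hip hp hW hN ih f hf
    by_cases hfi : IsProjectiveMap (f ∘ₗ i)
    · obtain ⟨t, ht, hti⟩ := hfi.exists_extend i hi
      obtain ⟨g, hg⟩ := exists_desc hip hp (f - t) (by rw [LinearMap.sub_comp, hti, sub_self])
      have hgp : ¬ IsProjectiveMap g := fun h0 => hf <| by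
        rw [← sub_add_cancel f t, ← hg]
        exact (h0.comp_right p).add ht
      obtain ⟨ι, _, s, hs, ⟨e⟩⟩ := hN
      obtain ⟨j, a, ha, haj, hga⟩ := ModInAdd.exists_component e g hgp
      have hbij := h.bijective (hs j) hS _ hga
      have hK := ModInAdd.ker hs e _ j a ha haj hbij
      refine ⟨g ∘ₗ p, by rw [hg, sub_sub_cancel]; exact ht,
        (Function.Surjective.of_comp (g := a) hbij.2).comp hp, ?_⟩
      refine .of_exact
        (i := LinearMap.codRestrict (LinearMap.ker (g ∘ₗ p)) i fun x => by
          change g (p (i x)) = 0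
          rw [hip.apply_apply_eq_zero, map_zero])
        (p := LinearMap.codRestrict (LinearMap.ker g) (p ∘ₗ Submodule.subtype _) fun x => x.2)
        ?_ ?_ ?_ hW hK
      · exact fun x y hxy => hi (congrArg Subtype.val hxy)
      · rintro ⟨x, hx⟩
        constructor
        · intro h0
          obtain ⟨y, rfl⟩ := (hip x).mp (congrArg Subtype.val h0)
          exact ⟨y, rfl⟩
        · rintro ⟨y, hy⟩
          exact Subtype.ext ((hip x).mpr ⟨y, congrArg Subtype.val hy⟩)
      · rintro ⟨y, hy⟩
        obtain ⟨x, rfl⟩ := hp y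
        exact ⟨⟨x, hy⟩, rfl⟩
    · obtain ⟨f', hf', hsurj, hker⟩ := ih _ hfi
      obtain ⟨t, ht, hti⟩ := hf'.exists_extend i hi
      have hft : ∀ x, (f - t) (i x) = f' x := fun x => by
        have := LinearMap.congr_fun hti x
        simp only [LinearMap.comp_apply, LinearMap.sub_apply] at this ⊢
        rw [this, sub_sub_cancel]
      refine ⟨f - t, by rw [sub_sub_cancel]; exact ht, fun y => ?_, ?_⟩
      · obtain ⟨x, rfl⟩ := hsurj y
        exact ⟨i x, hft x⟩
      · refine .of_exact
          (i := LinearMap.codRestrict (LinearMap.ker (f - t)) (i ∘ₗ Submodule.subtype _) fun x => by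
            change (f - t) (i x.1) = 0
            rw [hft]; exact x.2)
          (p := p ∘ₗ Submodule.subtype _) ?_ ?_ ?_ hker hN
        · exact fun x y hxy => Subtype.ext (hi (congrArg Subtype.val hxy))
        · rintro ⟨x, hx⟩
          constructor
          · intro h0
            obtain ⟨y, rfl⟩ := (hip x).mp h0
            exact ⟨⟨y, (hft y).symm.trans hx⟩, rfl⟩
          · rintro ⟨y, hy⟩
            exact (hip x).mpr ⟨y.1, congrArg Subtype.val hy⟩
        · intro y
          obtain ⟨x, rfl⟩ := hp y
          obtain ⟨z, hz⟩ := hsurj ((f - t) x)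
          refine ⟨⟨x - i z, ?_⟩, ?_⟩
          · rw [LinearMap.mem_ker, map_sub, hft, hz, sub_self]
          · change p (x - i z) = p x
            rw [map_sub, hip.apply_apply_eq_zero, sub_zero]

/-- The maps from a module to the elements of `𝒮` are projective on its radical submodules. -/
theorem IsRadicalSubmodule.isProjectiveMap_comp (h : IsStableSystem k A 𝒮) {U : Submodule A M}
    (hU : IsRadicalSubmodule 𝒮 U) {S : FGModuleCat.{u} A} (hS : S ∈ 𝒮) (r : M →ₗ[A] S) :
    IsProjectiveMap (r ∘ₗ U.subtype) := by
  by_contra hcon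
  obtain ⟨f', hf', hsurj, hker⟩ := hU.prop.1.exists_surjective h hS _ hcon
  obtain ⟨t, ht, htU⟩ := hf'.exists_extend U.subtype U.subtype_injective
  have hft : (r - t) ∘ₗ U.subtype = f' := by
    rw [LinearMap.sub_comp, htU, sub_sub_cancel]
  have h0 := hU.eq_zero hS (r - t) (by rwa [hft]) (by rwa [hft])
  have := (h.indecomposable S hS).1
  obtain ⟨y, hy⟩ := exists_ne (0 : S)
  obtain ⟨x, rfl⟩ := hsurj y
  exact hy (by rw [← hft, h0]; rfl)

/-- Modulo projective maps, the maps to the elements of `𝒮` factor through the quotient by a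
radical submodule. -/
theorem IsRadicalSubmodule.exists_factor (h : IsStableSystem k A 𝒮) {U : Submodule A M}
    (hU : IsRadicalSubmodule 𝒮 U) {S : FGModuleCat.{u} A} (hS : S ∈ 𝒮) (r : M →ₗ[A] S) :
    ∃ q : (M ⧸ U) →ₗ[A] S, IsProjectiveMap (r - q ∘ₗ U.mkQ) := by
  obtain ⟨t, ht, htU⟩ := (hU.isProjectiveMap_comp h hS r).exists_extend U.subtype
    U.subtype_injective
  obtain ⟨q, hq⟩ := exists_desc (LinearMap.exact_subtype_mkQ U) U.mkQ_surjective (r - t)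
    (by rw [LinearMap.sub_comp, htU, sub_self])
  exact ⟨q, by rw [hq, sub_sub_cancel]; exact ht⟩

end System

end

section

open CategoryTheory CategoryTheory.Limits

theorem ModInAdd.of_mem {A : Type u} [Ring A] {𝒮 : Set (FGModuleCat.{u} A)} {S : FGModuleCat.{u} A}
    (hS : S ∈ 𝒮) : ModInAdd 𝒮 S :=
  ⟨Unit, inferInstance, fun _ => S, fun _ => hS, ⟨(LinearEquiv.funUnique Unit A S).symm⟩⟩

/-- The finite direct sum of modules, as a bicone in the stable category. -/
noncomputable def stabBicone (k : Type w) {A : Type u} [Ring A] {ι : Type} [Finite ι]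
    (s : ι → FGModuleCat.{u} A) : Bicone fun j => stabObj k A (s j) := by
  classical
  exact
  { pt := stabObj k A (∀ j, s j)
    π := fun j => stabMap k (LinearMap.proj j)
    ι := fun j => stabMap k (LinearMap.single A (fun j => s j) j)
    ι_π := fun j j' => by
      rw [← stabMap_comp]
      split_ifs with hj
      · subst hj
        rw [LinearMap.proj_comp_single_same, stabMap_id]
        rfl
      · rw [LinearMap.proj_comp_single_ne A (fun j => s j) _ _ (Ne.symm hj), stabMap_zero] }

theorem stabBicone_isBilimit (k : Type w) {A : Type u} [Ring A] {ι : Type} [Finite ι]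
    (s : ι → FGModuleCat.{u} A) : Nonempty (stabBicone k s).IsBilimit := by
  classical
  have := Fintype.ofFinite ι
  refine ⟨isBilimitOfTotal _ ?_⟩
  let F : ((∀ j, s j) →ₗ[A] ∀ j, s j) →+ (stabObj k A (∀ j, s j) ⟶ stabObj k A (∀ j, s j)) :=
    AddMonoidHom.mk' (stabMap k) (stabMap_add k)
  have h1 : ∀ j, (stabBicone k s).π j ≫ (stabBicone k s).ι j =
      F (LinearMap.single A (fun j => s j) j ∘ₗ LinearMap.proj j) := fun j =>
    (stabMap_comp k _ _).symm.trans (by congr!)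
  refine (Finset.sum_congr rfl fun j _ => h1 j).trans ((map_sum F _ _).symm.trans
    ((congrArg F ?_).trans (stabMap_id k)))
  refine LinearMap.ext fun x => ?_
  rw [LinearMap.sum_apply]
  exact Finset.univ_sum_single (M := fun j => (s j : Type u)) x

section

variable {k : Type w} {A : Type u} [Field k] [Ring A] [Algebra k A] [Module.Finite k A]
  [Module.Injective A A] {𝒮 : Set (FGModuleCat.{u} A)}

/-- A linear equivalence, as an isomorphism in the stable category. -/
noncomputable def stabIso (k : Type w) {A : Type u} [Ring A] {M N : Type u} [AddCommGroup M]
    [Module A M] [Module.Finite A M] [AddCommGroup N] [Module A N] [Module.Finite A N]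
    (e : M ≃ₗ[A] N) : stabObj k A M ≅ stabObj k A N where
  hom := stabMap k e.toLinearMap
  inv := stabMap k e.symm.toLinearMap
  hom_inv_id := by rw [← stabMap_comp, LinearEquiv.symm_comp, stabMap_id]
  inv_hom_id := by rw [← stabMap_comp, LinearEquiv.comp_symm, stabMap_id]

theorem ModInAdd.inAdd {N : Type u} [AddCommGroup N] [Module A N] [Module.Finite A N]
    (h : ModInAdd 𝒮 N) : InAdd (stabSet k 𝒮) (stabObj k A N) := by
  obtain ⟨ι, _, s, hs, ⟨e⟩⟩ := h
  exact ⟨ι, inferInstance, _, stabBicone k s, fun j => ⟨s j, hs j, rfl⟩,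
    stabBicone_isBilimit k s, ⟨stabIso k e⟩⟩

namespace GObj

theorem fil_antitone (X : GObj k 𝒮) : Antitone X.fil := antitone_nat_of_succ_le X.fil_le

theorem isFiltered (h : IsStableSystem k A 𝒮) (X : GObj k 𝒮) :
    X.diagram.IsFiltered (stabSet k 𝒮) := by
  have hsurj : ∀ i, ∀ S ∈ stabSet k 𝒮,
      Function.Surjective fun q : X.diagram.N i ⟶ S => X.diagram.ε i ≫ q := by
    rintro i _ ⟨S, hS, rfl⟩ q
    obtain ⟨r, rfl⟩ := stabMap_surjective (M := X.fil i) (N := S) k q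
    obtain ⟨q, hq⟩ := (X.radical i).exists_factor h hS r
    exact ⟨stabMap k q, ((stabMap_comp k _ _).symm.trans ((stabMap_eq_iff k _ _).mpr hq).symm)⟩
  refine ⟨?_, fun i => ?_, fun i => ?_, hsurj 0, fun i hi S hS => ⟨?_, hsurj i S hS⟩⟩
  · obtain ⟨r, hr⟩ := X.exists_eq_bot
    refine ⟨r, fun i hi => ?_⟩
    have h0 : X.fil i = ⊥ := eq_bot_iff.mpr (hr ▸ X.fil_antitone hi)
    have : Subsingleton (X.fil i) := by rw [h0]; infer_instance
    exact isZero_stabObj_of_subsingleton k A (X.fil i)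
  · exact mem_stabDistinguished k (X.incl_injective i) (X.incl_proj_exact i) (X.proj_surjective i)
      (X.isConnecting_conn i)
  · exact (X.radical i).prop.2.inAdd
  · obtain ⟨S, hS, rfl⟩ := hS
    obtain ⟨i, rfl⟩ := Nat.exists_eq_add_of_le' hi
    intro q q' hqq
    obtain ⟨q, rfl⟩ := stabMap_surjective (M := X.layer (i + 1)) (N := S) k q
    obtain ⟨q', rfl⟩ := stabMap_surjective (M := X.layer (i + 1)) (N := S) k q'
    refine (stabMap_eq_iff k _ _).mpr ?_
    have h1 : IsProjectiveMap ((q - q') ∘ₗ X.proj (i + 1)) := by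
      rw [LinearMap.sub_comp, ← stabMap_eq_iff k, stabMap_comp, stabMap_comp]
      exact hqq
    obtain ⟨φ, -, hφ⟩ := h1.exists_extend (X.incl i) (X.incl_injective i)
    refine (X.radical i).isProjectiveMap' h (Submodule.submoduleOfEquivOfLe (X.fil_le i)).symm
      _ (X.radical (i + 1)).prop.1 (X.radical (i + 1)).prop.2 (.of_mem hS) φ _ (hφ.symm.trans ?_)
    rfl

/-- A homogeneous morphism of diagrams is induced by a filtered map. -/
theorem homDeg_diagram_le (h : IsStableSystem k A 𝒮) (X Y : GObj k 𝒮) (d : ℕ) :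
    FDiagram.homDeg X.diagram Y.diagram d ≤ homDeg X Y d := by
  rintro g ⟨h₀, hh⟩
  obtain ⟨g, rfl⟩ := stabMap_surjective (M := X.layer 0) (N := Y.layer d) k g
  obtain ⟨h₀, rfl⟩ := stabMap_surjective (M := X.fil 0) (N := Y.fil d) k h₀
  have lift : ∀ n {V : Type u} [AddCommGroup V] [Module A V] (t : V →ₗ[A] Y.layer n),
      IsProjectiveMap t → ∃ t' : V →ₗ[A] Y.fil n, IsProjectiveMap t' ∧ Y.proj n ∘ₗ t' = t := by
    rintro n V _ _ _ ⟨P, _, _, _, _, a, b, rfl⟩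
    obtain ⟨b', hb'⟩ := Module.projective_lifting_property (Y.proj n) b (Y.proj_surjective n)
    exact ⟨b' ∘ₗ a, .of_factor _ _, by rw [← LinearMap.comp_assoc, hb']⟩
  have key : ∀ n, ∃ f : X.M →ₗ[A] Y.M, ∃ hd : ∀ x, f x ∈ Y.fil d,
      (∀ i ≤ n + 1, ∀ x ∈ X.fil i, f x ∈ Y.fil (d + i)) ∧
        ∀ x : X.fil 0, Y.proj d ⟨f x.1, hd _⟩ = g (X.proj 0 x) := by
    intro n
    induction n with
    | zero =>
      have h1 : IsProjectiveMap (Y.proj d ∘ₗ h₀ - g ∘ₗ X.proj 0) := by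
        rw [← stabMap_eq_iff k, stabMap_comp, stabMap_comp]
        exact hh
      obtain ⟨t, -, ht⟩ := lift d _ h1
      let f₀ : X.fil 0 →ₗ[A] Y.fil d := h₀ - t
      have hf₀ : ∀ x, Y.proj d (f₀ x) = g (X.proj 0 x) := fun x => by
        have := LinearMap.congr_fun ht x
        simp only [LinearMap.comp_apply, LinearMap.sub_apply] at this
        change Y.proj d (h₀ x - t x) = _
        rw [map_sub, this, sub_sub_cancel]
      let e : X.M →ₗ[A] X.fil 0 := LinearMap.codRestrict _ LinearMap.id fun x => by
        rw [X.fil_zero]; exact Submodule.mem_top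
      refine ⟨(Y.fil d).subtype ∘ₗ f₀ ∘ₗ e, fun x => (f₀ (e x)).2, fun i hi x hx => ?_,
        fun x => hf₀ x⟩
      obtain rfl | rfl : i = 0 ∨ i = 1 := by omega
      · exact (f₀ (e x)).2
      · have h2 := hf₀ (e x)
        have h3 : X.proj 0 (e x) = 0 := (Submodule.Quotient.mk_eq_zero _).mpr hx
        rw [h3, map_zero] at h2
        exact (Submodule.Quotient.mk_eq_zero ((Y.fil (d + 1)).submoduleOf (Y.fil d))).mp h2
    | succ n ih =>
      obtain ⟨f, hd, hf, hfg⟩ := ih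
      let f' : X.fil (n + 1) →ₗ[A] Y.fil (d + (n + 1)) := f.restrict (hf (n + 1) le_rfl)
      obtain ⟨q, hq⟩ := (X.isFiltered h).exists_desc ((Y.isFiltered h).inAdd (d + (n + 1))) (n + 1)
        (stabMap k (Y.proj (d + (n + 1)) ∘ₗ f'))
      obtain ⟨q, rfl⟩ := stabMap_surjective (M := X.layer (n + 1)) (N := Y.layer (d + (n + 1))) k q
      have h1 : IsProjectiveMap (Y.proj (d + (n + 1)) ∘ₗ f' - q ∘ₗ X.proj (n + 1)) :=
        (stabMap_eq_iff k _ _).mp (hq.symm.trans (stabMap_comp k _ _).symm)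
      obtain ⟨t, ht, htq⟩ := lift _ _ h1
      obtain ⟨p, -, hp⟩ := ht.exists_extend (X.fil (n + 1)).subtype (Submodule.subtype_injective _)
      refine ⟨f - (Y.fil (d + (n + 1))).subtype ∘ₗ p, fun x => sub_mem (hd x)
        (Y.fil_antitone (by omega) (p x).2), fun i hi x hx => ?_, fun x => ?_⟩
      · rcases Nat.lt_or_ge (n + 1) i with hi' | hi'
        · obtain rfl : i = n + 2 := by omega
          let x' : X.fil (n + 1) := ⟨x, X.fil_le (n + 1) hx⟩
          have h2 : p x = t x' := LinearMap.congr_fun hp x'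
          have h3 := LinearMap.congr_fun htq x'
          have h4 : X.proj (n + 1) x' = 0 := (Submodule.Quotient.mk_eq_zero _).mpr hx
          simp only [LinearMap.comp_apply, LinearMap.sub_apply, h4, map_zero, sub_zero] at h3
          have h5 : Y.proj (d + (n + 1)) (f' x' - t x') = 0 := by rw [map_sub, h3, sub_self]
          have h6 := (Submodule.Quotient.mk_eq_zero _).mp h5
          change f x - (p x).1 ∈ _
          rw [h2]
          exact h6
        · exact sub_mem (hf i hi' x hx) (Y.fil_antitone (by omega) (p x).2)
      · rw [← hfg x, ← sub_eq_zero, ← map_sub]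
        refine (Submodule.Quotient.mk_eq_zero _).mpr ?_
        change (f x - (p x).1) - f x ∈ Y.fil (d + 1)
        rw [sub_sub_cancel_left]
        exact neg_mem (Y.fil_antitone (by omega) (p x).2)
  obtain ⟨r, hr⟩ := X.exists_eq_bot
  obtain ⟨f, hd, hf, hfg⟩ := key r
  have hff : IsFilteredMap X Y d f := by
    rintro i _ rfl x hx
    rcases Nat.lt_or_ge i (r + 1) with hi | hi
    · exact hf i hi.le x hx
    · have h0 : x ∈ X.fil r := X.fil_antitone (by omega) hx
      rw [hr, Submodule.mem_bot] at h0
      rw [h0, map_zero]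
      exact zero_mem _
  refine ⟨f, hff, congrArg (stabMap k) (LinearMap.ext fun x => ?_)⟩
  obtain ⟨x, rfl⟩ := X.proj_surjective 0 x
  exact hfg x

end GObj

end

end

section

open CategoryTheory CategoryTheory.Limits CategoryTheory.Pretriangulated

section Radical

variable {A : Type u} [Ring A] {𝒮 : Set (FGModuleCat.{u} A)}
  {M : Type u} [AddCommGroup M] [Module A M]

theorem IsFiltrable.exists_lt_top (h : IsFiltrable 𝒮 M) : Subsingleton M ∨
    ∃ L : Submodule A M, L ≠ ⊤ ∧ IsFiltrable 𝒮 L ∧ ModInAdd 𝒮 (M ⧸ L) := by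
  refine IsFiltrable.induction (𝒮 := 𝒮) (P := fun M _ _ => Subsingleton M ∨
    ∃ L : Submodule A M, L ≠ ⊤ ∧ IsFiltrable 𝒮 L ∧ ModInAdd 𝒮 (M ⧸ L))
    (fun M _ _ hM => .inl hM) ?_ h
  intro W M N _ _ _ _ _ _ i p hi hip hp hW hN ih
  by_cases hN' : Subsingleton N
  · have hsurj : Function.Surjective i := fun x => (hip x).mp (Subsingleton.elim _ _)
    let e := LinearEquiv.ofBijective i ⟨hi, hsurj⟩
    obtain ih | ⟨L, hL, h1, h2⟩ := ih
    · exact .inl e.symm.injective.subsingleton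
    · refine .inr ⟨L.map e.toLinearMap, fun h0 => hL ?_, h1.of_equiv (e.submoduleMap L),
        h2.of_equiv (Submodule.Quotient.equiv _ _ e rfl)⟩
      refine Submodule.map_injective_of_injective e.injective (h0.trans ?_)
      exact (LinearMap.range_eq_top.mpr e.surjective).symm.trans (Submodule.map_top _).symm
  · refine .inr ⟨LinearMap.range i, fun h0 => hN' ⟨fun x y => ?_⟩,
      hW.of_equiv (LinearEquiv.ofInjective i hi), hN.of_equiv
        ((LinearMap.quotKerEquivOfSurjective p hp).symm ≪≫ₗ
          Submodule.quotEquivOfEq _ _ hip.linearMap_ker_eq)⟩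
    have h1 : ∀ z : N, z = 0 := fun z => by
      obtain ⟨m, rfl⟩ := hp z
      obtain ⟨w, rfl⟩ := LinearMap.range_eq_top.mp h0 m
      exact hip.apply_apply_eq_zero w
    rw [h1 x, h1 y]

theorem IsFiltrable.exists_isRadicalSubmodule [IsArtinian A M] (h : IsFiltrable 𝒮 M) :
    ∃ U : Submodule A M, IsRadicalSubmodule 𝒮 U ∧ (U = ⊤ → Subsingleton M) := by
  obtain hM | ⟨L, hL, h1, h2⟩ := h.exists_lt_top
  · exact ⟨⊤, ⟨⟨.of_subsingleton _, .of_subsingleton _⟩, fun L _ _ x _ => by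
      rw [Subsingleton.elim x 0]; exact L.zero_mem⟩, fun _ => hM⟩
  · obtain ⟨U, hU, hU'⟩ := exists_minimal_le_of_wellFoundedLT
      (fun L : Submodule A M => IsFiltrable 𝒮 L ∧ ModInAdd 𝒮 (M ⧸ L)) L ⟨h1, h2⟩
    exact ⟨U, hU', fun h0 => absurd (top_le_iff.mp (h0 ▸ hU)) hL⟩

/-- A radical submodule is the first step of a radical filtration. -/
theorem IsRadicalSubmodule.exists_filtration [IsArtinian A M] {X : Submodule A M}
    (hX : IsRadicalSubmodule 𝒮 (X.submoduleOf ⊤)) : ∃ fil : ℕ → Submodule A M,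
      fil 0 = ⊤ ∧ fil 1 = X ∧ (∀ i, fil (i + 1) ≤ fil i) ∧ (∃ r, fil r = ⊥) ∧
        ∀ i, IsRadicalSubmodule 𝒮 ((fil (i + 1)).submoduleOf (fil i)) := by
  have hstep : ∀ W : {W : Submodule A M // IsFiltrable 𝒮 W},
      ∃ W' : {W : Submodule A M // IsFiltrable 𝒮 W}, W'.1 ≤ W.1 ∧
        IsRadicalSubmodule 𝒮 (W'.1.submoduleOf W.1) ∧ (W'.1 = W.1 → W.1 = ⊥) := by
    rintro ⟨W, hW⟩
    obtain ⟨U, hU, hU'⟩ := hW.exists_isRadicalSubmodule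
    have h1 : (U.map W.subtype).submoduleOf W = U :=
      Submodule.comap_map_eq_of_injective W.subtype_injective U
    refine ⟨⟨U.map W.subtype, hU.prop.1.of_equiv
      (Submodule.equivMapOfInjective _ W.subtype_injective U)⟩, Submodule.map_subtype_le _ _,
      by rwa [h1], fun h0 => ?_⟩
    have := hU' (by
      rw [← h1, show U.map W.subtype = W from h0]
      exact Submodule.submoduleOf_self W)
    exact Submodule.subsingleton_iff_eq_bot.mp this
  choose next h1 h2 h3 using hstep
  let s : ℕ → {W : Submodule A M // IsFiltrable 𝒮 W} := fun n => Nat.rec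
    ⟨X, hX.prop.1.of_equiv (Submodule.submoduleOfEquivOfLe le_top)⟩ (fun _ W => next W) n
  refine ⟨fun i => Nat.rec ⊤ (fun i _ => (s i).1) i, rfl, rfl, fun i => ?_, ?_, fun i => ?_⟩
  · cases i with
    | zero => exact le_top
    | succ i => exact h1 (s i)
  · have ha : Antitone fun n => (s n).1 := antitone_nat_of_succ_le fun n => h1 (s n)
    obtain ⟨n, hn⟩ := IsArtinian.monotone_stabilizes (R := A) (M := M)
      ⟨fun n => OrderDual.toDual (s n).1, fun a b hab => ha hab⟩
    exact ⟨n + 1, h3 (s n) (hn (n + 1) (Nat.le_succ n)).symm⟩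
  · cases i with
    | zero => exact hX
    | succ i => exact h2 (s i)

end Radical

section Extension

variable {k : Type w} {A : Type u} [Field k] [Ring A] [Algebra k A] [Module.Finite k A]
  [Module.Injective A A] {𝒮 : Set (FGModuleCat.{u} A)}

theorem exists_distinguished {M N L : Type u} [AddCommGroup M] [Module A M] [Module.Finite A M]
    [AddCommGroup N] [Module A N] [Module.Finite A N] [AddCommGroup L] [Module A L]
    [Module.Finite A L] {u : M →ₗ[A] N} {v : N →ₗ[A] L} (hu : Function.Injective u)
    (huv : Function.Exact u v) (hv : Function.Surjective v) :
    ∃ δ, stabTriangle k u v δ ∈ distTriang (Stab k A) := by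
  obtain ⟨δ, hδ⟩ := exists_isConnecting (k := k) hu huv hv
  exact ⟨δ, mem_stabDistinguished k hu huv hv hδ⟩

/-- Distinguished triangles come from short exact sequences with given outer terms. -/
theorem exists_extension (T : Triangle (Stab k A)) (hT : T ∈ distTriang (Stab k A))
    {X N : Type u} [AddCommGroup X] [Module A X] [Module.Finite A X] [AddCommGroup N] [Module A N]
    [Module.Finite A N] (a : T.obj₁ ≅ stabObj k A X) (c : T.obj₃ ≅ stabObj k A N) :
    ∃ (E : FGModuleCat.{u} A) (u : X →ₗ[A] E) (v : E →ₗ[A] N), Function.Injective u ∧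
      Function.Exact u v ∧ Function.Surjective v ∧ ∃ b : T.obj₂ ≅ stabObj k A E,
        T.mor₁ ≫ b.hom = a.hom ≫ stabMap k u ∧ T.mor₂ ≫ c.hom = b.hom ≫ stabMap k v := by
  have : IsNoetherianRing A := IsNoetherianRing.of_finite k A
  obtain ⟨δ, hδ⟩ : ∃ δ : N →ₗ[A] Cosyzygy k A X,
      stabConn k δ = c.inv ≫ T.mor₃ ≫ a.hom⟦(1 : ℤ)⟧' := stabMap_surjective k _
  let E : Submodule A (Hull k A X × N) :=
    LinearMap.ker ((cosyzygyπ k A X).coprod (-δ))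
  have hE : ∀ z : E, cosyzygyπ k A X z.1.1 = δ z.1.2 := fun z => by
    have h0 : cosyzygyπ k A X z.1.1 + -δ z.1.2 = 0 := z.2
    exact eq_of_sub_eq_zero (by rwa [sub_eq_add_neg])
  let u : X →ₗ[A] E := LinearMap.codRestrict E (LinearMap.inl A _ N ∘ₗ hullι k A X) fun x => by
    change cosyzygyπ k A X (hullι k A X x) + -δ 0 = 0
    rw [map_zero, neg_zero, add_zero]
    exact LinearMap.congr_fun (hull_comp k A X) x
  let v : E →ₗ[A] N := LinearMap.snd A _ N ∘ₗ E.subtype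
  have hu : Function.Injective u := fun x y hxy =>
    hullι_injective k A X (congrArg (fun z : E => z.1.1) hxy)
  have huv : Function.Exact u v := fun z => by
    constructor
    · intro hz
      replace hz : z.1.2 = 0 := hz
      have h1 := hE z
      rw [hz, map_zero] at h1
      obtain ⟨x, hx⟩ := (hull_exact k A X _).mp h1
      exact ⟨x, Subtype.ext (Prod.ext hx hz.symm)⟩
    · rintro ⟨x, rfl⟩
      rfl
  have hv : Function.Surjective v := fun n => by
    obtain ⟨y, hy⟩ := cosyzygyπ_surjective k A X (δ n)
    refine ⟨⟨(y, n), ?_⟩, rfl⟩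
    change cosyzygyπ k A X y + -δ n = 0
    rw [hy, add_neg_cancel]
  have hδ' : IsConnecting k u v δ :=
    ⟨LinearMap.fst A _ N ∘ₗ E.subtype, rfl, LinearMap.ext fun z => (hE z).symm⟩
  have hd : stabTriangle k u v δ ∈ distTriang (Stab k A) := mem_stabDistinguished k hu huv hv hδ'
  have hc : T.mor₃ ≫ a.hom⟦1⟧' = c.hom ≫ (stabTriangle k u v δ).mor₃ := by
    change _ = c.hom ≫ stabConn k δ
    rw [hδ, Iso.hom_inv_id_assoc]
  obtain ⟨b, hb1, hb2⟩ := complete_distinguished_triangle_morphism₂ T _ hT hd a.hom c.hom hc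
  let φ : T ⟶ stabTriangle k u v δ := ⟨a.hom, b, c.hom, hb1, hb2, hc⟩
  have hb : IsIso φ.hom₂ := isIso₂_of_isIso₁₃ φ hT hd (inferInstanceAs (IsIso a.hom))
    (inferInstanceAs (IsIso c.hom))
  exact ⟨FGModuleCat.of A E, u, v, hu, huv, hv, @asIso _ _ _ _ φ.hom₂ hb, hb1, hb2⟩

theorem IsFiltrable.isProjectiveMap {M Y : Type u} [AddCommGroup M] [Module A M] [AddCommGroup Y]
    [Module A Y] (hY : IsFiltrable 𝒮 Y)
    (hM : ∀ S ∈ 𝒮, ∀ q : M →ₗ[A] S, IsProjectiveMap q) (f : M →ₗ[A] Y) : IsProjectiveMap f := by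
  refine IsFiltrable.induction (𝒮 := 𝒮) (P := fun Y _ _ => ∀ f : M →ₗ[A] Y, IsProjectiveMap f)
    ?_ ?_ hY f
  · intro Y _ _ _ f
    rw [show f = 0 from LinearMap.ext fun x => Subsingleton.elim _ _]
    exact .zero
  · intro W Y N _ _ _ _ _ _ i p hi hip hp _ hN ih f
    obtain ⟨P, _, _, _, _, a, b, hab⟩ :=
      hN.isProjectiveMap_to (p ∘ₗ f) fun S hS q => hM S hS _
    obtain ⟨b', hb'⟩ := Module.projective_lifting_property p b hp
    have hle : ∀ x, (f - b' ∘ₗ a) x ∈ LinearMap.range i := fun x => by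
      refine (hip _).mp ?_
      have h1 := LinearMap.congr_fun hab x
      have h2 := LinearMap.congr_fun hb' (a x)
      simp only [LinearMap.comp_apply] at h1 h2
      rw [LinearMap.sub_apply, map_sub, ← h1, LinearMap.comp_apply, h2, sub_self]
    have hf : f = i ∘ₗ ((LinearEquiv.ofInjective i hi).symm.toLinearMap ∘ₗ
        LinearMap.codRestrict _ _ hle) + b' ∘ₗ a := by
      refine LinearMap.ext fun x => ?_
      have h1 := congrArg Subtype.val ((LinearEquiv.ofInjective i hi).apply_symm_apply
        (LinearMap.codRestrict _ _ hle x))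
      exact sub_eq_iff_eq_add.mp h1.symm
    rw [hf]
    exact ((ih _).comp_left i).add (.of_factor _ _)

/-- A stable retract of a filtrable module `K`, if filtrable, is stably isomorphic to a filtrable
module whose length is at most that of `K`. -/
theorem IsStableSystem.exists_filtrable_of_retract (h : IsStableSystem k A 𝒮)
    {K M : FGModuleCat.{u} A} (hK : IsFiltrable 𝒮 K) (hM : IsFiltrable 𝒮 M)
    (i : stabObj k A M ⟶ stabObj k A K) (p : stabObj k A K ⟶ stabObj k A M) (hip : i ≫ p = 𝟙 _) :
    ∃ E : FGModuleCat.{u} A, IsFiltrable 𝒮 E ∧ Module.length A E ≤ Module.length A K ∧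
      Nonempty (stabObj k A M ≅ stabObj k A E) := by
  have : IsNoetherianRing A := IsNoetherianRing.of_finite k A
  have : IsArtinianRing A := IsArtinianRing.of_finite k A
  generalize hn : Module.length A K = n
  induction n using WellFoundedLT.induction generalizing K M with
  | ind n ih =>
  by_cases hv : ∀ S ∈ 𝒮, ∀ q : M →ₗ[A] S, IsProjectiveMap q
  · have h0 : IsZero (stabObj k A M) := by
      rw [IsZero.iff_id_eq_zero, ← stabMap_id, stabMap_eq_zero_iff]
      exact hM.isProjectiveMap hv _
    refine ⟨FGModuleCat.of A PUnit, .of_subsingleton PUnit, ?_,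
      ⟨h0.iso (isZero_stabObj_of_subsingleton k A PUnit)⟩⟩
    exact (Module.length_eq_zero (R := A) (M := PUnit.{u + 1})).trans_le zero_le
  push Not at hv
  obtain ⟨S, hS, v, hv⟩ := hv
  obtain ⟨v', hv', hv's, hv'k⟩ := hM.exists_surjective h hS v hv
  obtain ⟨p, rfl⟩ := stabMap_surjective (M := K) (N := M) k p
  have hvp : ¬ IsProjectiveMap (v ∘ₗ p) := fun h0 => hv <| by
    rw [← stabMap_eq_zero_iff k] at h0 ⊢
    rw [← Category.id_comp (stabMap k v), ← hip, Category.assoc, ← stabMap_comp, h0, comp_zero]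
  obtain ⟨u, hu, hus, huk⟩ := hK.exists_surjective h hS (v ∘ₗ p) hvp
  obtain ⟨δ, hδ⟩ := exists_distinguished (k := k) (LinearMap.ker v').subtype_injective
    (LinearMap.exact_subtype_ker_map v') hv's
  obtain ⟨δ', hδ'⟩ := exists_distinguished (k := k) (LinearMap.ker u).subtype_injective
    (LinearMap.exact_subtype_ker_map u) hus
  have hc : stabMap k u = stabMap k p ≫ stabMap k v' := by
    rw [← stabMap_eq_iff k] at hu hv'
    rw [← hu, stabMap_comp, hv']
  obtain ⟨a, ha1, ha2⟩ := complete_distinguished_triangle_morphism₁ _ _ hδ hδ' i (𝟙 _) (by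
    change stabMap k v' ≫ 𝟙 _ = i ≫ stabMap k u
    rw [hc, reassoc_of% hip, Category.comp_id])
  obtain ⟨b, hb1, hb2⟩ := complete_distinguished_triangle_morphism₁ _ _ hδ' hδ (stabMap k p) (𝟙 _)
    (by
      change stabMap k u ≫ 𝟙 _ = stabMap k p ≫ stabMap k v'
      rw [hc, Category.comp_id])
  let φ : stabTriangle k (LinearMap.ker v').subtype v' δ ⟶
      stabTriangle k (LinearMap.ker u).subtype u δ' := ⟨a, i, 𝟙 _, ha1, by
    change stabMap k v' ≫ 𝟙 _ = i ≫ stabMap k u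
    rw [hc, reassoc_of% hip, Category.comp_id], ha2⟩
  let ψ : stabTriangle k (LinearMap.ker u).subtype u δ' ⟶
      stabTriangle k (LinearMap.ker v').subtype v' δ := ⟨b, stabMap k p, 𝟙 _, hb1, by
    change stabMap k u ≫ 𝟙 _ = stabMap k p ≫ stabMap k v'
    rw [hc, Category.comp_id], hb2⟩
  have hab : IsIso (a ≫ b) := isIso₁_of_isIso₂₃ (φ ≫ ψ) hδ hδ
    (by change IsIso (i ≫ stabMap k p); rw [hip]; infer_instance)
    (by change IsIso (𝟙 (stabObj k A S) ≫ 𝟙 _); infer_instance)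
  obtain ⟨w, -, hw⟩ := hab.out
  have := (h.indecomposable S hS).1
  have hlt : LinearMap.ker u ≠ ⊤ := fun h0 => by
    obtain ⟨y, hy⟩ := exists_ne (0 : S)
    obtain ⟨x, rfl⟩ := hus y
    have hx : x ∈ LinearMap.ker u := h0 ▸ Submodule.mem_top
    exact hy hx
  obtain ⟨E₁, hE₁, hlen, ⟨e⟩⟩ := ih _ (hn ▸ Submodule.length_lt hlt)
    (K := FGModuleCat.of A (LinearMap.ker u)) (M := FGModuleCat.of A (LinearMap.ker v'))
    huk hv'k (w ≫ a) b ((Category.assoc _ _ _).trans hw) rfl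
  obtain ⟨E, u', w', hu', huw', hw', e', -, -⟩ := exists_extension _ hδ e (Iso.refl _)
  refine ⟨E, .of_exact hu' huw' hw' hE₁ (.of_mem hS), ?_, ⟨e'⟩⟩
  rw [← hn, Module.length_eq_add_of_exact u' w' hu' hw' huw',
    Module.length_eq_add_of_exact (LinearMap.ker u).subtype u (Submodule.subtype_injective _) hus
      (LinearMap.exact_subtype_ker_map u)]
  exact add_le_add_left hlen _

/-- In an extension of a direct sum of elements of `𝒮` by a filtrable module of minimal length
in its stable class, this module is a radical submodule. -/
theorem IsStableSystem.isRadicalSubmodule_range (h : IsStableSystem k A 𝒮) {X E N : Type u}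
    [AddCommGroup X] [Module A X] [Module.Finite A X] [AddCommGroup E] [Module A E]
    [Module.Finite A E] [AddCommGroup N] [Module A N] (hX : IsFiltrable 𝒮 X)
    (hmin : ∀ E' : FGModuleCat.{u} A, IsFiltrable 𝒮 E' →
      Nonempty (stabObj k A X ≅ stabObj k A E') → Module.length A X ≤ Module.length A E')
    {u : X →ₗ[A] E} {v : E →ₗ[A] N} (hu : Function.Injective u) (huv : Function.Exact u v)
    (hv : Function.Surjective v) (hN : ModInAdd 𝒮 N)
    (hfac : ∀ S ∈ 𝒮, ∀ r : E →ₗ[A] S, IsProjectiveMap (r ∘ₗ u)) :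
    IsRadicalSubmodule 𝒮 (LinearMap.range u) := by
  have : IsNoetherianRing A := IsNoetherianRing.of_finite k A
  have : IsArtinianRing A := IsArtinianRing.of_finite k A
  refine ⟨⟨hX.of_equiv (LinearEquiv.ofInjective u hu), hN.of_equiv
    ((LinearMap.quotKerEquivOfSurjective v hv).symm ≪≫ₗ
      Submodule.quotEquivOfEq _ _ huv.linearMap_ker_eq)⟩, ?_⟩
  rintro L ⟨hL, hEL⟩ hle
  let φ : (E ⧸ L) →ₗ[A] N := L.liftQ v (hle.trans huv.linearMap_ker_eq.ge)
  have hφ : ∀ x, φ (L.mkQ x) = v x := fun x => rfl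
  obtain ⟨s, hs⟩ := hEL.exists_section h hN φ fun n => by
    obtain ⟨x, rfl⟩ := hv n
    exact ⟨L.mkQ x, rfl⟩
  obtain ⟨P, _, _, _, _, a, b, hab⟩ : IsProjectiveMap (L.mkQ ∘ₗ u) :=
    hEL.isProjectiveMap_to _ fun S hS q => hfac S hS (q ∘ₗ L.mkQ)
  obtain ⟨β, hβ⟩ := Module.projective_lifting_property L.mkQ (b - s ∘ₗ φ ∘ₗ b) L.mkQ_surjective
  have hβr : ∀ y, β y ∈ LinearMap.range u := fun y => by
    refine (huv _).mp ?_
    have h1 : L.mkQ (β y) = b y - s (φ (b y)) := LinearMap.congr_fun hβ y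
    have h2 : φ (s (φ (b y))) = φ (b y) := LinearMap.congr_fun hs _
    rw [← hφ, h1, map_sub, h2, sub_self]
  let e := LinearEquiv.ofInjective u hu
  have he : ∀ y, u (e.symm y) = y.1 := fun y => congrArg Subtype.val (e.apply_symm_apply y)
  let t : X →ₗ[A] X := (e.symm.toLinearMap ∘ₗ LinearMap.codRestrict _ β hβr) ∘ₗ a
  have ht : ∀ x, u (t x) = β (a x) := fun x => he _
  have hc : ∀ x, (u ∘ₗ (LinearMap.id - t)) x ∈ L := fun x => by
    rw [← Submodule.Quotient.mk_eq_zero, ← Submodule.mkQ_apply]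
    have h1 : L.mkQ (β (a x)) = b (a x) - s (φ (b (a x))) := LinearMap.congr_fun hβ (a x)
    have h2 : b (a x) = L.mkQ (u x) := LinearMap.congr_fun hab x
    change L.mkQ (u (x - t x)) = 0
    rw [map_sub, map_sub, ht, h1, h2, hφ, huv.apply_apply_eq_zero, map_zero, sub_zero, sub_self]
  let c : X →ₗ[A] L := LinearMap.codRestrict L _ hc
  let j : L →ₗ[A] X := e.symm.toLinearMap ∘ₗ Submodule.inclusion hle
  have hjc : j ∘ₗ c = LinearMap.id - t := LinearMap.ext fun x => hu (he _)
  have hret : stabMap k c ≫ stabMap k j = 𝟙 (stabObj k A X) := by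
    rw [← stabMap_comp, hjc, ← stabMap_id, stabMap_eq_iff, sub_sub_cancel_left]
    exact (IsProjectiveMap.of_factor _ _).neg
  obtain ⟨E', hE', hlen, hiso⟩ := h.exists_filtrable_of_retract (K := FGModuleCat.of A L)
    (M := FGModuleCat.of A X) hL hX (stabMap k c) (stabMap k j) hret
  have h1 : Module.length A (LinearMap.range u) ≤ Module.length A L :=
    (LinearEquiv.length_eq e).symm.trans_le ((hmin E' hE' hiso).trans hlen)
  by_contra hnot
  have h2 : L.submoduleOf (LinearMap.range u) ≠ ⊤ := fun h0 =>
    hnot (Submodule.comap_subtype_eq_top.mp h0)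
  have h3 := Submodule.length_lt h2
  rw [LinearEquiv.length_eq (Submodule.submoduleOfEquivOfLe hle)] at h3
  exact absurd h1 (not_le.mpr h3)

theorem InAdd.exists_modInAdd {X : Stab k A} (hX : InAdd (stabSet k 𝒮) X) :
    ∃ N : FGModuleCat.{u} A, ModInAdd 𝒮 N ∧ Nonempty (X ≅ stabObj k A N) := by
  obtain ⟨ι, _, s, b, hs, ⟨hb⟩, ⟨e⟩⟩ := hX
  choose S hS hSs using hs
  obtain rfl : (fun j => stabObj k A (S j)) = s := funext hSs
  obtain ⟨hb'⟩ := stabBicone_isBilimit k S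
  exact ⟨FGModuleCat.of A (∀ j, S j), ⟨ι, inferInstance, S, hS, ⟨LinearEquiv.refl A _⟩⟩,
    ⟨e ≪≫ hb.isLimit.conePointUniqueUpToIso hb'.isLimit⟩⟩

theorem IsGeneratingSystem.exists_filtrable_iso (h : IsGeneratingSystem k A 𝒮) (X : Stab k A) :
    ∃ E : FGModuleCat.{u} A, IsFiltrable 𝒮 E ∧ Nonempty (X ≅ stabObj k A E) := by
  obtain ⟨M, rfl⟩ := stab_exists_rep k A X
  obtain ⟨P, hP, hMP⟩ := h.exists_filtrable M
  exact ⟨FGModuleCat.of A (P × M), hMP.of_equiv (LinearEquiv.prodComm A M P),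
    ⟨stabProdIso k P⟩⟩

/-- A distinguished triangle which satisfies the conditions on the first triangle of a filtered
object is isomorphic to the first triangle of a module with a radical filtration. -/
theorem IsGeneratingSystem.exists_gObj (h : IsGeneratingSystem k A 𝒮) (T : Triangle (Stab k A))
    (hT : T ∈ distTriang (Stab k A)) (hadd : InAdd (stabSet k 𝒮) T.obj₃)
    (hs : ∀ S ∈ stabSet k 𝒮, Function.Surjective fun q : T.obj₃ ⟶ S => T.mor₂ ≫ q) :
    ∃ (X : GObj k 𝒮) (b : X.diagram.M 0 ≅ T.obj₂) (c : X.diagram.N 0 ≅ T.obj₃),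
      X.diagram.ε 0 ≫ c.hom = b.hom ≫ T.mor₂ := by
  have : IsArtinianRing A := IsArtinianRing.of_finite k A
  obtain ⟨N, hN, ⟨c⟩⟩ := hadd.exists_modInAdd
  obtain ⟨E₁, ⟨hE₁, ⟨a⟩⟩, hmin⟩ := WellFounded.has_min
    (InvImage.wf (fun E : FGModuleCat.{u} A => Module.length A E) wellFounded_lt)
    {E | IsFiltrable 𝒮 E ∧ Nonempty (T.obj₁ ≅ stabObj k A E)} (h.exists_filtrable_iso T.obj₁)
  obtain ⟨E, u, v, hu, huv, hv, b, hb1, hb2⟩ := exists_extension T hT a c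
  let u' : E₁ →ₗ[A] (⊤ : Submodule A E) := LinearMap.codRestrict _ u fun _ => Submodule.mem_top
  let v' : (⊤ : Submodule A E) →ₗ[A] N := v ∘ₗ Submodule.subtype _
  have hrad : IsRadicalSubmodule 𝒮 (LinearMap.range u') := by
    refine h.toIsStableSystem.isRadicalSubmodule_range (k := k) (v := v') hE₁
      (fun E' hE' ⟨e⟩ => not_lt.mp (hmin E' ⟨hE', ⟨a ≪≫ e⟩⟩))
      (fun x y hxy => hu (congrArg Subtype.val hxy)) (fun z => ?_) (fun n => ?_) hN
      fun S hS r => ?_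
    · refine (huv z.1).trans ⟨?_, ?_⟩
      · rintro ⟨x, hx⟩
        exact ⟨x, Subtype.ext hx⟩
      · rintro ⟨x, rfl⟩
        exact ⟨x, rfl⟩
    · obtain ⟨x, rfl⟩ := hv n
      exact ⟨⟨x, Submodule.mem_top⟩, rfl⟩
    · let r' : E →ₗ[A] S := r ∘ₗ LinearMap.codRestrict ⊤ LinearMap.id fun _ => Submodule.mem_top
      change IsProjectiveMap (r' ∘ₗ u)
      rw [← stabMap_eq_zero_iff k, stabMap_comp]
      obtain ⟨q, hq⟩ := hs _ ⟨S, hS, rfl⟩ (b.hom ≫ stabMap k r')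
      rw [← cancel_epi a.hom, ← reassoc_of% hb1, ← hq, comp_distTriang_mor_zero₁₂_assoc _ hT,
        zero_comp, comp_zero]
  have hrange : (LinearMap.range u).submoduleOf ⊤ = LinearMap.range u' := by
    ext z
    constructor
    · rintro ⟨x, hx⟩
      exact ⟨x, Subtype.ext hx⟩
    · rintro ⟨x, rfl⟩
      exact ⟨x, rfl⟩
  rw [← hrange] at hrad
  obtain ⟨fil, h0, h1, hle, hbot, hfil⟩ := hrad.exists_filtration
  let X : GObj k 𝒮 := ⟨E, fil, h0, hle, hbot, hfil⟩
  let v₀ : X.fil 0 →ₗ[A] N := v ∘ₗ Submodule.subtype _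
  have hv₀ : Function.Surjective v₀ := fun n => by
    obtain ⟨x, rfl⟩ := hv n
    exact ⟨⟨x, by change x ∈ fil 0; rw [h0]; exact Submodule.mem_top⟩, rfl⟩
  have hker : (X.fil 1).submoduleOf (X.fil 0) = LinearMap.ker v₀ := by
    change (fil 1).submoduleOf (fil 0) = _
    rw [h1, ← huv.linearMap_ker_eq]
    rfl
  let c₀ : X.layer 0 ≃ₗ[A] N :=
    Submodule.quotEquivOfEq _ _ hker ≪≫ₗ LinearMap.quotKerEquivOfSurjective v₀ hv₀
  let b₀ : X.fil 0 ≃ₗ[A] E := LinearEquiv.ofTop _ h0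
  refine ⟨X, stabIso k b₀ ≪≫ b.symm, stabIso k c₀ ≪≫ c.symm, ?_⟩
  have key : stabMap k (X.proj 0) ≫ stabMap k c₀.toLinearMap =
      stabMap k b₀.toLinearMap ≫ stabMap k v := by
    rw [← stabMap_comp, ← stabMap_comp]
    rfl
  change stabMap k (X.proj 0) ≫ stabMap k c₀.toLinearMap ≫ c.inv =
    (stabMap k b₀.toLinearMap ≫ b.inv) ≫ T.mor₂
  have hvc : stabMap k v ≫ c.inv = b.inv ≫ T.mor₂ := by
    rw [Iso.comp_inv_eq, Category.assoc, hb2, Iso.inv_hom_id_assoc]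
  rw [reassoc_of% key, hvc, Category.assoc]

end Extension

end

section

open CategoryTheory CategoryTheory.Limits CategoryTheory.Pretriangulated

section

variable {T T' : Type u} [Category.{v} T] [Category.{v} T'] [Preadditive T] [Preadditive T']

theorem InAdd.of_iso {𝒮 : Set T} {X Y : T} (hX : InAdd 𝒮 X) (e : Y ≅ X) : InAdd 𝒮 Y := by
  obtain ⟨ι, hι, s, b, hs, hb, ⟨e'⟩⟩ := hX
  exact ⟨ι, hι, s, b, hs, hb, ⟨e ≪≫ e'⟩⟩

/-- Additive functors preserve finite direct sums. -/
theorem InAdd.map {𝒮 : Set T} {𝒮' : Set T'} (G : T ⥤ T') [G.Additive]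
    (h : ∀ S ∈ 𝒮, ∃ S' ∈ 𝒮', Nonempty (G.obj S ≅ S')) {X : T} (hX : InAdd 𝒮 X) :
    InAdd 𝒮' (G.obj X) := by
  classical
  obtain ⟨ι, _, s, b, hs, ⟨hb⟩, ⟨e⟩⟩ := hX
  have := Fintype.ofFinite ι
  choose s' hs' a using fun j => h (s j) (hs j)
  let b' : Bicone s' :=
    { pt := G.obj b.pt
      π := fun j => G.map (b.π j) ≫ (a j).some.hom
      ι := fun j => (a j).some.inv ≫ G.map (b.ι j)
      ι_π := fun j j' => by
        rw [Category.assoc, ← Category.assoc (G.map _), ← G.map_comp, b.ι_π]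
        split_ifs with hj
        · subst hj
          simp
        · simp }
  refine ⟨ι, inferInstance, s', b', hs', ⟨isBilimitOfTotal b' ?_⟩, ⟨G.mapIso e⟩⟩
  have h1 : ∀ j, b'.π j ≫ b'.ι j = G.map (b.π j ≫ b.ι j) := fun j => by
    simp [b']
  rw [Finset.sum_congr rfl fun j _ => h1 j, ← G.map_sum, IsBilimit.total hb, G.map_id]

end

namespace LayeredHoms

variable {T T' : Type u} [Category.{v} T] [Category.{v} T'] [Preadditive T] [Preadditive T']
  {Obj Obj' : Type w} {layer : Obj → ℕ → T} {layer' : Obj' → ℕ → T'}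

/-- The functor given by additive maps between the groups of homogeneous morphisms which are
compatible with composition. -/
noncomputable def functorOfMaps (L : LayeredHoms layer) (L' : LayeredHoms layer') (F : Obj → Obj')
    (m : ∀ (X Y : Obj) (d : ℕ), L.hom X Y d →+ L'.hom (F X) (F Y) d)
    (hid : ∀ X, m X X 0 ⟨𝟙 _, L.id_mem X⟩ = ⟨𝟙 _, L'.id_mem (F X)⟩)
    (hcomp' : ∀ {X Y Z : Obj} {d e : ℕ} (φ : L.hom X Y d) (ψ : L.hom Y Z e),
      m X Z (e + d) (hcomp φ ψ (e + d) rfl) = hcomp (m X Y d φ) (m Y Z e ψ) (e + d) rfl) :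
    L.Cat ⥤ L'.Cat where
  obj X := ⟨F X.of⟩
  map {X Y} f := DirectSum.map (m X.of Y.of) f
  map_id X := (DirectSum.map_of _ _ _).trans (congrArg homogeneous (hid X.of))
  map_comp {X Y Z} f g := by
    change DirectSum.map _ (compHom _ _ _ f g) =
      compHom _ _ _ (DirectSum.map _ f) (DirectSum.map _ g)
    induction f using hom_induction with
    | h0 => simp
    | h2 f f' hf hf' => simp only [map_add, AddMonoidHom.add_apply, hf, hf']
    | h1 d φ =>
      induction g using hom_induction with
      | h0 => simp
      | h2 f f' hf hf' => simp only [map_add, hf, hf']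
      | h1 e ψ =>
        rw [compHom_homogeneous (L := L) φ ψ rfl]
        simp only [homogeneous, DirectSum.map_of]
        exact (congrArg homogeneous (hcomp' φ ψ)).trans (compHom_homogeneous _ _ rfl).symm

/-- Objects are isomorphic if there are mutually inverse homogeneous morphisms of degree `0`. -/
theorem nonempty_iso {L : LayeredHoms layer} {X Y : Obj} (φ : L.hom X Y 0) (ψ : L.hom Y X 0)
    (h : φ.1 ≫ ψ.1 = 𝟙 _) (h' : ψ.1 ≫ φ.1 = 𝟙 _) :
    Nonempty ((⟨X⟩ : L.Cat) ≅ (⟨Y⟩ : L.Cat)) := by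
  have h1 : hcomp φ ψ 0 rfl = ⟨𝟙 _, L.id_mem X⟩ :=
    Subtype.ext ((congrArg (φ.1 ≫ ·) (L.lift_zero ψ)).trans h)
  have h2 : hcomp ψ φ 0 rfl = ⟨𝟙 _, L.id_mem Y⟩ :=
    Subtype.ext ((congrArg (ψ.1 ≫ ·) (L.lift_zero φ)).trans h')
  exact ⟨⟨homogeneous φ, homogeneous ψ,
    (compHom_homogeneous φ ψ rfl).trans (congrArg homogeneous h1),
    (compHom_homogeneous ψ φ rfl).trans (congrArg homogeneous h2)⟩⟩

end LayeredHoms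

section

variable {T T' : Type u} [Category.{v} T] [Preadditive T] [HasZeroObject T] [HasShift T ℤ]
  [∀ n : ℤ, (shiftFunctor T n).Additive] [Pretriangulated T]
  [Category.{v} T'] [Preadditive T'] [HasZeroObject T'] [HasShift T' ℤ]
  [∀ n : ℤ, (shiftFunctor T' n).Additive] [Pretriangulated T']
  {𝒮 : Set T} {𝒮' : Set T'}

/-- Objects of the category of filtered objects are isomorphic if their first layers are. -/
theorem FObj.nonempty_iso {X Y : FObj 𝒮} (b : X.D.M 0 ≅ Y.D.M 0) (c : X.D.N 0 ≅ Y.D.N 0)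
    (h : X.D.ε 0 ≫ c.hom = b.hom ≫ Y.D.ε 0) :
    Nonempty ((⟨X⟩ : FCat 𝒮) ≅ (⟨Y⟩ : FCat 𝒮)) := by
  have h' : b.inv ≫ X.D.ε 0 = Y.D.ε 0 ≫ c.inv := by
    rw [Iso.inv_comp_eq, ← Category.assoc, ← h, Category.assoc, Iso.hom_inv_id, Category.comp_id]
  exact LayeredHoms.nonempty_iso (L := FObj.homs 𝒮)
    (⟨c.hom, show _ ∈ FDiagram.homDeg _ _ _ from ⟨b.hom, h.symm⟩⟩)
    (⟨c.inv, show _ ∈ FDiagram.homDeg _ _ _ from ⟨b.inv, h'⟩⟩) c.hom_inv_id c.inv_hom_id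

theorem surjective_map_comp {C D : Type*} [Category C] [Category D] (F : C ⥤ D) [F.Full]
    {X Y Z : C} (f : X ⟶ Y) {W : D} (e : F.obj Z ≅ W)
    (hf : Function.Surjective fun q : Y ⟶ Z => f ≫ q) :
    Function.Surjective fun q : F.obj Y ⟶ W => F.map f ≫ q := fun p => by
  obtain ⟨q, hq⟩ := hf (F.preimage (p ≫ e.inv))
  refine ⟨F.map q ≫ e.hom, ?_⟩
  change F.map f ≫ F.map q ≫ e.hom = p
  rw [← F.map_comp_assoc, show f ≫ q = _ from hq, F.map_preimage, Category.assoc, e.inv_hom_id,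
    Category.comp_id]

theorem injective_map_comp {C D : Type*} [Category C] [Category D] (F : C ⥤ D) [F.Full]
    [F.Faithful] {X Y Z : C} (f : X ⟶ Y) {W : D} (e : F.obj Z ≅ W)
    (hf : Function.Injective fun q : Y ⟶ Z => f ≫ q) :
    Function.Injective fun q : F.obj Y ⟶ W => F.map f ≫ q := fun p q hpq => by
  replace hpq : F.map f ≫ p = F.map f ≫ q := hpq
  rw [← cancel_mono e.inv, ← F.map_preimage (p ≫ e.inv), ← F.map_preimage (q ≫ e.inv)]
  refine congrArg F.map (hf (F.map_injective ?_))
  change F.map (f ≫ _) = F.map (f ≫ _)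
  rw [F.map_comp, F.map_comp, F.map_preimage, F.map_preimage, ← Category.assoc, hpq,
    Category.assoc]

variable (E : T ⥤ T') [E.CommShift ℤ]

/-- The image of a diagram under a functor which commutes with the shift. -/
noncomputable def FDiagram.map (D : FDiagram T) : FDiagram T' where
  M i := E.obj (D.M i)
  N i := E.obj (D.N i)
  f i := E.map (D.f i)
  ε i := E.map (D.ε i)
  δ i := E.map (D.δ i) ≫ (E.commShiftIso (1 : ℤ)).hom.app _

/-- The image of a ladder. -/
noncomputable def FDiagram.Ladder.map {D D' : FDiagram T} {d : ℕ} (l : Ladder D D' d) :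
    Ladder (D.map E) (D'.map E) d where
  h i m hi := E.map (l.h i m hi)
  g i m hi := E.map (l.g i m hi)
  comm_f i m hi := (E.map_comp _ _).symm.trans ((congrArg E.map (l.comm_f i m hi)).trans
    (E.map_comp _ _))
  comm_ε i m hi := (E.map_comp _ _).symm.trans ((congrArg E.map (l.comm_ε i m hi)).trans
    (E.map_comp _ _))
  comm_δ i m hi := by
    change (E.map _ ≫ (E.commShiftIso (1 : ℤ)).hom.app _) ≫ (shiftFunctor T' (1 : ℤ)).map _ =
      E.map _ ≫ E.map _ ≫ (E.commShiftIso (1 : ℤ)).hom.app _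
    rw [Category.assoc, ← Functor.commShiftIso_hom_naturality, ← E.map_comp_assoc,
      ← E.map_comp_assoc, l.comm_δ i m hi]

variable [E.IsTriangulated]

theorem FDiagram.IsFiltered.map [E.Full] [E.Faithful] {D : FDiagram T} (hD : D.IsFiltered 𝒮)
    (h : ∀ S ∈ 𝒮, ∃ S' ∈ 𝒮', Nonempty (E.obj S ≅ S'))
    (h' : ∀ S' ∈ 𝒮', ∃ S ∈ 𝒮, Nonempty (E.obj S ≅ S')) : (D.map E).IsFiltered 𝒮' where
  bounded := by
    obtain ⟨r, hr⟩ := hD.bounded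
    exact ⟨r, fun i hi => E.map_isZero (hr i hi)⟩
  distinguished i := E.map_distinguished _ (hD.distinguished i)
  inAdd i := (hD.inAdd i).map E h
  surjective S' hS' := by
    obtain ⟨S, hS, ⟨e⟩⟩ := h' S' hS'
    exact surjective_map_comp E _ e (hD.surjective S hS)
  bijective i hi S' hS' := by
    obtain ⟨S, hS, ⟨e⟩⟩ := h' S' hS'
    exact ⟨injective_map_comp E _ e (hD.bijective i hi S hS).1,
      surjective_map_comp E _ e (hD.bijective i hi S hS).2⟩

variable [E.Full] [E.Faithful] (h : ∀ S ∈ 𝒮, ∃ S' ∈ 𝒮', Nonempty (E.obj S ≅ S'))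
  (h' : ∀ S' ∈ 𝒮', ∃ S ∈ 𝒮, Nonempty (E.obj S ≅ S'))

/-- The image of a filtered object under a fully faithful triangulated functor. -/
noncomputable def FObj.map (X : FObj 𝒮) : FObj 𝒮' := ⟨X.D.map E, X.isFiltered.map E h h'⟩

/-- The map between the groups of homogeneous morphisms given by a triangulated functor. -/
noncomputable def FDiagram.homDegMap (D D' : FDiagram T) (d : ℕ) :
    homDeg D D' d →+ homDeg (D.map E) (D'.map E) d :=
  AddMonoidHom.mk' (fun g => ⟨E.map g.1, by
    obtain ⟨g, h, hh⟩ := g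
    refine ⟨E.map h, ?_⟩
    exact (E.map_comp _ _).symm.trans ((congrArg E.map hh).trans (E.map_comp _ _))⟩)
    fun g g' => Subtype.ext E.map_add

theorem FDiagram.homDegMap_bijective (D D' : FDiagram T) (d : ℕ) :
    Function.Bijective (homDegMap E D D' d) := by
  refine ⟨fun g g' hg => Subtype.ext (E.map_injective (congrArg Subtype.val hg)), ?_⟩
  rintro ⟨g, a, ha⟩
  obtain ⟨g, rfl⟩ := E.map_surjective g
  obtain ⟨a, rfl⟩ := E.map_surjective a
  exact ⟨⟨g, a, E.map_injective ((E.map_comp _ _).trans (ha.trans (E.map_comp _ _).symm))⟩, rfl⟩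

theorem FObj.lift_homDegMap {X Y : FObj 𝒮} {d : ℕ} (g : FDiagram.homDeg X.D Y.D d) (i m : ℕ)
    (hi : d + i = m) :
    FObj.lift (X := X.map E h h') (Y := Y.map E h h') (FDiagram.homDegMap E X.D Y.D d g) i m hi =
      E.map (FObj.lift g i m hi) := by
  obtain ⟨l, hl⟩ := FObj.exists_ladder g
  rw [FObj.lift_eq g l hl]
  have hl' : (l.map E).g 0 d rfl = (FDiagram.homDegMap E X.D Y.D d g).1 := congrArg E.map hl
  exact FObj.lift_eq (X := X.map E h h') (Y := Y.map E h h') _ (l.map E) hl' i m hi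

/-- The functor between categories of filtered objects given by a triangulated functor. -/
noncomputable def FCat.map : FCat 𝒮 ⥤ FCat 𝒮' :=
  LayeredHoms.functorOfMaps (FObj.homs 𝒮) (FObj.homs 𝒮') (FObj.map E h h')
    (fun X Y d => FDiagram.homDegMap E X.D Y.D d)
    (fun _ => Subtype.ext (E.map_id _))
    (fun {_ _ _ d e} φ ψ => Subtype.ext ((E.map_comp _ _).trans
      (congrArg (E.map φ.1 ≫ ·) (FObj.lift_homDegMap E h h' ψ d (e + d) rfl).symm)))

instance : (FCat.map E h h').Faithful where
  map_injective {X Y} := (DirectSum.map_injective _).mpr fun d =>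
    (FDiagram.homDegMap_bijective E X.of.D Y.of.D d).1

instance : (FCat.map E h h').Full where
  map_surjective {X Y} := (DirectSum.map_surjective _).mpr fun d =>
    (FDiagram.homDegMap_bijective E X.of.D Y.of.D d).2

end

section

variable {k : Type w} {A : Type u} [Field k] [Ring A] [Algebra k A] [Module.Finite k A]
  [Module.Injective A A] {𝒮 : Set (FGModuleCat.{u} A)}

instance (h : IsStableSystem k A 𝒮) (hD : ∀ X : GObj k 𝒮, X.diagram.IsFiltered (stabSet k 𝒮)) :
    (canonicalFunctor h hD).Faithful where
  map_injective {_ _} := (DirectSum.map_injective _).mpr fun _ => AddSubgroup.inclusion_injective _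

instance (h : IsStableSystem k A 𝒮) (hD : ∀ X : GObj k 𝒮, X.diagram.IsFiltered (stabSet k 𝒮)) :
    (canonicalFunctor h hD).Full where
  map_surjective {X Y} := (DirectSum.map_surjective _).mpr fun d g =>
    ⟨⟨g.1, GObj.homDeg_diagram_le h X.of Y.of d g.2⟩, rfl⟩

theorem IsGeneratingSystem.isEquivalence_canonicalFunctor (h : IsGeneratingSystem k A 𝒮)
    (hD : ∀ X : GObj k 𝒮, X.diagram.IsFiltered (stabSet k 𝒮)) :
    (canonicalFunctor h.toIsStableSystem hD).IsEquivalence where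
  essSurj := ⟨fun ⟨Y⟩ => by
    obtain ⟨X, b, c, hbc⟩ := h.exists_gObj _ (Y.isFiltered.distinguished 0)
      (Y.isFiltered.inAdd 0) Y.isFiltered.surjective
    exact ⟨⟨X⟩, FObj.nonempty_iso (X := ⟨X.diagram, hD X⟩) (Y := Y) b c hbc⟩⟩

variable {B : Type u} [Ring B] [Algebra k B] [Module.Finite k B] [Module.Injective B B]
  {𝒮' : Set (FGModuleCat.{u} B)}

/-- Every filtered object of the target of a triangulated equivalence is isomorphic to the image of
a module with a radical filtration. -/
theorem IsGeneratingSystem.exists_gObj_map (hA : IsGeneratingSystem k A 𝒮)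
    (E : Stab k A ⥤ Stab k B) [E.CommShift ℤ] [E.IsTriangulated] [E.IsEquivalence]
    (h : ∀ S ∈ stabSet k 𝒮, ∃ S' ∈ stabSet k 𝒮', Nonempty (E.obj S ≅ S'))
    (h' : ∀ S' ∈ stabSet k 𝒮', ∃ S ∈ stabSet k 𝒮, Nonempty (E.obj S ≅ S'))
    (Y : FObj (stabSet k 𝒮')) :
    ∃ (X : GObj k 𝒮) (b : E.obj (X.diagram.M 0) ≅ Y.D.M 0) (c : E.obj (X.diagram.N 0) ≅ Y.D.N 0),
      E.map (X.diagram.ε 0) ≫ c.hom = b.hom ≫ Y.D.ε 0 := by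
  let e₁ := E.objObjPreimageIso (Y.D.M 1)
  let e₀ := E.objObjPreimageIso (Y.D.M 0)
  obtain ⟨f, hf⟩ := E.map_surjective (e₁.hom ≫ Y.D.f 0 ≫ e₀.inv)
  obtain ⟨C, g, δ, hT⟩ := distinguished_cocone_triangle f
  let τ := isoTriangleOfIso₁₂ _ _ (E.map_distinguished _ hT) (Y.isFiltered.distinguished 0) e₁ e₀
    (by
      change E.map f ≫ e₀.hom = e₁.hom ≫ Y.D.f 0
      rw [hf]; simp)
  let e₃ : E.obj C ≅ Y.D.N 0 := Triangle.π₃.mapIso τ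
  have hg : E.map g ≫ e₃.hom = e₀.hom ≫ Y.D.ε 0 := τ.hom.comm₂
  have : E.asEquivalence.functor.Additive := inferInstanceAs E.Additive
  have : E.inv.Additive := E.asEquivalence.inverse_additive
  have hC : InAdd (stabSet k 𝒮) C := by
    refine ((Y.isFiltered.inAdd 0).map (𝒮' := stabSet k 𝒮) E.inv fun S' hS' => ?_).of_iso
      (E.asEquivalence.unitIso.app C ≪≫ E.inv.mapIso e₃)
    obtain ⟨S, hS, ⟨e⟩⟩ := h' S' hS'
    exact ⟨S, hS, ⟨E.inv.mapIso e.symm ≪≫ (E.asEquivalence.unitIso.app S).symm⟩⟩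
  have hsurj : ∀ S ∈ stabSet k 𝒮, Function.Surjective fun r : C ⟶ S => g ≫ r := fun S hS p => by
    obtain ⟨S', hS', ⟨s⟩⟩ := h S hS
    obtain ⟨q, hq⟩ := Y.isFiltered.surjective S' hS' (e₀.inv ≫ E.map p ≫ s.hom)
    replace hq : Y.D.ε 0 ≫ q = e₀.inv ≫ E.map p ≫ s.hom := hq
    refine ⟨E.preimage (e₃.hom ≫ q ≫ s.inv), E.map_injective ((E.map_comp g _).trans ?_)⟩
    rw [E.map_preimage, reassoc_of% hg, reassoc_of% hq, Iso.hom_inv_id_assoc,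
      Iso.hom_inv_id, Category.comp_id]
  obtain ⟨X, b, c, hbc⟩ := hA.exists_gObj (Triangle.mk f g δ) hT hC hsurj
  refine ⟨X, E.mapIso b ≪≫ e₀, E.mapIso c ≪≫ e₃, ?_⟩
  have h1 : E.map (X.diagram.ε 0) ≫ E.map c.hom = E.map b.hom ≫ E.map g :=
    (E.map_comp _ _).symm.trans ((congrArg E.map hbc).trans (E.map_comp _ _))
  exact (Category.assoc _ _ _).symm.trans ((congrArg (· ≫ e₃.hom) h1).trans
    ((Category.assoc _ _ _).trans ((congrArg (E.map b.hom ≫ ·) hg).trans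
      (Category.assoc _ _ _).symm)))

theorem IsGeneratingSystem.nonempty_equivalence (hA : IsGeneratingSystem k A 𝒮)
    (hB : IsGeneratingSystem k B 𝒮') (E : Stab k A ⥤ Stab k B) [E.CommShift ℤ] [E.IsTriangulated]
    [E.IsEquivalence] (h : ∀ S ∈ stabSet k 𝒮, ∃ S' ∈ stabSet k 𝒮', Nonempty (E.obj S ≅ S'))
    (h' : ∀ S' ∈ stabSet k 𝒮', ∃ S ∈ stabSet k 𝒮, Nonempty (E.obj S ≅ S')) :
    Nonempty (GCat hA.toIsStableSystem ≌ GCat hB.toIsStableSystem) := by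
  let F := canonicalFunctor hA.toIsStableSystem (GObj.isFiltered hA.toIsStableSystem) ⋙
    FCat.map E h h'
  have hF : F.IsEquivalence :=
    { faithful := inferInstance
      full := inferInstance
      essSurj := ⟨fun ⟨Y⟩ => by
        obtain ⟨X, b, c, hbc⟩ := hA.exists_gObj_map E h h' Y
        exact ⟨⟨X⟩, FObj.nonempty_iso (X := FObj.map E h h'
          ⟨X.diagram, X.isFiltered hA.toIsStableSystem⟩) (Y := Y) b c hbc⟩⟩ }
  have := hB.isEquivalence_canonicalFunctor (GObj.isFiltered hB.toIsStableSystem)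
  exact ⟨F.asEquivalence.trans (canonicalFunctor hB.toIsStableSystem
    (GObj.isFiltered hB.toIsStableSystem)).asEquivalence.symm⟩

end

end

/-- For a split self-injective algebra without projective simple modules, the canonical functor from
the category of modules with a radical filtration to the category of filtered objects of the stable
category is an equivalence. In particular the former category depends only on the triangulated
stable category and on the image of `𝒮` in it. -/
theorem mainTheorem2 {k : Type w} {A : Type u} [Field k] [Ring A] [Algebra k A]
    [Module.Finite k A] [Module.Injective A A]
    (hsplit : ∀ (S : Type u) [AddCommGroup S] [Module A S] [IsSimpleModule A S] (f : S →ₗ[A] S),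
      ∃ c : k, ∀ x, f x = algebraMap k A c • x)
    (hproj : ∀ (S : Type u) [AddCommGroup S] [Module A S] [IsSimpleModule A S],
      ¬ Module.Projective A S)
    (𝒮 : Set (FGModuleCat.{u} A)) (h𝒮 : IsGeneratingSystem k A 𝒮) :
    (∃ hD : ∀ X : GObj k 𝒮, X.diagram.IsFiltered (stabSet k 𝒮),
      (canonicalFunctor h𝒮.toIsStableSystem hD).IsEquivalence) ∧
    ∀ (B : Type u) [Ring B] [Algebra k B] [Module.Finite k B] [Module.Injective B B],
      (∀ (S : Type u) [AddCommGroup S] [Module B S] [IsSimpleModule B S] (f : S →ₗ[B] S),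
        ∃ c : k, ∀ x, f x = algebraMap k B c • x) →
      (∀ (S : Type u) [AddCommGroup S] [Module B S] [IsSimpleModule B S],
        ¬ Module.Projective B S) →
      ∀ (𝒮' : Set (FGModuleCat.{u} B)) (h𝒮' : IsGeneratingSystem k B 𝒮')
        (E : CategoryTheory.Functor (Stab k A) (Stab k B)) [E.CommShift ℤ] [E.IsTriangulated]
        [E.IsEquivalence],
        (∀ S ∈ stabSet k 𝒮, ∃ S' ∈ stabSet k 𝒮', Nonempty (CategoryTheory.Iso (E.obj S) S')) →
        (∀ S' ∈ stabSet k 𝒮', ∃ S ∈ stabSet k 𝒮, Nonempty (CategoryTheory.Iso (E.obj S) S')) →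
        Nonempty (CategoryTheory.Equivalence (GCat h𝒮.toIsStableSystem)
          (GCat h𝒮'.toIsStableSystem)) := by
  exact ⟨⟨GObj.isFiltered h𝒮.toIsStableSystem, h𝒮.isEquivalence_canonicalFunctor _⟩,
    fun B _ _ _ _ _ _ 𝒮' h𝒮' E _ _ _ h h' => h𝒮.nonempty_equivalence h𝒮' E h h'⟩
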